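/- **Setting.** A link function is a sequence of symmetric functions $L_n:\{1,\dots,n\}^2\to I$ ($n\ge 1$), where $I$ is an index set such as $\mathbb Z_{+}$ or $\mathbb Z_{+}^2$. An input sequence is a family of real random variables $(x_t)_{t\in I}$ satisfying one of: (A1) the $x_t$ are independent, uniformly bounded, with mean $0$ and variance $1$; (A2) the $x_t$ are i.i.d. with mean $0$ and variance $1$; (A3) the $x_t$ are independent with mean $0$, variance $1$ and uniformly bounded moments of all orders. The patterned matrix with link $L$ and input $(x_t)$ is the $n\times n$ matrix $X_n=(x_{L_n(i,j)})_{i,j}$. $L$ has Property B if $\sup_n\sup_t\sup_{k\le n}\#\{l\le n: L_n(k,l)=t\}<\infty$. Let $k_n=\#\{L_n(i,j): i,j\le n\}$ and $\alpha_n=\max_t\#\{(i,j): L_n(i,j)=t\}$; the growth conditions on $L$ are $k_n\to\infty$ and $k_n\alpha_n=O(n^2)$. A circuit of length $h$ is a map $\pi:\{0,\dots,h\}\to\{1,\dots,n\}$ with $\pi(0)=\pi(h)$. For a word $w$ of length $h$, $\Pi_L(w)$ is the set of circuits such that, for all $1\le i,j\le h$, $w[i]=w[j]$ if and only if $L_n(\pi(i-1),\pi(i))=L_n(\pi(j-1),\pi(j))$.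 A word is pair-matched if each of its letters occurs exactly twice. For a probability measure $\mu$ on $\mathbb R$ with distribution function $F$, a sequence of random symmetric matrices $A_n$ has limiting spectral distribution (LSD) $\mu$ almost surely if, almost surely, the empirical distribution functions $F^{A_n}$ of the eigenvalues converge to $F$ at every continuity point of $F$; it has LSD $\mu$ in probability if $F^{A_n}(t)\to F(t)$ in probability for every continuity point $t$ of $F$. $\odot$ denotes the entrywise product. **Proposition.** Let $L_X,L_Y$ be symmetric link functions that satisfy Property B and the growth conditions, and suppose that for every $k$ and all pair-matched words $w,w'$ of length $2k$ the limit $$p_Z(w,w')=\lim_{n\to\infty} n^{-(1+k)}\,\#\big(\Pi_{L_X}(w)\cap\Pi_{L_Y}(w')\big)$$ exists. Let $\rho_1,\rho_2$ be injective transformations of the index sets (they may depend on $n$), and put $L_U=\rho_1\circ L_X$, $L_V=\rho_2\circ L_Y$. Let $(X_n)$, $(Y_n)$ be independent sequences of patterned matrices with links $L_X,L_Y$, and let $(U_n)$, $(V_n)$ be independent sequences of patterned matrices with links $L_U,L_V$ (possibly on another probability space), where each of the four input sequences satisfies (A1), (A2) or (A3). Then there is a probability measure $\mu$ on $\mathbb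 R$ which is the LSD, in probability, both of $n^{-1/2}X_n\odot Y_n$ and of $n^{-1/2}U_n\odot V_n$. Moreover, for each of these two products, $\mu$ is the LSD almost surely if both of its input sequences satisfy (A1) or (A3), or if neither of its two link functions depends on $n$ (that is, each $L_n$ is the restriction of one function on $\mathbb N^2$). -/

import Mathlib

open Filter Topology MeasureTheory ProbabilityTheory Asymptotics
open scoped Matrix

/-- A sequence of link functions `L n : {1, …, n}² → ι`. The index `i : Fin n` stands for the vertex
`i + 1` of `{1, …, n}`. The input variables are indexed by `ι`, for instance `ℕ` or `ℕ × ℕ`. -/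
abbrev Link (ι : Type*) := (n : ℕ) → Fin n → Fin n → ι

namespace Link

variable {ι κ : Type*}

/-- The link function is symmetric, so that the patterned matrices are symmetric. -/
def Symm (L : Link ι) : Prop := ∀ n (i j : Fin n), L n i j = L n j i

/-- Property B: the number of occurrences of any value in any row is uniformly bounded. -/
def PropertyB (L : Link ι) : Prop :=
  ∃ Δ : ℕ, ∀ (n : ℕ) (t : ι) (k : Fin n), {l : Fin n | L n k l = t}.ncard ≤ Δ

/-- The number of distinct values of `L n`. -/
noncomputable def numValues (L : Link ι) (n : ℕ) : ℕ :=
  (Set.range fun p : Fin n × Fin n => L n p.1 p.2).ncard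

/-- The largest number of occurrences of a single value of `L n`. -/
noncomputable def maxMult (L : Link ι) (n : ℕ) : ℕ :=
  Finset.univ.sup fun p : Fin n × Fin n =>
    {q : Fin n × Fin n | L n q.1 q.2 = L n p.1 p.2}.ncard

/-- `k_n → ∞` and `k_n α_n = O(n²)`, where `k_n` is the number of distinct values of `L n` and `α_n`
is the largest multiplicity of a value. -/
def GrowthConditions (L : Link ι) : Prop :=
  Tendsto L.numValues atTop atTop ∧
    (fun n => (L.numValues n : ℝ) * (L.maxMult n : ℝ)) =O[atTop] fun n => (n : ℝ) ^ 2

/-- The link function does not depend on `n`: the functions `L n` are the restrictions of one function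
of two natural variables. -/
def IsConstant (L : Link ι) : Prop :=
  ∃ l : ℕ → ℕ → ι, ∀ n (i j : Fin n), L n i j = l i j

/-- The composition `ρ ∘ L`; the transformation `ρ n` may depend on `n`. -/
def comp (ρ : ℕ → ι → κ) (L : Link ι) : Link κ := fun n i j => ρ n (L n i j)

/-- The circuits `π : {0, …, h} → {1, …, n}`, `π 0 = π h`, whose `L`-values match exactly as the
letters of the word `w` do: `w[i] = w[j]` if and only if
`L (π (i - 1), π i) = L (π (j - 1), π j)`. Letters are numbered by natural numbers; only
the partition of the positions into classes of equal letters matters. -/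
def circuits (L : Link ι) (n : ℕ) {h : ℕ} (w : Fin h → ℕ) : Set (Fin (h + 1) → Fin n) :=
  {π | π 0 = π (Fin.last h) ∧
    ∀ i j : Fin h, w i = w j ↔ L n (π i.castSucc) (π i.succ) = L n (π j.castSucc) (π j.succ)}

end Link

/-- A word is pair-matched if each of its letters occurs exactly twice. -/
def IsPairMatched {h : ℕ} (w : Fin h → ℕ) : Prop := ∀ i, {j | w j = w i}.ncard = 2

/-- The limit `p_Z(w, w') = lim n^{-(1 + k)} #(Π_X(w) ∩ Π_Y(w'))` exists for all pair-matched words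
`w`, `w'` of the same length `2k`. -/
def WordLimitsExist {ι κ : Type*} (LX : Link ι) (LY : Link κ) : Prop :=
  ∀ (k : ℕ) (w w' : Fin (2 * k) → ℕ), IsPairMatched w → IsPairMatched w' →
    ∃ p : ℝ, Tendsto
      (fun n : ℕ => ((LX.circuits n w ∩ LY.circuits n w').ncard : ℝ) / (n : ℝ) ^ (1 + k))
      atTop (𝓝 p)

section Inputs

variable {ι Ω : Type*} [MeasurableSpace Ω]

/-- Independent, uniformly bounded input variables with mean `0` and variance `1`. -/
structure BoundedInput (x : ι → Ω → ℝ) (P : Measure Ω) : Prop where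
  measurable : ∀ k, Measurable (x k)
  indep : iIndepFun x P
  bounded : ∃ C : ℝ, ∀ k, ∀ᵐ ω ∂P, |x k ω| ≤ C
  mean : ∀ k, ∫ ω, x k ω ∂P = 0
  variance : ∀ k, variance (x k) P = 1

/-- Independent and identically distributed input variables with mean `0` and variance `1`. -/
structure IIDInput (x : ι → Ω → ℝ) (P : Measure Ω) : Prop where
  measurable : ∀ k, Measurable (x k)
  indep : iIndepFun x P
  identDistrib : ∀ k l, IdentDistrib (x k) (x l) P P
  memLp : ∀ k, MemLp (x k) 2 P
  mean : ∀ k, ∫ ω, x k ω ∂P = 0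
  variance : ∀ k, variance (x k) P = 1

/-- Independent input variables with mean `0`, variance `1`, and moments of all orders that are
bounded uniformly in the variable. -/
structure MomentInput (x : ι → Ω → ℝ) (P : Measure Ω) : Prop where
  measurable : ∀ k, Measurable (x k)
  indep : iIndepFun x P
  moments : ∀ p : ℕ, ∃ C : ℝ, ∀ k,
    Integrable (fun ω => |x k ω| ^ p) P ∧ ∫ ω, |x k ω| ^ p ∂P ≤ C
  mean : ∀ k, ∫ ω, x k ω ∂P = 0
  variance : ∀ k, variance (x k) P = 1

/-- The (unscaled) patterned random matrix with link `L` and input `x`. -/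
def patternedMatrix (L : Link ι) (x : ι → Ω → ℝ) (n : ℕ) (ω : Ω) : Matrix (Fin n) (Fin n) ℝ :=
  Matrix.of fun i j => x (L n i j) ω

/-- The two sequences of patterned random matrices are independent. -/
def IndepPatterned {κ : Type*} (LX : Link ι) (x : ι → Ω → ℝ) (LY : Link κ) (y : κ → Ω → ℝ)
    (P : Measure Ω) : Prop :=
  IndepFun (fun ω (n : ℕ) (i j : Fin n) => patternedMatrix LX x n ω i j)
    (fun ω (n : ℕ) (i j : Fin n) => patternedMatrix LY y n ω i j) P

/-- The matrix `n^{-1/2} (X_n ⊙ Y_n)`, the scaled entrywise product of two patterned matrices. -/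
noncomputable def scaledHadamard {κ : Type*} (LX : Link ι) (x : ι → Ω → ℝ)
    (LY : Link κ) (y : κ → Ω → ℝ) (n : ℕ) (ω : Ω) : Matrix (Fin n) (Fin n) ℝ :=
  (Real.sqrt n)⁻¹ • (patternedMatrix LX x n ω ⊙ patternedMatrix LY y n ω)

/-- The distribution function of the empirical spectral distribution of an `n × n` real matrix all of
whose eigenvalues are real: the proportion of eigenvalues, with multiplicity, in `(-∞, t]`. -/
noncomputable def esdCDF {n : ℕ} (A : Matrix (Fin n) (Fin n) ℝ) (t : ℝ) : ℝ :=
  (A.charpoly.roots.countP (· ≤ t) : ℝ) / n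

/-- The empirical spectral distributions of `A n` converge weakly, almost surely, to `μ`. -/
def HasLSDAlmostSurely (A : (n : ℕ) → Ω → Matrix (Fin n) (Fin n) ℝ) (μ : Measure ℝ)
    (P : Measure Ω) : Prop :=
  ∀ᵐ ω ∂P, ∀ t : ℝ, ContinuousAt (cdf μ) t →
    Tendsto (fun n => esdCDF (A n ω) t) atTop (𝓝 (cdf μ t))

/-- The empirical spectral distributions of `A n` converge weakly, in probability, to `μ`. -/
def HasLSDInProbability (A : (n : ℕ) → Ω → Matrix (Fin n) (Fin n) ℝ) (μ : Measure ℝ)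
    (P : Measure Ω) : Prop :=
  ∀ t : ℝ, ContinuousAt (cdf μ) t →
    TendstoInMeasure P (fun n ω => esdCDF (A n ω) t) atTop (fun _ => cdf μ t)

end Inputs

/-! For inputs with uniformly bounded moments of all orders the proof is the moment method. The
trace of a power of `X ⊙ Y` is a sum over circuits, and the independence of `X` and `Y` factors the
expectation of each term. A circuit contributes zero if a letter occurs once in one of its two
words, and one if both words are pair-matched. In the remaining circuits all letters repeat and one
word has a letter occurring more than twice; Property B leaves at most `Δ` choices for a vertex that
repeats an old letter, so these circuits are too few by a factor `√n`
(`Link.ncard_nonPairPaths_le`). Hence the expected spectral distributions have odd moments tending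
to zero and `2k`-th moments tending to `β k`, the sum of `p_Z(w, w')` over canonical pair-matched
words. Circuits see a link only through equality of its values, so injective relabelling does not
change `β`. As `β k ≤ (8kΔ)^k`, the moments determine the limit `μ`, which is found through
characteristic functions (`exists_tendsto_of_hasMomentLimits`).

The passage from expectations to almost sure convergence is a concentration argument. The functional
`n⁻¹ ∑ (λᵢ - t)⁺` is convex in the matrix, and a supporting functional
(`exists_support_sum_posPart`) controls the positive parts of all its increments under resampling
one variable at once. Two applications of the Efron–Stein inequality bound its fourth central moment
by a constant times `R⁸ / n²` when the inputs are clipped at `R`. With `R = n^(1/16)` this is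
summable, and the clipping is almost surely invisible for large `n`. Differences of such functionals
are ramps, which squeeze the distribution function.

An i.i.d. input with only two moments is replaced by a bounded standardized function of itself that
is close in `L²`. By `esdCDF_le_of_sub` the change of the distribution function is governed by the
average over the entries of `min n (difference²)`: large entries are paid for by rank, the others by
the Frobenius norm. The expectation of this average is small, which suffices in probability. For
links that do not depend on `n` the matrices are nested, so sizes `2 ^ m` suffice; there the
variances of the averages are summable because `∑ 2⁻ᵐ min(2ᵐ, z)² ≤ 6 z`, and the replacement is
harmless almost surely. -/

/-! ### Spectral decomposition and perturbation of eigenvalue counts -/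

lemma quadForm_eq_sum_sq {n : ℕ} {C : Matrix (Fin n) (Fin n) ℝ} {l : Fin n → ℝ}
    {z : Fin n → Fin n → ℝ} (hC : ∀ i j, C i j = ∑ k, l k * (z k i * z k j)) (v : Fin n → ℝ) :
    ∑ i, ∑ j, v i * C i j * v j = ∑ k, l k * (∑ i, z k i * v i) ^ 2 := by
  simp_rw [hC, pow_two, Finset.sum_mul_sum, Finset.mul_sum, Finset.sum_mul]
  rw [Finset.sum_congr rfl fun i _ => Finset.sum_comm, Finset.sum_comm]
  refine Finset.sum_congr rfl fun k _ => Finset.sum_congr rfl fun i _ =>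
    Finset.sum_congr rfl fun j _ => by ring

lemma sum_sq_eq_sum_sq {n : ℕ} {z : Fin n → Fin n → ℝ}
    (hz : ∀ i j, ∑ k, z k i * z k j = if i = j then 1 else 0) (v : Fin n → ℝ) :
    ∑ i, v i ^ 2 = ∑ k, (∑ i, z k i * v i) ^ 2 := by
  have := quadForm_eq_sum_sq (C := 1) (l := fun _ => 1) (z := z)
    (fun i j => by simp [hz, Matrix.one_apply]) v
  simpa [Matrix.one_apply, pow_two] using this

namespace Matrix.IsHermitian

variable {n : ℕ} {A B : Matrix (Fin n) (Fin n) ℝ}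

lemma exists_orthogonal_diagonalization (hA : A.IsHermitian) :
    ∃ u : Fin n → Fin n → ℝ, (∀ k l, ∑ i, u k i * u l i = if k = l then 1 else 0) ∧
      (∀ i j, ∑ k, u k i * u k j = if i = j then 1 else 0) ∧
      ∀ i j, A i j = ∑ k, hA.eigenvalues k * (u k i * u k j) := by
  refine ⟨fun k i => hA.eigenvectorUnitary.1 i k, fun k l => ?_, fun i j => ?_, fun i j => ?_⟩
  · have := congrFun (congrFun (Unitary.coe_star_mul_self hA.eigenvectorUnitary) k) l
    simpa [Matrix.mul_apply, Matrix.one_apply, Matrix.star_apply] using this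
  · have := congrFun (congrFun (Unitary.coe_mul_star_self hA.eigenvectorUnitary) i) j
    simpa [Matrix.mul_apply, Matrix.one_apply, Matrix.star_apply] using this
  · conv_lhs => rw [hA.spectral_theorem, Unitary.conjStarAlgAut_apply]
    rw [Matrix.mul_apply]
    refine Finset.sum_congr rfl fun k _ => ?_
    simp [Matrix.mul_apply, Matrix.diagonal_apply, Matrix.star_apply]
    ring

lemma sum_eigenvalues_pow (hA : A.IsHermitian) (h : ℕ) :
    ∑ k, hA.eigenvalues k ^ h = (A ^ h).trace := by
  conv_rhs => rw [hA.spectral_theorem, ← map_pow, Unitary.conjStarAlgAut_apply, Matrix.trace_mul_cycle,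
    Unitary.coe_star_mul_self, one_mul, Matrix.diagonal_pow]
  simp [Matrix.trace]

lemma sum_eigenvalues_sq (hA : A.IsHermitian) :
    ∑ k, hA.eigenvalues k ^ 2 = ∑ i, ∑ j, A i j ^ 2 := by
  rw [hA.sum_eigenvalues_pow, pow_two, Matrix.trace]
  refine Finset.sum_congr rfl fun i _ => ?_
  rw [Matrix.diag_apply, Matrix.mul_apply]
  refine Finset.sum_congr rfl fun j _ => ?_
  have := hA.apply i j
  simp at this
  rw [this, pow_two]

lemma countP_roots_charpoly (hA : A.IsHermitian) (p : ℝ → Prop) [DecidablePred p] :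
    A.charpoly.roots.countP p = (Finset.univ.filter fun i => p (hA.eigenvalues i)).card := by
  rw [hA.roots_charpoly_eq_eigenvalues, Multiset.countP_map, ← Finset.filter_val, Finset.card_val]
  rfl

/-- If the quadratic form of `A - B` is at most `δ‖v‖²` on a subspace of codimension at most `r`, then
`A` has at most `r` more eigenvalues above `t + δ` than `B` above `t`. -/
lemma card_eigenvalues_gt_le (hA : A.IsHermitian) (hB : B.IsHermitian) {κ : Type*} [Fintype κ]
    (a : κ → Fin n → ℝ) {t δ : ℝ}
    (h : ∀ v : Fin n → ℝ, (∀ k, ∑ i, a k i * v i = 0) →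
      ∑ i, ∑ j, v i * (A i j - B i j) * v j ≤ δ * ∑ i, v i ^ 2) :
    (Finset.univ.filter fun i => t + δ < hA.eigenvalues i).card ≤
      (Finset.univ.filter fun i => t < hB.eigenvalues i).card + Fintype.card κ := by
  obtain ⟨u, hu1, hu2, hu⟩ := hA.exists_orthogonal_diagonalization
  obtain ⟨w, hw1, hw2, hw⟩ := hB.exists_orthogonal_diagonalization
  by_contra! hlt
  let S := {i // ¬ t + δ < hA.eigenvalues i}
  let T := {i // t < hB.eigenvalues i}
  -- If the bound failed, these would be fewer than `n` linear equations. A nonzero solution `v`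
  -- lies in the span of the eigenvectors of `A` above `t + δ`, in that of the eigenvectors of `B`
  -- up to `t`, and in the given subspace, so the quadratic form of `A - B` at `v` would exceed
  -- `δ‖v‖²`.
  let f : (Fin n → ℝ) →ₗ[ℝ] ((S ⊕ T) ⊕ κ → ℝ) :=
    LinearMap.pi fun s => Sum.elim (Sum.elim (fun k => ∑ i, u k.1 i • LinearMap.proj i)
      (fun k => ∑ i, w k.1 i • LinearMap.proj i)) (fun k => ∑ i, a k i • LinearMap.proj i) s
  have hcard : Module.finrank ℝ ((S ⊕ T) ⊕ κ → ℝ) < Module.finrank ℝ (Fin n → ℝ) := by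
    simp only [Module.finrank_fintype_fun_eq_card, Fintype.card_sum, S, T, Fintype.card_subtype,
      Fintype.card_fin]
    have := Finset.card_filter_add_card_filter_not (s := (Finset.univ : Finset (Fin n)))
      (fun i => t + δ < hA.eigenvalues i)
    simp only [Finset.card_univ, Fintype.card_fin] at this
    omega
  obtain ⟨v, hv, hv0⟩ := (Submodule.ne_bot_iff _).1 (LinearMap.ker_ne_bot_of_finrank_lt (f := f) hcard)
  have hf : ∀ s, f v s = 0 := fun s => congrFun (LinearMap.mem_ker.1 hv) s
  have hS : ∀ k, ¬ t + δ < hA.eigenvalues k → ∑ i, u k i * v i = 0 := fun k hk => by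
    simpa [f] using hf (Sum.inl (Sum.inl ⟨k, hk⟩))
  have hT : ∀ k, t < hB.eigenvalues k → ∑ i, w k i * v i = 0 := fun k hk => by
    simpa [f] using hf (Sum.inl (Sum.inr ⟨k, hk⟩))
  have hK : ∀ k, ∑ i, a k i * v i = 0 := fun k => by simpa [f] using hf (Sum.inr k)
  have quad := fun C l z hC => quadForm_eq_sum_sq (C := C) (l := l) (z := z) hC v
  have norm := fun z hz => sum_sq_eq_sum_sq (z := z) hz v
  have hpos : 0 < ∑ i, v i ^ 2 := by
    refine lt_of_le_of_ne (Finset.sum_nonneg fun i _ => sq_nonneg _) fun h0 => hv0 ?_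
    ext i
    have := (Finset.sum_eq_zero_iff_of_nonneg (fun i _ => sq_nonneg (v i))).1 h0.symm i (Finset.mem_univ _)
    simpa using this
  have hAv : (t + δ) * ∑ i, v i ^ 2 < ∑ i, ∑ j, v i * A i j * v j := by
    rw [quad A _ u hu, norm u hu2, Finset.mul_sum]
    have hle : ∀ k, (t + δ) * (∑ i, u k i * v i) ^ 2 ≤ hA.eigenvalues k * (∑ i, u k i * v i) ^ 2 := by
      intro k
      by_cases hk : t + δ < hA.eigenvalues k
      · exact mul_le_mul_of_nonneg_right hk.le (sq_nonneg _)
      · simp [hS k hk]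
    refine Finset.sum_lt_sum (fun k _ => hle k) ?_
    -- Equality would force every coefficient of `v` above `t + δ` to vanish as well, hence `v = 0`.
    by_contra! hcon
    rw [norm u hu2] at hpos
    refine hpos.ne' (Finset.sum_eq_zero fun k _ => ?_)
    by_cases hk : t + δ < hA.eigenvalues k
    · have := hcon k (Finset.mem_univ _)
      nlinarith [sq_nonneg (∑ i, u k i * v i)]
    · simp [hS k hk]
  have hBv : ∑ i, ∑ j, v i * B i j * v j ≤ t * ∑ i, v i ^ 2 := by
    rw [quad B _ w hw, norm w hw2, Finset.mul_sum]
    refine Finset.sum_le_sum fun k _ => ?_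
    by_cases hk : t < hB.eigenvalues k
    · simp [hT k hk]
    · exact mul_le_mul_of_nonneg_right (not_lt.1 hk) (sq_nonneg _)
  have hD := h v hK
  have : ∑ i, ∑ j, v i * (A i j - B i j) * v j =
      ∑ i, ∑ j, v i * A i j * v j - ∑ i, ∑ j, v i * B i j * v j := by
    simp_rw [← Finset.sum_sub_distrib]
    refine Finset.sum_congr rfl fun i _ => Finset.sum_congr rfl fun j _ => by ring
  linarith

/-- A supporting functional at `A` of the convex function `A ↦ ∑ (λᵢ(A) - t)⁺`. -/
lemma exists_support_sum_posPart (hA : A.IsHermitian) (t : ℝ) :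
    ∃ Q : Fin n → Fin n → ℝ, ∑ i, ∑ j, Q i j ^ 2 ≤ n ∧
      ∀ {B : Matrix (Fin n) (Fin n) ℝ} (hB : B.IsHermitian),
        ∑ k, max (hA.eigenvalues k - t) 0 - ∑ k, max (hB.eigenvalues k - t) 0 ≤
          ∑ i, ∑ j, Q i j * (A i j - B i j) := by
  obtain ⟨u, hu1, hu2, hu⟩ := hA.exists_orthogonal_diagonalization
  -- `Q` is the spectral projection of `A` above `t`. Its squared Frobenius norm is its rank; `tr
  -- Q(A - t)` equals the sum of positive parts for `A`, while `0 ≤ Q ≤ 1` gives only `≤` for `B`.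
  let q : Fin n → ℝ := fun k => if t < hA.eigenvalues k then 1 else 0
  have hq0 : ∀ k, 0 ≤ q k := fun k => by simp only [q]; split_ifs <;> norm_num
  have hq1 : ∀ k, q k ≤ 1 := fun k => by simp only [q]; split_ifs <;> norm_num
  have pair : ∀ (l : Fin n → ℝ) (z : Fin n → Fin n → ℝ) (C : Matrix (Fin n) (Fin n) ℝ),
      (∀ i j, C i j = ∑ m, l m * (z m i * z m j)) →
      ∑ i, ∑ j, (∑ k, q k * (u k i * u k j)) * C i j =
        ∑ k, ∑ m, q k * l m * (∑ i, u k i * z m i) ^ 2 := by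
    intro l z C hC
    simp_rw [hC, pow_two, Finset.sum_mul_sum, Finset.mul_sum]
    rw [Finset.sum_congr rfl fun i _ => Finset.sum_comm, Finset.sum_comm]
    refine Finset.sum_congr rfl fun k _ => ?_
    rw [Finset.sum_congr rfl fun i _ => Finset.sum_comm, Finset.sum_comm]
    refine Finset.sum_congr rfl fun m _ => Finset.sum_congr rfl fun i _ =>
      Finset.sum_congr rfl fun j _ => by ring
  have horth : ∀ k m, (∑ i, u k i * u m i) ^ 2 = if k = m then 1 else 0 := fun k m => by
    rw [hu1]; split_ifs <;> norm_num
  refine ⟨fun i j => ∑ k, q k * (u k i * u k j), ?_, fun {B} hB => ?_⟩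
  · have := pair q u (fun i j => ∑ k, q k * (u k i * u k j)) (fun _ _ => rfl)
    simp only [horth, mul_ite, mul_one, mul_zero, Finset.sum_ite_eq, Finset.mem_univ, if_true] at this
    simp_rw [pow_two, this]
    calc ∑ k, q k * q k ≤ ∑ _k : Fin n, (1 : ℝ) :=
          Finset.sum_le_sum fun k _ => mul_le_one₀ (hq1 k) (hq0 k) (hq1 k)
      _ = n := by simp
  · obtain ⟨w, hw1, hw2, hw⟩ := hB.exists_orthogonal_diagonalization
    have hI := pair (fun _ => 1) w 1 (fun i j => by simp [hw2, Matrix.one_apply])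
    have hIA := pair (fun _ => 1) u 1 (fun i j => by simp [hu2, Matrix.one_apply])
    have hPA := pair _ u A hu
    have hPB := pair _ w B hw
    have hAeq : ∑ k, max (hA.eigenvalues k - t) 0 =
        ∑ i, ∑ j, (∑ k, q k * (u k i * u k j)) * A i j
          - t * ∑ i, ∑ j, (∑ k, q k * (u k i * u k j)) * (1 : Matrix (Fin n) (Fin n) ℝ) i j := by
      rw [hPA, hIA]
      simp only [horth, mul_ite, mul_one, mul_zero, Finset.sum_ite_eq, Finset.mem_univ, if_true]
      rw [Finset.mul_sum, ← Finset.sum_sub_distrib]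
      refine Finset.sum_congr rfl fun k _ => ?_
      by_cases hk : t < hA.eigenvalues k
      · simp [q, hk, hk.le]
      · simp [q, hk, not_lt.1 hk]
    have hsum : ∀ m, ∑ k, (∑ i, u k i * w m i) ^ 2 = 1 := by
      intro m
      have : ∑ k, (∑ i, u k i * w m i) ^ 2 = ∑ i, ∑ j, (∑ k, u k i * u k j) * (w m i * w m j) := by
        simp_rw [pow_two, Finset.sum_mul_sum, Finset.sum_mul]
        rw [Finset.sum_comm]
        refine Finset.sum_congr rfl fun i _ => ?_
        rw [Finset.sum_comm]
        refine Finset.sum_congr rfl fun j _ => Finset.sum_congr rfl fun k _ => by ring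
      rw [this]
      simp [hu2, hw1]
    have hBle : ∑ i, ∑ j, (∑ k, q k * (u k i * u k j)) * B i j
          - t * ∑ i, ∑ j, (∑ k, q k * (u k i * u k j)) * (1 : Matrix (Fin n) (Fin n) ℝ) i j
        ≤ ∑ k, max (hB.eigenvalues k - t) 0 := by
      rw [hPB, hI, Finset.mul_sum, ← Finset.sum_sub_distrib]
      calc ∑ k, ((∑ m, q k * hB.eigenvalues m * (∑ i, u k i * w m i) ^ 2)
              - t * ∑ m, q k * 1 * (∑ i, u k i * w m i) ^ 2)
          = ∑ k, ∑ m, q k * (hB.eigenvalues m - t) * (∑ i, u k i * w m i) ^ 2 := by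
            refine Finset.sum_congr rfl fun k _ => ?_
            rw [Finset.mul_sum, ← Finset.sum_sub_distrib]
            exact Finset.sum_congr rfl fun m _ => by ring
        _ ≤ ∑ k, ∑ m, max (hB.eigenvalues m - t) 0 * (∑ i, u k i * w m i) ^ 2 := by
            refine Finset.sum_le_sum fun k _ => Finset.sum_le_sum fun m _ =>
              mul_le_mul_of_nonneg_right ?_ (sq_nonneg _)
            calc q k * (hB.eigenvalues m - t) ≤ q k * max (hB.eigenvalues m - t) 0 :=
                  mul_le_mul_of_nonneg_left (le_max_left _ _) (hq0 k)
              _ ≤ 1 * max (hB.eigenvalues m - t) 0 :=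
                  mul_le_mul_of_nonneg_right (hq1 k) (le_max_right _ _)
              _ = _ := one_mul _
        _ = ∑ m, max (hB.eigenvalues m - t) 0 := by
            rw [Finset.sum_comm]
            refine Finset.sum_congr rfl fun m _ => ?_
            rw [← Finset.mul_sum, hsum, mul_one]
    have hsub : ∑ i, ∑ j, (∑ k, q k * (u k i * u k j)) * (A i j - B i j) =
        ∑ i, ∑ j, (∑ k, q k * (u k i * u k j)) * A i j
          - ∑ i, ∑ j, (∑ k, q k * (u k i * u k j)) * B i j := by
      simp_rw [← Finset.sum_sub_distrib, mul_sub]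
    rw [hsub]
    linarith

lemma antitone_lt_iff {m : ℕ} {f : Fin m → ℝ} (hf : Antitone f) (s : ℝ) (i : Fin m) :
    s < f i ↔ i.val < (Finset.univ.filter fun j => s < f j).card := by
  constructor
  · intro h
    have : Finset.Iic i ⊆ Finset.univ.filter fun j => s < f j := fun j hj => by
      simpa using h.trans_le (hf (Finset.mem_Iic.1 hj))
    have := Finset.card_le_card this
    rw [Fin.card_Iic] at this
    omega
  · intro h
    by_contra hs
    have : (Finset.univ.filter fun j => s < f j) ⊆ Finset.Iio i := fun j hj => by
      simp only [Finset.mem_filter, Finset.mem_univ, true_and] at hj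
      rw [Finset.mem_Iio]
      by_contra hij
      exact hs (hj.trans_le (hf (not_lt.1 hij)))
    have := Finset.card_le_card this
    rw [Fin.card_Iio] at this
    omega

lemma card_eigenvalues₀_gt (hA : A.IsHermitian) (s : ℝ) :
    (Finset.univ.filter fun j => s < hA.eigenvalues₀ j).card =
      (Finset.univ.filter fun j => s < hA.eigenvalues j).card := by
  rw [← hA.countP_roots_charpoly, hA.roots_charpoly_eq_eigenvalues₀, Multiset.countP_map,
    ← Finset.filter_val, Finset.card_val]
  rfl

/-- The counting inequality without any constraint, with `δ` the entrywise `ℓ¹` distance, since `|vᵢ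
vⱼ| ≤ ‖v‖²`. This crude Lipschitz bound is only needed to make the ordered eigenvalues continuous,
hence measurable. -/
lemma eigenvalues₀_sub_le (hA : A.IsHermitian) (hB : B.IsHermitian) (i) :
    hA.eigenvalues₀ i - ∑ i, ∑ j, |A i j - B i j| ≤ hB.eigenvalues₀ i := by
  refine le_of_forall_lt fun t ht => ?_
  rw [antitone_lt_iff hB.eigenvalues₀_antitone, card_eigenvalues₀_gt]
  have h1 : t + ∑ i, ∑ j, |A i j - B i j| < hA.eigenvalues₀ i := by linarith
  rw [antitone_lt_iff hA.eigenvalues₀_antitone, card_eigenvalues₀_gt] at h1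
  refine h1.trans_le ((hA.card_eigenvalues_gt_le hB (κ := Empty) (fun k => k.elim)
    fun v _ => ?_).trans (by simp))
  simp_rw [Finset.sum_mul]
  refine Finset.sum_le_sum fun i _ => Finset.sum_le_sum fun j _ => ?_
  have hi : v i ^ 2 ≤ ∑ i, v i ^ 2 :=
    Finset.single_le_sum (f := fun i => v i ^ 2) (fun i _ => sq_nonneg _) (Finset.mem_univ i)
  have hj : v j ^ 2 ≤ ∑ i, v i ^ 2 :=
    Finset.single_le_sum (f := fun i => v i ^ 2) (fun i _ => sq_nonneg _) (Finset.mem_univ j)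
  have hij : |v i * v j| ≤ ∑ i, v i ^ 2 := by
    rw [abs_le]
    constructor <;> nlinarith [sq_nonneg (v i + v j), sq_nonneg (v i - v j)]
  calc v i * (A i j - B i j) * v j ≤ |v i * (A i j - B i j) * v j| := le_abs_self _
    _ = |A i j - B i j| * |v i * v j| := by simp only [abs_mul]; ring
    _ ≤ _ := mul_le_mul_of_nonneg_left hij (abs_nonneg _)

lemma continuous_eigenvalues₀ (e) :
    Continuous fun a : {a : Fin n → Fin n → ℝ // (Matrix.of a).IsHermitian} =>
      a.2.eigenvalues₀ e := by
  rw [continuous_iff_continuousAt]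
  intro a
  have h0 : Tendsto (fun b : {a : Fin n → Fin n → ℝ // (Matrix.of a).IsHermitian} =>
      ∑ i, ∑ j, |b.1 i j - a.1 i j|) (𝓝 a) (𝓝 0) := by
    have : Continuous fun b : {a : Fin n → Fin n → ℝ // (Matrix.of a).IsHermitian} =>
        ∑ i, ∑ j, |b.1 i j - a.1 i j| := by
      refine continuous_finsetSum _ fun i _ => continuous_finsetSum _ fun j _ => ?_
      exact (((continuous_apply_apply i j).comp continuous_subtype_val).sub continuous_const).abs
    simpa using this.tendsto a
  rw [ContinuousAt, tendsto_iff_norm_sub_tendsto_zero]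
  refine squeeze_zero (fun _ => norm_nonneg _) (fun b => ?_) h0
  rw [Real.norm_eq_abs, abs_le]
  have h1 := b.2.eigenvalues₀_sub_le a.2 e
  have h2 := a.2.eigenvalues₀_sub_le b.2 e
  simp only [Matrix.of_apply] at h1 h2
  simp_rw [abs_sub_comm (a.1 _ _)] at h2
  constructor <;> linarith

lemma _root_.Continuous.measurable_subtype_mk {Ω X : Type*} [MeasurableSpace Ω]
    [TopologicalSpace X] [MeasurableSpace X] [BorelSpace X] {p : X → Prop}
    {F : {a // p a} → ℝ} (hF : Continuous F) {a : Ω → X} (hp : ∀ ω, p (a ω)) (ha : Measurable a) :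
    Measurable fun ω => F ⟨a ω, hp ω⟩ :=
  hF.measurable.comp (ha.subtype_mk (h := hp))

lemma measurable_eigenvalues₀ {Ω : Type*} [MeasurableSpace Ω] {a : Ω → Fin n → Fin n → ℝ}
    (hA : ∀ ω, (Matrix.of (a ω)).IsHermitian) (ha : Measurable a) (k) :
    Measurable fun ω => (hA ω).eigenvalues₀ k :=
  (continuous_eigenvalues₀ k).measurable_subtype_mk (p := fun a => (Matrix.of a).IsHermitian) hA ha

lemma measurable_eigenvalues {Ω : Type*} [MeasurableSpace Ω] {A : Ω → Matrix (Fin n) (Fin n) ℝ}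
    (hA : ∀ ω, (A ω).IsHermitian) (hm : ∀ i j, Measurable fun ω => A ω i j) (k : Fin n) :
    Measurable fun ω => (hA ω).eigenvalues k :=
  measurable_eigenvalues₀ (a := fun ω i j => A ω i j) hA
    (measurable_pi_iff.2 fun i => measurable_pi_iff.2 fun j => hm i j) _

lemma esdCDF_eq (hA : A.IsHermitian) (hn : n ≠ 0) (t : ℝ) :
    esdCDF A t = 1 - ((Finset.univ.filter fun i => t < hA.eigenvalues i).card : ℝ) / n := by
  have hn' : (n : ℝ) ≠ 0 := Nat.cast_ne_zero.2 hn
  rw [esdCDF, hA.countP_roots_charpoly, eq_sub_iff_add_eq, ← add_div, div_eq_one_iff_eq hn']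
  have := Finset.card_filter_add_card_filter_not (s := (Finset.univ : Finset (Fin n)))
    (fun i => hA.eigenvalues i ≤ t)
  simp only [not_le, Finset.card_univ, Fintype.card_fin] at this
  exact_mod_cast this

/-- Truncated perturbation bound for the empirical distribution function: large entries of the
difference are controlled by the rank, the others by the Frobenius norm. -/
lemma esdCDF_le_of_sub (hA : A.IsHermitian) (hB : B.IsHermitian) (hn : n ≠ 0) (t : ℝ) {δ : ℝ}
    (hδ : 0 < δ) :
    esdCDF ((Real.sqrt n)⁻¹ • A) t ≤ esdCDF ((Real.sqrt n)⁻¹ • B) (t + δ) +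
      (1 + (δ ^ 2)⁻¹) * ((∑ i, ∑ j, min (n : ℝ) ((A i j - B i j) ^ 2)) / (n : ℝ) ^ 2) := by
  have hn0 : (0 : ℝ) < n := Nat.cast_pos.2 (Nat.pos_of_ne_zero hn)
  set c : ℝ := (Real.sqrt n)⁻¹
  have hc2 : c ^ 2 = (n : ℝ)⁻¹ := by rw [inv_pow, Real.sq_sqrt hn0.le]
  have hA' : (c • A).IsHermitian := by
    ext i j; have := hA.apply i j; simp at this; simp [this]
  have hB' : (c • B).IsHermitian := by
    ext i j; have := hB.apply i j; simp at this; simp [this]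
  have hsA : ∀ i j, A i j = A j i := fun i j => by simpa using (hA.apply i j).symm
  have hsB : ∀ i j, B i j = B j i := fun i j => by simpa using (hB.apply i j).symm
  -- The scaled difference with the entries of `B - A` larger than `√n` in absolute value removed;
  -- `J` collects the rows that contain a removed entry.
  let E : Matrix (Fin n) (Fin n) ℝ :=
    Matrix.of fun i j => if (n : ℝ) < (B i j - A i j) ^ 2 then 0 else c * (B i j - A i j)
  have hE : E.IsHermitian := by
    ext i j; simp [E, hsA j i, hsB j i]
  obtain ⟨u, hu1, hu2, hu⟩ := hE.exists_orthogonal_diagonalization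
  let J : Finset (Fin n) := by
    classical exact Finset.univ.filter fun i => ∃ j, (n : ℝ) < (B i j - A i j) ^ 2
  have hJm : ∀ i, i ∈ J ↔ ∃ j, (n : ℝ) < (B i j - A i j) ^ 2 := fun i => by simp [J]
  let K : Finset (Fin n) := Finset.univ.filter fun k => δ < hE.eigenvalues k
  have hKm : ∀ k, k ∈ K ↔ δ < hE.eigenvalues k := fun k => by simp [K]
  clear_value J K
  -- On vectors that vanish on `J` the removed entries play no role, and orthogonality to the
  -- eigenvectors in `K` bounds the form of `E` by `δ`. The codimension is at most `|J| + |K|`: a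
  -- row in `J` costs at least one in the sum of `min n (·)² / n`, and Chebyshev's inequality for
  -- the eigenvalues of `E` bounds `|K|`.
  let a : ↥J ⊕ ↥K → Fin n → ℝ := Sum.elim (fun i => Pi.single i.1 1) (fun k => u k.1)
  have key := hB'.card_eigenvalues_gt_le hA' (κ := ↥J ⊕ ↥K) a (t := t) (δ := δ) (by
    intro v hv
    have hJ : ∀ i j, (n : ℝ) < (B i j - A i j) ^ 2 → v i = 0 := fun i j hij => by
      have := hv (Sum.inl ⟨i, (hJm i).2 ⟨j, hij⟩⟩)
      simpa [a, Pi.single_apply] using this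
    have hK : ∀ k, δ < hE.eigenvalues k → ∑ i, u k i * v i = 0 := fun k hk => by
      simpa [a] using hv (Sum.inr ⟨k, (hKm k).2 hk⟩)
    calc ∑ i, ∑ j, v i * ((c • B) i j - (c • A) i j) * v j = ∑ i, ∑ j, v i * E i j * v j := by
          refine Finset.sum_congr rfl fun i _ => Finset.sum_congr rfl fun j _ => ?_
          simp only [Matrix.smul_apply, smul_eq_mul, E, Matrix.of_apply]
          split_ifs with hij
          · simp [hJ i j hij]
          · ring
      _ ≤ δ * ∑ i, v i ^ 2 := by
          rw [quadForm_eq_sum_sq hu, sum_sq_eq_sum_sq hu2, Finset.mul_sum]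
          refine Finset.sum_le_sum fun k _ => ?_
          by_cases hk : δ < hE.eigenvalues k
          · simp [hK k hk]
          · exact mul_le_mul_of_nonneg_right (not_lt.1 hk) (sq_nonneg _))
  have hKcard : (K.card : ℝ) * δ ^ 2 ≤ ∑ i, ∑ j, min (n : ℝ) ((A i j - B i j) ^ 2) / n := by
    calc (K.card : ℝ) * δ ^ 2
        = ∑ k ∈ K, δ ^ 2 := by
          rw [Finset.sum_const, nsmul_eq_mul]
      _ ≤ ∑ k ∈ K, hE.eigenvalues k ^ 2 := by
          refine Finset.sum_le_sum fun k hk => ?_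
          have := (hKm k).1 hk
          exact pow_le_pow_left₀ hδ.le this.le 2
      _ ≤ ∑ k, hE.eigenvalues k ^ 2 :=
          Finset.sum_le_sum_of_subset_of_nonneg (Finset.subset_univ _) fun _ _ _ => sq_nonneg _
      _ = ∑ i, ∑ j, E i j ^ 2 := hE.sum_eigenvalues_sq
      _ ≤ _ := by
          refine Finset.sum_le_sum fun i _ => Finset.sum_le_sum fun j _ => ?_
          simp only [E, Matrix.of_apply]
          split_ifs with hij
          · simp only [ne_eq, OfNat.ofNat_ne_zero, not_false_eq_true, zero_pow]; positivity
          · rw [sub_sq_comm, min_eq_right (not_lt.1 hij), mul_pow, hc2, div_eq_inv_mul, sub_sq_comm]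
  have hJcard : (J.card : ℝ) ≤ ∑ i, ∑ j, min (n : ℝ) ((A i j - B i j) ^ 2) / n := by
    have hnn : ∀ i j, 0 ≤ min (n : ℝ) ((A i j - B i j) ^ 2) / n := fun i j => by positivity
    calc (J.card : ℝ) = ∑ i ∈ J, 1 := by simp
      _ ≤ ∑ i ∈ J, ∑ j, min (n : ℝ) ((A i j - B i j) ^ 2) / n := by
          refine Finset.sum_le_sum fun i hi => ?_
          obtain ⟨j, hj⟩ := (hJm i).1 hi
          refine le_trans ?_ (Finset.single_le_sum (fun j _ => hnn i j) (Finset.mem_univ j))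
          rw [sub_sq_comm, min_eq_left hj.le, div_self hn0.ne']
      _ ≤ _ := Finset.sum_le_sum_of_subset_of_nonneg (Finset.subset_univ _)
          fun i _ _ => Finset.sum_nonneg fun j _ => hnn i j
  rw [hA'.esdCDF_eq hn, hB'.esdCDF_eq hn]
  set T := ∑ i, ∑ j, min (n : ℝ) ((A i j - B i j) ^ 2) with hT
  have hTn : ∑ i, ∑ j, min (n : ℝ) ((A i j - B i j) ^ 2) / n = T / n := by
    simp_rw [hT, Finset.sum_div]
  rw [hTn] at hKcard hJcard
  simp only [Fintype.card_sum, Fintype.card_coe] at key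
  have key' : ((Finset.univ.filter fun i => t + δ < hB'.eigenvalues i).card : ℝ) ≤
      (Finset.univ.filter fun i => t < hA'.eigenvalues i).card + (J.card + K.card) := by
    exact_mod_cast key
  have hK2 : (K.card : ℝ) ≤ T / n * (δ ^ 2)⁻¹ := by
    rw [← div_eq_mul_inv, le_div_iff₀ (by positivity)]; exact hKcard
  have hfin : ((Finset.univ.filter fun i => t + δ < hB'.eigenvalues i).card : ℝ) / n ≤
      (Finset.univ.filter fun i => t < hA'.eigenvalues i).card / n +
        (1 + (δ ^ 2)⁻¹) * (T / (n : ℝ) ^ 2) := by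
    have : (1 + (δ ^ 2)⁻¹) * (T / (n : ℝ) ^ 2) = (T / n + T / n * (δ ^ 2)⁻¹) / n := by
      field_simp
    rw [this, ← add_div]
    gcongr
    linarith
  linarith

end Matrix.IsHermitian

/-! ### The Efron–Stein inequality and a fourth moment bound -/

namespace EfronStein

variable {κ : Type*} [DecidableEq κ]

/-- Replace the coordinates in `S` of the first vector by those of the second one. -/
def mix (S : Finset κ) (p : κ → ℝ × ℝ) : κ → ℝ := fun k => if k ∈ S then (p k).2 else (p k).1

/-- Exchange the two vectors in the coordinates in `S`. -/
def swapOn (S : Finset κ) (p : κ → ℝ × ℝ) : κ → ℝ × ℝ := fun k => if k ∈ S then (p k).swap else p k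

lemma mix_swapOn (S T : Finset κ) (p : κ → ℝ × ℝ) : mix S (swapOn T p) = mix (symmDiff S T) p := by
  ext k
  by_cases hS : k ∈ S <;> by_cases hT : k ∈ T <;> simp [mix, swapOn, hS, hT, Finset.mem_symmDiff]

lemma mix_empty (p : κ → ℝ × ℝ) : mix ∅ p = fun k => (p k).1 := by ext; simp [mix]

lemma mix_singleton (k : κ) (p : κ → ℝ × ℝ) :
    mix {k} p = Function.update (fun j => (p j).1) k (p k).2 := by
  ext j
  by_cases hj : j = k
  · subst hj; simp [mix]
  · simp [mix, hj]

lemma measurable_mix (S : Finset κ) : Measurable (mix S) := by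
  refine measurable_pi_iff.2 fun k => ?_
  unfold mix
  split_ifs <;> fun_prop

variable [Fintype κ] {μ : κ → Measure ℝ} [∀ k, IsProbabilityMeasure (μ k)]

lemma measurePreserving_swapOn (S : Finset κ) :
    MeasurePreserving (swapOn S) (Measure.pi fun k => (μ k).prod (μ k))
      (Measure.pi fun k => (μ k).prod (μ k)) := by
  have := measurePreserving_pi (fun k => (μ k).prod (μ k)) (fun k => (μ k).prod (μ k))
    (f := fun k q => if k ∈ S then q.swap else q) (fun k => by
      by_cases hk : k ∈ S
      · simpa [hk] using Measure.measurePreserving_swap (μ := μ k) (ν := μ k)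
      · simpa [hk] using! MeasurePreserving.id ((μ k).prod (μ k)))
  exact this

lemma integral_swapOn (S : Finset κ) {f : (κ → ℝ × ℝ) → ℝ} (hf : Measurable f) :
    ∫ p, f (swapOn S p) ∂(Measure.pi fun k => (μ k).prod (μ k)) =
      ∫ p, f p ∂(Measure.pi fun k => (μ k).prod (μ k)) := by
  have h := measurePreserving_swapOn (μ := μ) S
  conv_rhs => rw [← h.map_eq]
  rw [integral_map h.measurable.aemeasurable hf.aestronglyMeasurable]

lemma integral_mix_empty {f : (κ → ℝ) → ℝ} (hf : Measurable f) :
    ∫ p, f (mix ∅ p) ∂(Measure.pi fun k => (μ k).prod (μ k)) = ∫ x, f x ∂(Measure.pi μ) := by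
  have h := measurePreserving_pi (fun k => (μ k).prod (μ k)) μ (f := fun _ q => q.1)
    (fun k => measurePreserving_fst)
  rw [← h.map_eq, integral_map h.measurable.aemeasurable hf.aestronglyMeasurable]
  simp_rw [mix_empty]

lemma integral_mix_mul_mix {f : (κ → ℝ) → ℝ} (hf : Measurable f) :
    ∫ p, f (mix ∅ p) * f (mix Finset.univ p) ∂(Measure.pi fun k => (μ k).prod (μ k)) =
      (∫ x, f x ∂(Measure.pi μ)) ^ 2 := by
  have h := measurePreserving_arrowProdEquivProdArrow ℝ ℝ κ μ μ
  rw [pow_two, ← integral_prod_mul, ← h.map_eq, integral_map h.measurable.aemeasurable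
    (by fun_prop)]
  have hu : ∀ p : κ → ℝ × ℝ, mix Finset.univ p = fun k => (p k).2 := fun p => by ext; simp [mix]
  simp_rw [mix_empty, hu]
  simp [MeasurableEquiv.arrowProdEquivProdArrow, Equiv.arrowProdEquivProdArrow]

lemma integrable_of_abs_le {Ω : Type*} [MeasurableSpace Ω] {P : Measure Ω} [IsFiniteMeasure P]
    {f : Ω → ℝ} (hf : Measurable f) {C : ℝ} (hC : ∀ x, |f x| ≤ C) : Integrable f P :=
  Integrable.of_bound hf.aestronglyMeasurable C (Filter.Eventually.of_forall hC)

/-- The **Efron–Stein inequality**. -/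
lemma efronStein {H : (κ → ℝ) → ℝ} (hH : Measurable H) {C : ℝ} (hC : ∀ x, |H x| ≤ C) :
    ∫ x, H x ^ 2 ∂(Measure.pi μ) - (∫ x, H x ∂(Measure.pi μ)) ^ 2 ≤
      2⁻¹ * ∑ k, ∫ p, (H (mix ∅ p) - H (mix {k} p)) ^ 2
        ∂(Measure.pi fun k => (μ k).prod (μ k)) := by
  set ν := Measure.pi fun k => (μ k).prod (μ k)
  have hm : ∀ S, Measurable fun p => H (mix S p) := fun S => hH.comp (measurable_mix S)
  have hprod : ∀ S T, Integrable (fun p => H (mix S p) * H (mix T p)) ν := fun S T =>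
    integrable_of_abs_le ((hm S).mul (hm T)) (C := C * C) fun p => by
      rw [abs_mul]
      exact mul_le_mul (hC _) (hC _) (abs_nonneg _) ((abs_nonneg _).trans (hC (mix S p)))
  have hsq : ∀ S T, Integrable (fun p => (H (mix S p) - H (mix T p)) ^ 2) ν := fun S T => by
    have := (((hprod S S).sub ((hprod S T).const_mul 2)).add (hprod T T))
    refine this.congr (Eventually.of_forall fun p => ?_)
    simp only [Pi.add_apply, Pi.sub_apply]
    ring
  -- Coordinates are replaced one at a time. For `S = univ` the two vectors are independent, so the
  -- left side is the variance.
  have main : ∀ S : Finset κ, ∫ p, H (mix ∅ p) * H (mix ∅ p) ∂ν - ∫ p, H (mix ∅ p) * H (mix S p) ∂ν ≤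
      2⁻¹ * ∑ k ∈ S, ∫ p, (H (mix ∅ p) - H (mix {k} p)) ^ 2 ∂ν := by
    intro S
    induction S using Finset.induction_on with
    | empty => simp
    | insert k S hk ih =>
      rw [Finset.sum_insert hk, mul_add]
      have e1 : symmDiff ∅ {k} = ({k} : Finset κ) := by simp
      have e2 : symmDiff S {k} = insert k S := by
        ext j; simp only [Finset.mem_symmDiff, Finset.mem_singleton, Finset.mem_insert]
        by_cases hj : j = k
        · subst hj; simp [hk]
        · simp [hj]
      have e3 : symmDiff (insert k S) {k} = S := by
        ext j; simp only [Finset.mem_symmDiff, Finset.mem_singleton, Finset.mem_insert]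
        by_cases hj : j = k
        · subst hj; simp [hk]
        · simp [hj]
      have e5 : symmDiff ∅ S = S := by simp
      have e4 : symmDiff {k} S = insert k S := by rw [symmDiff_comm, e2]
      have h1 : ∫ p, H (mix ∅ p) * H (mix (insert k S) p) ∂ν =
          ∫ p, H (mix {k} p) * H (mix S p) ∂ν := by
        rw [← integral_swapOn {k} (f := fun p => H (mix ∅ p) * H (mix (insert k S) p))
          ((hm ∅).mul (hm (insert k S)))]
        simp only [mix_swapOn, e1, e3]; rfl
      have h2 : ∫ p, H (mix ∅ p) * H (mix S p) ∂ν =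
          ∫ p, H (mix {k} p) * H (mix (insert k S) p) ∂ν := by
        rw [← integral_swapOn {k} (f := fun p => H (mix ∅ p) * H (mix S p)) ((hm ∅).mul (hm S))]
        simp only [mix_swapOn, e1, e2]; rfl
      have h3 : ∫ p, (H (mix S p) - H (mix (insert k S) p)) ^ 2 ∂ν =
          ∫ p, (H (mix ∅ p) - H (mix {k} p)) ^ 2 ∂ν := by
        rw [← integral_swapOn S (f := fun p => (H (mix ∅ p) - H (mix {k} p)) ^ 2)
          (((hm ∅).sub (hm {k})).pow_const 2)]
        simp only [mix_swapOn, e4, e5]; rfl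
      -- By the swaps, twice the decrement is the expectation of the product of the increments in
      -- coordinate `k` at `∅` and at `S`. Then `ab ≤ (a² + b²) / 2`, and by `h3` the two increments
      -- have the same second moment.
      have h4 : 2 * (∫ p, H (mix ∅ p) * H (mix S p) ∂ν - ∫ p, H (mix ∅ p) * H (mix (insert k S) p) ∂ν)
          ≤ 2⁻¹ * ∫ p, (H (mix ∅ p) - H (mix {k} p)) ^ 2 ∂ν +
            2⁻¹ * ∫ p, (H (mix S p) - H (mix (insert k S) p)) ^ 2 ∂ν := by
        have : 2 * (∫ p, H (mix ∅ p) * H (mix S p) ∂ν - ∫ p, H (mix ∅ p) * H (mix (insert k S) p) ∂ν)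
            = ∫ p, (H (mix ∅ p) * H (mix S p) + H (mix {k} p) * H (mix (insert k S) p))
                - (H (mix ∅ p) * H (mix (insert k S) p) + H (mix {k} p) * H (mix S p)) ∂ν := by
          have hadd : ∀ S T S' T', Integrable (fun p => H (mix S p) * H (mix T p) +
              H (mix S' p) * H (mix T' p)) ν := fun S T S' T' => (hprod S T).add (hprod S' T')
          rw [integral_sub (hadd _ _ _ _) (hadd _ _ _ _),
            integral_add (hprod _ _) (hprod _ _), integral_add (hprod _ _) (hprod _ _), ← h1, ← h2]
          ring
        rw [this, ← integral_const_mul, ← integral_const_mul,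
          ← integral_add ((hsq _ _).const_mul _) ((hsq _ _).const_mul _)]
        refine integral_mono (((hprod _ _).add (hprod _ _)).sub ((hprod _ _).add (hprod _ _)))
          (((hsq _ _).const_mul _).add ((hsq _ _).const_mul _)) fun p => ?_
        simp only
        nlinarith [sq_nonneg ((H (mix ∅ p) - H (mix {k} p)) - (H (mix S p) - H (mix (insert k S) p)))]
      rw [h3] at h4
      linarith
  have := main Finset.univ
  rw [integral_mix_mul_mix hH] at this
  have h0 := integral_mix_empty (μ := μ) (hH.pow_const 2)
  simp_rw [← pow_two] at this
  rw [← h0]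
  exact this

variable {G : (κ → ℝ) → ℝ} {C V : ℝ}

/-- A bound for the fourth central moment of a function of independent variables whose increments under
resampling of one coordinate have positive parts with sum of squares at most `V`. -/
lemma integral_sub_integral_pow_four_le (hG : Measurable G) (hC : ∀ x, |G x| ≤ C)
    (hV : ∀ x y : κ → ℝ, ∑ k, max (G x - G (Function.update x k (y k))) 0 ^ 2 ≤ V) :
    ∫ x, (G x - ∫ z, G z ∂(Measure.pi μ)) ^ 4 ∂(Measure.pi μ) ≤ 11 * V ^ 2 := by
  set ν := Measure.pi fun k => (μ k).prod (μ k)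
  set m := ∫ z, G z ∂(Measure.pi μ)
  have hm : ∀ S, Measurable fun p => G (mix S p) := fun S => hG.comp (measurable_mix S)
  have hbound : ∀ S p, |G (mix S p)| ≤ C := fun S p => hC _
  have hVp : ∀ p, ∑ k, max (G (mix ∅ p) - G (mix {k} p)) 0 ^ 2 ≤ V := by
    intro p
    have := hV (fun j => (p j).1) (fun j => (p j).2)
    simp_rw [mix_singleton, mix_empty]
    exact this
  have hV0 : 0 ≤ V := (Finset.sum_nonneg fun k _ => sq_nonneg _).trans (hV 0 0)
  have hmC : |m| ≤ C := by
    have := norm_integral_le_of_norm_le_const (μ := Measure.pi μ) (f := G) (C := C)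
      (Eventually.of_forall hC)
    simpa using this
  have hC0 : 0 ≤ C := (abs_nonneg _).trans hmC
  have hanti : ∀ (k : κ) (F : ℝ → ℝ → ℝ), Measurable (fun q : ℝ × ℝ => F q.1 q.2) →
      ∫ p, F (G (mix ∅ p)) (G (mix {k} p)) ∂ν = ∫ p, F (G (mix {k} p)) (G (mix ∅ p)) ∂ν := by
    intro k F hF
    rw [← integral_swapOn {k} (f := fun p => F (G (mix ∅ p)) (G (mix {k} p)))
      (hF.comp ((hm ∅).prodMk (hm {k})))]
    have e1 : symmDiff ∅ {k} = ({k} : Finset κ) := by simp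
    simp only [mix_swapOn, symmDiff_self, e1]
    rfl
  -- symmetric functions of the pair can be restricted to the event that the increment is positive
  have hsymm : ∀ (k : κ) (F : ℝ → ℝ → ℝ), Measurable (fun q : ℝ × ℝ => F q.1 q.2) →
      (∀ a b, F a b = F b a) → (∀ a, F a a = 0) → (∃ B, ∀ a b, |a| ≤ C → |b| ≤ C → |F a b| ≤ B) →
      Integrable (fun p => if G (mix {k} p) < G (mix ∅ p) then F (G (mix ∅ p)) (G (mix {k} p)) else 0) ν
      ∧ ∫ p, F (G (mix ∅ p)) (G (mix {k} p)) ∂ν =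
        2 * ∫ p, (if G (mix {k} p) < G (mix ∅ p) then F (G (mix ∅ p)) (G (mix {k} p)) else 0) ∂ν := by
    intro k F hF hFs hF0 ⟨B, hB⟩
    have hB0 : 0 ≤ B := (abs_nonneg _).trans (hB 0 0 (by simpa) (by simpa))
    let F1 : ℝ → ℝ → ℝ := fun a b => if b < a then F a b else 0
    have hF1 : Measurable (fun q : ℝ × ℝ => F1 q.1 q.2) :=
      Measurable.ite (measurableSet_lt measurable_snd measurable_fst) hF measurable_const
    have hF1B : ∀ a b, |a| ≤ C → |b| ≤ C → |F1 a b| ≤ B := fun a b ha hb => by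
      simp only [F1]; split_ifs
      · exact hB a b ha hb
      · simpa
    have hi1 : Integrable (fun p => F1 (G (mix ∅ p)) (G (mix {k} p))) ν :=
      integrable_of_abs_le (hF1.comp ((hm ∅).prodMk (hm {k}))) fun p =>
        hF1B _ _ (hbound _ _) (hbound _ _)
    have hi2 : Integrable (fun p => F1 (G (mix {k} p)) (G (mix ∅ p))) ν :=
      integrable_of_abs_le (hF1.comp ((hm {k}).prodMk (hm ∅))) fun p =>
        hF1B _ _ (hbound _ _) (hbound _ _)
    refine ⟨hi1, ?_⟩
    calc ∫ p, F (G (mix ∅ p)) (G (mix {k} p)) ∂ν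
        = ∫ p, F1 (G (mix ∅ p)) (G (mix {k} p)) + F1 (G (mix {k} p)) (G (mix ∅ p)) ∂ν := by
          congr 1; ext p
          simp only [F1]
          rcases lt_trichotomy (G (mix ∅ p)) (G (mix {k} p)) with h | h | h
          · simp [h, h.not_gt, hFs]
          · simp [h, hF0]
          · simp [h, h.not_gt]
      _ = _ := by
          rw [integral_add hi1 hi2, ← hanti k F1 hF1, two_mul]
  -- variance
  have hvar : ∫ x, (G x - m) ^ 2 ∂(Measure.pi μ) ≤ V := by
    have hes := efronStein (μ := μ) (hG.sub_const m) (C := C + C) fun x =>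
      (abs_sub _ _).trans (add_le_add (hC x) hmC)
    have hz : ∫ x, (G x - m) ∂(Measure.pi μ) = 0 := by
      rw [integral_sub (integrable_of_abs_le hG hC) (integrable_const _)]
      simp [m]
    rw [hz] at hes
    have hk : ∀ k, ∫ p, ((G (mix ∅ p) - m) - (G (mix {k} p) - m)) ^ 2 ∂ν =
        2 * ∫ p, max (G (mix ∅ p) - G (mix {k} p)) 0 ^ 2 ∂ν := by
      intro k
      have := (hsymm k (fun a b => ((a - m) - (b - m)) ^ 2) (by fun_prop) (fun a b => by ring)
        (fun a => by ring) ⟨(C + C) ^ 2, fun a b ha hb => by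
          rw [abs_pow]
          refine pow_le_pow_left₀ (abs_nonneg _) ?_ 2
          rw [sub_sub_sub_cancel_right]
          exact (abs_sub _ _).trans (add_le_add ha hb)⟩).2
      rw [this]
      congr 2; ext p
      split_ifs with h
      · rw [max_eq_left (by linarith)]; ring
      · rw [max_eq_right (by linarith)]; ring
    replace hes := hes.trans_eq (congrArg (2⁻¹ * ·) (Finset.sum_congr rfl fun k _ => hk k))
    rw [← Finset.mul_sum, ← integral_finsetSum] at hes
    · have : ∫ p, ∑ k, max (G (mix ∅ p) - G (mix {k} p)) 0 ^ 2 ∂ν ≤ ∫ _p, V ∂ν :=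
        integral_mono_of_nonneg (Eventually.of_forall fun p => Finset.sum_nonneg fun k _ => sq_nonneg _)
          (integrable_const _) (Eventually.of_forall hVp)
      simp only [integral_const, probReal_univ, one_smul] at this
      linarith
    · intro k _
      refine integrable_of_abs_le ((((hm ∅).sub (hm {k})).max measurable_const).pow_const 2)
        (C := V) fun p => ?_
      rw [abs_of_nonneg (sq_nonneg _)]
      exact (Finset.single_le_sum (f := fun k => max (G (mix ∅ p) - G (mix {k} p)) 0 ^ 2)
        (fun k _ => sq_nonneg _) (Finset.mem_univ k)).trans (hVp p)
  have hdev : ∀ x, |G x - m| ≤ C + C := fun x => (abs_sub _ _).trans (add_le_add (hC x) hmC)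
  -- fourth moment
  have hes := efronStein (μ := μ) ((hG.sub_const m).pow_const 2) (C := (C + C) ^ 2) fun x => by
    rw [abs_pow]; exact pow_le_pow_left₀ (abs_nonneg _) (hdev x) 2
  -- With `a = G - m` and a positive increment `D`, the squared increment of `a²` is `D² (2a - D)² ≤
  -- D² (8a² + 2D²)`, and `D² ≤ V`. Restricting to positive increments is what allows a bound on the
  -- sum over `k` by `V` pointwise.
  have hk : ∀ k, Integrable (fun p => (8 * (G (mix ∅ p) - m) ^ 2 + 2 * V) *
        max (G (mix ∅ p) - G (mix {k} p)) 0 ^ 2) ν ∧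
      ∫ p, ((G (mix ∅ p) - m) ^ 2 - (G (mix {k} p) - m) ^ 2) ^ 2 ∂ν ≤
        2 * ∫ p, (8 * (G (mix ∅ p) - m) ^ 2 + 2 * V) *
          max (G (mix ∅ p) - G (mix {k} p)) 0 ^ 2 ∂ν := by
    intro k
    have hsm : ∀ p, max (G (mix ∅ p) - G (mix {k} p)) 0 ^ 2 ≤ V := fun p =>
      (Finset.single_le_sum (f := fun k => max (G (mix ∅ p) - G (mix {k} p)) 0 ^ 2)
        (fun k _ => sq_nonneg _) (Finset.mem_univ k)).trans (hVp p)
    obtain ⟨hint, heq⟩ := hsymm k (fun a b => ((a - m) ^ 2 - (b - m) ^ 2) ^ 2) (by fun_prop)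
        (fun a b => by ring) (fun a => by ring) ⟨(2 * (C + C) ^ 2) ^ 2, fun a b ha hb => by
          rw [abs_pow]
          refine pow_le_pow_left₀ (abs_nonneg _) ?_ 2
          refine (abs_sub _ _).trans ?_
          rw [abs_pow, abs_pow, two_mul]
          refine add_le_add (pow_le_pow_left₀ (abs_nonneg _) ?_ 2) (pow_le_pow_left₀ (abs_nonneg _) ?_ 2)
          · exact (abs_sub _ _).trans (add_le_add ha hmC)
          · exact (abs_sub _ _).trans (add_le_add hb hmC)⟩
    have hi : Integrable (fun p => (8 * (G (mix ∅ p) - m) ^ 2 + 2 * V) *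
        max (G (mix ∅ p) - G (mix {k} p)) 0 ^ 2) ν := by
      refine integrable_of_abs_le (((((hm ∅).sub_const m).pow_const 2).const_mul 8 |>.add_const _).mul
        ((((hm ∅).sub (hm {k})).max measurable_const).pow_const 2))
        (C := (8 * (C + C) ^ 2 + 2 * V) * V) fun p => ?_
      rw [abs_of_nonneg (by positivity)]
      refine mul_le_mul ?_ (hsm p) (sq_nonneg _) (by positivity)
      have := sq_le_sq' (abs_le.1 (hdev (mix ∅ p))).1 (abs_le.1 (hdev (mix ∅ p))).2
      linarith
    refine ⟨hi, ?_⟩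
    rw [heq]
    refine mul_le_mul_of_nonneg_left (integral_mono hint hi fun p => ?_) (by norm_num)
    simp only
    split_ifs with h
    · set a := G (mix ∅ p) - m
      set D := G (mix ∅ p) - G (mix {k} p) with hD
      have hb : G (mix {k} p) - m = a - D := by simp [a, D]
      have hDp : max D 0 = D := max_eq_left (by linarith)
      have hDV : D ^ 2 ≤ V := by have := hsm p; rwa [hDp] at this
      rw [hb, hDp]
      have : (a ^ 2 - (a - D) ^ 2) ^ 2 = D ^ 2 * (2 * a - D) ^ 2 := by ring
      rw [this, mul_comm]
      refine mul_le_mul_of_nonneg_right ?_ (sq_nonneg _)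
      nlinarith [sq_nonneg (2 * a + D)]
    · positivity
  have hsum : ∑ k, ∫ p, (8 * (G (mix ∅ p) - m) ^ 2 + 2 * V) *
          max (G (mix ∅ p) - G (mix {k} p)) 0 ^ 2 ∂ν ≤ 10 * V ^ 2 := by
    have hvar' : ∫ p, (G (mix ∅ p) - m) ^ 2 ∂ν ≤ V := by
      rw [integral_mix_empty (μ := μ) (f := fun x => (G x - m) ^ 2) ((hG.sub_const m).pow_const 2)]
      exact hvar
    have hvi : Integrable (fun p => (G (mix ∅ p) - m) ^ 2) ν :=
      integrable_of_abs_le (((hm ∅).sub_const m).pow_const 2) (C := (C + C) ^ 2) fun p => by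
        rw [abs_pow]; exact pow_le_pow_left₀ (abs_nonneg _) (hdev _) 2
    rw [← integral_finsetSum _ fun k _ => (hk k).1]
    calc ∫ p, ∑ k, (8 * (G (mix ∅ p) - m) ^ 2 + 2 * V) * max (G (mix ∅ p) - G (mix {k} p)) 0 ^ 2 ∂ν
        ≤ ∫ p, (8 * (G (mix ∅ p) - m) ^ 2 + 2 * V) * V ∂ν := by
          refine integral_mono (integrable_finsetSum _ fun k _ => (hk k).1)
            (((hvi.const_mul 8).add (integrable_const _)).mul_const V) fun p => ?_
          simp only
          rw [← Finset.mul_sum]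
          exact mul_le_mul_of_nonneg_left (hVp p) (by positivity)
      _ = (8 * ∫ p, (G (mix ∅ p) - m) ^ 2 ∂ν + 2 * V) * V := by
          rw [integral_mul_const, integral_add (hvi.const_mul 8) (integrable_const _),
            integral_const_mul]
          simp
      _ ≤ _ := by nlinarith
  have hsum2 : ∑ k, ∫ p, ((G (mix ∅ p) - m) ^ 2 - (G (mix {k} p) - m) ^ 2) ^ 2 ∂ν ≤ 20 * V ^ 2 := by
    refine (Finset.sum_le_sum fun k _ => (hk k).2).trans ?_
    rw [← Finset.mul_sum]
    linarith
  have h4 : ∫ x, (G x - m) ^ 4 ∂(Measure.pi μ) = ∫ x, ((G x - m) ^ 2) ^ 2 ∂(Measure.pi μ) := by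
    congr 1; ext x; ring
  have hvar0 : 0 ≤ ∫ x, (G x - m) ^ 2 ∂(Measure.pi μ) := integral_nonneg fun x => sq_nonneg _
  -- Half of `20 V²` from Efron–Stein for `(G - m)²`, and at most `V²` from the square of its mean.
  rw [h4]
  nlinarith

end EfronStein

/-! ### Words up to renaming of letters -/

section Words

variable {α : Type*} {h : ℕ}

open Classical in
/-- The canonical form of a word: every letter is replaced by the position of its first occurrence. -/
noncomputable def canonicalWord (f : Fin h → α) (i : Fin h) : Fin h :=
  (Finset.univ.filter fun j => f j = f i).min' ⟨i, by simp⟩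

lemma apply_canonicalWord (f : Fin h → α) (i : Fin h) : f (canonicalWord f i) = f i := by
  classical
  have := Finset.min'_mem (Finset.univ.filter fun j => f j = f i) ⟨i, by simp⟩
  exact (Finset.mem_filter.1 this).2

lemma canonicalWord_le (f : Fin h → α) {i j : Fin h} (hij : f j = f i) : canonicalWord f i ≤ j :=
  Finset.min'_le _ _ (by simpa using hij)

lemma canonicalWord_eq_iff (f : Fin h → α) {i j : Fin h} :
    canonicalWord f i = canonicalWord f j ↔ f i = f j := by
  constructor
  · intro hij
    rw [← apply_canonicalWord f i, hij, apply_canonicalWord f]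
  · intro hij
    refine le_antisymm (canonicalWord_le f ?_) (canonicalWord_le f ?_)
    · rw [apply_canonicalWord f, hij]
    · rw [apply_canonicalWord f, hij]

lemma canonicalWord_congr {β : Type*} {f : Fin h → α} {g : Fin h → β}
    (hfg : ∀ i j, f i = f j ↔ g i = g j) : canonicalWord f = canonicalWord g := by
  ext1 i
  refine le_antisymm (canonicalWord_le f ?_) (canonicalWord_le g ?_)
  · rw [hfg, apply_canonicalWord g]
  · rw [← hfg, apply_canonicalWord f]

lemma canonicalWord_canonicalWord (f : Fin h → α) :
    canonicalWord (canonicalWord f) = canonicalWord f :=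
  canonicalWord_congr fun _ _ => canonicalWord_eq_iff f

/-- The number of occurrences of the `i`-th letter of a word. -/
noncomputable def letterCount (f : Fin h → α) (i : Fin h) : ℕ := {j | f j = f i}.ncard

lemma letterCount_congr {β : Type*} {f : Fin h → α} {g : Fin h → β}
    (hfg : ∀ i j, f i = f j ↔ g i = g j) : letterCount f = letterCount g := by
  ext i
  simp [letterCount, hfg]

lemma letterCount_canonicalWord (f : Fin h → α) : letterCount (canonicalWord f) = letterCount f :=
  letterCount_congr fun _ _ => canonicalWord_eq_iff f

/-- The positions at which a letter occurs for the first time. -/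
def firstPositions (w : Fin h → Fin h) : Finset (Fin h) := Finset.univ.filter fun i => w i = i

lemma sum_letterCount_firstPositions (f : Fin h → α) :
    ∑ i ∈ firstPositions (canonicalWord f), letterCount f i = h := by
  classical
  have := Finset.card_eq_sum_card_fiberwise (s := (Finset.univ : Finset (Fin h)))
    (t := firstPositions (canonicalWord f)) (f := canonicalWord f) (fun i _ => by
      simp only [firstPositions, Finset.coe_filter, Finset.mem_univ, true_and, Set.mem_ofPred_eq]
      rw [canonicalWord_eq_iff, apply_canonicalWord f])
  rw [Finset.card_univ, Fintype.card_fin] at this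
  conv_rhs => rw [this]
  refine Finset.sum_congr rfl fun i hi => ?_
  have hi' : canonicalWord f i = i := (Finset.mem_filter.1 hi).2
  rw [letterCount, ← Set.ncard_coe_finset]
  congr 1
  ext j
  simp only [Set.mem_ofPred_eq, Finset.coe_filter, Finset.mem_univ, true_and]
  rw [← canonicalWord_eq_iff, hi']

lemma two_mul_card_firstPositions_of_pairMatched {f : Fin h → α} (hf : ∀ i, letterCount f i = 2) :
    2 * (firstPositions (canonicalWord f)).card = h := by
  have := sum_letterCount_firstPositions f
  simp only [hf, Finset.sum_const, smul_eq_mul] at this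
  omega

/-- The class sizes add up to `h`, all are at least two and one is larger. The strict inequality is
the source of the factor `√n` gained on words that are not pair-matched. -/
lemma two_mul_card_firstPositions_lt {f : Fin h → α} (hf : ∀ i, 2 ≤ letterCount f i)
    (hf' : ¬ ∀ i, letterCount f i = 2) : 2 * (firstPositions (canonicalWord f)).card < h := by
  push Not at hf'
  obtain ⟨i, hi⟩ := hf'
  have hlt : ∑ i ∈ firstPositions (canonicalWord f), 2 <
      ∑ i ∈ firstPositions (canonicalWord f), letterCount f i := by
    refine Finset.sum_lt_sum (fun i _ => hf i) ⟨canonicalWord f i, ?_, ?_⟩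
    · simp only [firstPositions, Finset.mem_filter, Finset.mem_univ, true_and]
      rw [canonicalWord_eq_iff, apply_canonicalWord f]
    · have : letterCount f (canonicalWord f i) = letterCount f i := by
        simp only [letterCount, apply_canonicalWord]
      rw [this]
      exact lt_of_le_of_ne (hf i) (Ne.symm hi)
  rw [sum_letterCount_firstPositions, Finset.sum_const, smul_eq_mul] at hlt
  omega

end Words

open Classical in
/-- The pair-matched words of length `2 k` in canonical form. -/
noncomputable def pairWords (k : ℕ) : Finset (Fin (2 * k) → Fin (2 * k)) :=
  Finset.univ.filter fun w => canonicalWord w = w ∧ ∀ i, letterCount w i = 2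

/-- A canonical word is fixed by its set of first positions, one of `4 ^ k` subsets, and its letters
at the other `k` positions. The growth `k ^ k` is slow enough to be beaten by `(2k)!` later. -/
lemma card_pairWords_le (k : ℕ) : (pairWords k).card ≤ 4 ^ k * (2 * k) ^ k := by
  classical
  have hfib : ∀ w ∈ pairWords k, firstPositions w ∈
      (Finset.univ : Finset (Finset (Fin (2 * k)))) := fun w _ => Finset.mem_univ _
  rw [Finset.card_eq_sum_card_fiberwise hfib]
  calc ∑ S : Finset (Fin (2 * k)), ((pairWords k).filter fun w => firstPositions w = S).card
      ≤ ∑ _S : Finset (Fin (2 * k)), (2 * k) ^ k := by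
        refine Finset.sum_le_sum fun S _ => ?_
        by_cases hS : S.card = k
        · have hinj : Set.InjOn (fun (w : Fin (2 * k) → Fin (2 * k)) (i : ↥Sᶜ) => w i)
              ((pairWords k).filter fun w => firstPositions w = S) := by
            intro w hw w' hw' heq
            simp only [Finset.coe_filter, Set.mem_ofPred_eq] at hw hw'
            ext1 i
            by_cases hi : i ∈ S
            · have h1 : w i = i := by
                rw [← hw.2] at hi; exact (Finset.mem_filter.1 hi).2
              have h2 : w' i = i := by
                rw [← hw'.2] at hi; exact (Finset.mem_filter.1 hi).2
              rw [h1, h2]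
            · exact congrFun heq ⟨i, Finset.mem_compl.2 hi⟩
          have := Finset.card_le_card_of_injOn (t := Finset.univ) _ (fun _ _ => Finset.mem_univ _) hinj
          refine this.trans (le_of_eq ?_)
          rw [Finset.card_univ, Fintype.card_fun, Fintype.card_fin, Fintype.card_coe,
            Finset.card_compl, Fintype.card_fin, hS]
          congr 1; omega
        · rw [Finset.card_eq_zero.2]
          · exact Nat.zero_le _
          · refine Finset.filter_eq_empty_iff.2 fun w hw hwS => hS ?_
            obtain ⟨hc, hp⟩ := (Finset.mem_filter.1 hw).2
            have := two_mul_card_firstPositions_of_pairMatched hp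
            rw [hc, hwS] at this
            omega
    _ = 4 ^ k * (2 * k) ^ k := by
        rw [Finset.sum_const, Finset.card_univ, Fintype.card_finset, Fintype.card_fin, pow_mul]
        simp

/-! ### Counting paths with a prescribed word -/

namespace Link

variable {ι : Type*} {n h : ℕ}

/-- The word of `L`-values along a path. -/
def word (L : Link ι) (π : Fin (h + 1) → Fin n) : Fin h → ι :=
  fun i => L n (π i.castSucc) (π i.succ)

open Classical in
-- The path is built vertex by vertex. Where `w i = i` the next vertex is free; otherwise the
-- preceding vertex and the required value leave at most `Δ` choices. Taking `w` on all of `ℕ` keeps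
-- it fixed during the induction on `h`.
lemma card_paths_le (L : Link ι) {Δ : ℕ}
    (hΔ : ∀ (n : ℕ) (t : ι) (k : Fin n), {l : Fin n | L n k l = t}.ncard ≤ Δ)
    (w : ℕ → ℕ) (hw : ∀ i, w i ≤ i) (h : ℕ) :
    (Finset.univ.filter fun π : Fin (h + 1) → Fin n =>
      ∀ (i : Fin h) (hj : w i < h), L.word π i = L.word π ⟨w i, hj⟩).card ≤
      n * ∏ i ∈ Finset.range h, if w i = i then n else Δ := by
  induction h with
  | zero => simp
  | succ h ih =>
    set S := Finset.univ.filter fun π : Fin (h + 1 + 1) → Fin n =>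
      ∀ (i : Fin (h + 1)) (hj : w i < h + 1), L.word π i = L.word π ⟨w i, hj⟩ with hS
    have hword : ∀ (π : Fin (h + 1 + 1) → Fin n) (i : Fin h),
        L.word (Fin.init π : Fin (h + 1) → Fin n) i = L.word π i.castSucc := by
      intro π i
      simp only [word, Fin.init, Fin.succ_castSucc]
    have himg : S.image (fun π => (Fin.init π : Fin (h + 1) → Fin n)) ⊆
        Finset.univ.filter fun π : Fin (h + 1) → Fin n =>
          ∀ (i : Fin h) (hj : w i < h), L.word π i = L.word π ⟨w i, hj⟩ := by
      intro ρ hρ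
      obtain ⟨π, hπ, rfl⟩ := Finset.mem_image.1 hρ
      simp only [Finset.mem_filter, Finset.mem_univ, true_and, hS] at hπ ⊢
      intro i hj
      rw [hword, hword]
      exact hπ i.castSucc (by simpa using hj.trans (Nat.lt_succ_self h))
    have hfib : ∀ ρ ∈ S.image (fun π => (Fin.init π : Fin (h + 1) → Fin n)),
        (S.filter fun π => (Fin.init π : Fin (h + 1) → Fin n) = ρ).card ≤
          if w h = h then n else Δ := by
      intro ρ _
      have hinj : Set.InjOn (fun π : Fin (h + 1 + 1) → Fin n => π (Fin.last (h + 1)))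
          (S.filter fun π => (Fin.init π : Fin (h + 1) → Fin n) = ρ) := by
        intro π hπ π' hπ' heq
        simp only [Finset.coe_filter, Set.mem_ofPred_eq] at hπ hπ'
        rw [← Fin.snoc_init_self π, ← Fin.snoc_init_self π', hπ.2, hπ'.2]
        simp only at heq
        rw [heq]
      split_ifs with hwh
      · refine (Finset.card_le_card_of_injOn (t := Finset.univ) _ (fun _ _ => Finset.mem_univ _)
          hinj).trans (by simp)
      · have hlt : w h < h := lt_of_le_of_ne (hw h) hwh
        refine (Finset.card_le_card_of_injOn (t := Finset.univ.filter fun l =>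
          L n (ρ (Fin.last h)) l = L.word ρ ⟨w h, hlt⟩) _ (fun π hπ => ?_) hinj).trans ?_
        · simp only [Finset.coe_filter, Set.mem_ofPred_eq, Finset.mem_filter, Finset.mem_univ,
            true_and, hS] at hπ ⊢
          obtain ⟨hπ, rfl⟩ := hπ
          have := hπ (Fin.last h) (by simp only [Fin.val_last]; omega)
          rw [hword]
          exact this
        · have := hΔ n (L.word ρ ⟨w h, hlt⟩) (ρ (Fin.last h))
          rwa [← Set.ncard_coe_finset, Finset.coe_filter_univ]
    have := Finset.card_le_mul_card_image S _ hfib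
    rw [Finset.prod_range_succ, ← mul_assoc, mul_comm _ (if w h = h then n else Δ)]
    exact this.trans (Nat.mul_le_mul_left _ ((Finset.card_le_card himg).trans ih))

open Classical in
lemma card_paths_canonicalWord_le (L : Link ι) {Δ : ℕ}
    (hΔ : ∀ (n : ℕ) (t : ι) (k : Fin n), {l : Fin n | L n k l = t}.ncard ≤ Δ)
    (w : Fin h → Fin h) :
    (Finset.univ.filter fun π : Fin (h + 1) → Fin n => canonicalWord (L.word π) = w).card ≤
      n ^ (1 + (firstPositions w).card) * Δ ^ (h - (firstPositions w).card) := by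
  by_cases hex : ∃ π : Fin (h + 1) → Fin n, canonicalWord (L.word π) = w
  · obtain ⟨π₀, hπ₀⟩ := hex
    have hwle : ∀ i, w i ≤ i := fun i => by
      rw [← hπ₀]; exact canonicalWord_le _ rfl
    -- Extension by the identity, so that `w' i ≤ i` holds beyond `h` too.
    let w' : ℕ → ℕ := fun i => if hi : i < h then w ⟨i, hi⟩ else i
    have hw' : ∀ i, w' i ≤ i := fun i => by
      simp only [w']; split_ifs with hi
      · exact hwle ⟨i, hi⟩
      · exact le_rfl
    have hval : ∀ i : Fin h, w' i = w i := fun i => by simp [w']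
    refine (Finset.card_le_card ?_).trans ((L.card_paths_le hΔ (n := n) w' hw' h).trans (le_of_eq ?_))
    · intro π hπ
      simp only [Finset.mem_filter, Finset.mem_univ, true_and] at hπ ⊢
      intro i hj
      have : (⟨w' i, hj⟩ : Fin h) = w i := Fin.ext (hval i)
      rw [this, ← hπ, apply_canonicalWord (L.word π)]
    · rw [← Fin.prod_univ_eq_prod_range (fun i => if w' i = i then n else Δ), Finset.prod_ite]
      have e : (Finset.univ.filter fun i : Fin h => w' i = i) = firstPositions w := by
        ext i; simp [firstPositions, hval, Fin.ext_iff]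
      have e' : (Finset.univ.filter fun i : Fin h => ¬ w' i = i) = (firstPositions w)ᶜ := by
        rw [← e, Finset.compl_filter]
      rw [e, e', Finset.prod_const, Finset.prod_const, Finset.card_compl, Fintype.card_fin, pow_add,
        pow_one, mul_assoc]
  · rw [Finset.card_eq_zero.2]
    · exact Nat.zero_le _
    · exact Finset.filter_eq_empty_iff.2 fun π _ hπ => hex ⟨π, hπ⟩

/-- The paths whose word has no letter that occurs once, but some letter that occurs more than twice. -/
def nonPairPaths (L : Link ι) (n h : ℕ) : Set (Fin (h + 1) → Fin n) :=
  {π | (∀ i, 2 ≤ letterCount (L.word π) i) ∧ ¬ ∀ i, letterCount (L.word π) i = 2}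

/-- A word of this kind has `b` distinct letters with `2b + 1 ≤ h`, so it is carried by a constant
times `n^(1+b)` paths, which is at most that constant times `n · √n^(h-1)`; at most `h ^ h` words
occur. Closing up the path is not needed for this bound. -/
lemma ncard_nonPairPaths_le (L : Link ι) (hB : L.PropertyB) (h : ℕ) :
    ∃ C : ℝ, 0 ≤ C ∧ ∀ n : ℕ, n ≠ 0 →
      ((L.nonPairPaths n h).ncard : ℝ) / ((n : ℝ) * Real.sqrt n ^ h) ≤ C / Real.sqrt n := by
  classical
  obtain ⟨Δ, hΔ⟩ := hB
  refine ⟨(h : ℝ) ^ h * (max 1 Δ : ℝ) ^ h, by positivity, fun n hn => ?_⟩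
  have hn1 : (1 : ℝ) ≤ n := by exact_mod_cast Nat.one_le_iff_ne_zero.2 hn
  have hs1 : 1 ≤ Real.sqrt n := Real.one_le_sqrt.2 hn1
  set T : Finset (Fin (h + 1) → Fin n) := Finset.univ.filter fun π => π ∈ L.nonPairPaths n h
  have hT : (L.nonPairPaths n h).ncard = T.card := by
    rw [← Set.ncard_coe_finset]; simp [T]
  have hfib : ∀ w : Fin h → Fin h,
      ((T.filter fun π => canonicalWord (L.word π) = w).card : ℝ) * Real.sqrt n ≤
        (max 1 Δ : ℝ) ^ h * (n * Real.sqrt n ^ h) := by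
    intro w
    rcases (T.filter fun π => canonicalWord (L.word π) = w).eq_empty_or_nonempty with he | ⟨π, hπ⟩
    · rw [he]; simp; positivity
    · obtain ⟨hπT, hπw⟩ := Finset.mem_filter.1 hπ
      obtain ⟨h2, h3⟩ := (Finset.mem_filter.1 hπT).2
      have hb := two_mul_card_firstPositions_lt h2 h3
      rw [hπw] at hb
      set b := (firstPositions w).card
      have h1 : ((T.filter fun π => canonicalWord (L.word π) = w).card : ℝ) ≤
          (n : ℝ) ^ (1 + b) * (Δ : ℝ) ^ (h - b) := by
        exact_mod_cast (Finset.card_le_card (Finset.filter_subset_filter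
          (fun π => canonicalWord (L.word π) = w) (Finset.subset_univ T))).trans (L.card_paths_canonicalWord_le hΔ w)
      have hΔ1 : (Δ : ℝ) ^ (h - b) ≤ (max 1 Δ : ℝ) ^ h :=
        (pow_le_pow_left₀ (Nat.cast_nonneg _) (le_max_right _ _) _).trans
          (pow_le_pow_right₀ (le_max_left _ _) (Nat.sub_le _ _))
      have hn2 : (n : ℝ) ^ (1 + b) * Real.sqrt n ≤ n * Real.sqrt n ^ h := by
        have : (n : ℝ) ^ (1 + b) = n * Real.sqrt n ^ (2 * b) := by
          rw [pow_add, pow_one, pow_mul, Real.sq_sqrt (Nat.cast_nonneg _)]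
        rw [this, mul_assoc, ← pow_succ]
        exact mul_le_mul_of_nonneg_left (pow_le_pow_right₀ hs1 (by omega)) (Nat.cast_nonneg _)
      calc ((T.filter fun π => canonicalWord (L.word π) = w).card : ℝ) * Real.sqrt n
          ≤ ((n : ℝ) ^ (1 + b) * (Δ : ℝ) ^ (h - b)) * Real.sqrt n := by gcongr
        _ = (Δ : ℝ) ^ (h - b) * ((n : ℝ) ^ (1 + b) * Real.sqrt n) := by ring
        _ ≤ _ := by gcongr
  rw [div_le_div_iff₀ (by positivity) (by positivity), hT,
    Finset.card_eq_sum_card_fiberwise (t := Finset.univ) (f := fun π => canonicalWord (L.word π))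
      (fun _ _ => Finset.mem_coe.2 (Finset.mem_univ _))]
  push_cast
  rw [Finset.sum_mul]
  refine (Finset.sum_le_sum fun w _ => hfib w).trans (le_of_eq ?_)
  rw [Finset.sum_const, Finset.card_univ, Fintype.card_fun, Fintype.card_fin, nsmul_eq_mul]
  push_cast
  ring

/-- The circuits of length `2 k` whose word is pair-matched. -/
def pairCircuits (L : Link ι) (n k : ℕ) : Set (Fin (2 * k + 1) → Fin n) :=
  {π | π 0 = π (Fin.last _) ∧ ∀ i, letterCount (L.word π) i = 2}

/-- The exact dependence on `k` is kept because this bounds the limit moments well enough for them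
to determine the law. -/
lemma ncard_pairCircuits_le (L : Link ι) {Δ : ℕ}
    (hΔ : ∀ (n : ℕ) (t : ι) (k : Fin n), {l : Fin n | L n k l = t}.ncard ≤ Δ) (k : ℕ) :
    (L.pairCircuits n k).ncard ≤ 4 ^ k * (2 * k) ^ k * Δ ^ k * n ^ (1 + k) := by
  classical
  set T : Finset (Fin (2 * k + 1) → Fin n) := Finset.univ.filter fun π => π ∈ L.pairCircuits n k
  have hT : (L.pairCircuits n k).ncard = T.card := by
    rw [← Set.ncard_coe_finset]; simp [T]
  rw [hT, Finset.card_eq_sum_card_fiberwise (t := pairWords k)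
    (f := fun π => canonicalWord (L.word π)) (fun π hπ => by
      simp only [pairWords, Finset.coe_filter, Finset.mem_univ, true_and, Set.mem_ofPred_eq]
      exact ⟨canonicalWord_canonicalWord _, by
        rw [letterCount_canonicalWord]
        exact ((Finset.mem_filter.1 hπ).2).2⟩)]
  calc _ ≤ ∑ _w ∈ pairWords k, Δ ^ k * n ^ (1 + k) := by
        refine Finset.sum_le_sum fun w hw => ?_
        obtain ⟨hc, hp⟩ := (Finset.mem_filter.1 hw).2
        have hb := two_mul_card_firstPositions_of_pairMatched hp
        rw [hc] at hb
        have hb' : (firstPositions w).card = k := by omega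
        have := (Finset.card_le_card (Finset.filter_subset_filter
          (fun π => canonicalWord (L.word π) = w) (Finset.subset_univ T))).trans
          (L.card_paths_canonicalWord_le (n := n) hΔ w)
        rw [hb', mul_comm (n ^ (1 + k))] at this
        refine this.trans (le_of_eq ?_)
        congr 2
        omega
    _ ≤ _ := by
        rw [Finset.sum_const, smul_eq_mul, mul_assoc (4 ^ k * (2 * k) ^ k)]
        exact Nat.mul_le_mul_right _ (card_pairWords_le k)

lemma mem_circuits_iff (L : Link ι) {w : Fin h → Fin h} (hw : canonicalWord w = w)
    (π : Fin (h + 1) → Fin n) :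
    π ∈ L.circuits n (fun i => (w i : ℕ)) ↔
      π 0 = π (Fin.last h) ∧ canonicalWord (L.word π) = w := by
  have : (∀ i j : Fin h, (w i : ℕ) = w j ↔ L n (π i.castSucc) (π i.succ) = L n (π j.castSucc) (π j.succ))
      ↔ canonicalWord (L.word π) = w := by
    constructor
    · intro h
      rw [← hw]
      refine canonicalWord_congr fun i j => ?_
      rw [Fin.ext_iff]
      exact (h i j).symm
    · rintro h i j
      rw [← Fin.ext_iff, ← h]
      exact canonicalWord_eq_iff _
  simp only [circuits, Set.mem_ofPred_eq, this]

/-- Each circuit is sorted by its pair of canonical words. This turns the existence of the limits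
`p_Z(w, w')` into the convergence of a single count for each `k`. -/
lemma ncard_pairCircuits_inter {κ : Type*} (L : Link ι) (L' : Link κ) (n k : ℕ) :
    (L.pairCircuits n k ∩ L'.pairCircuits n k).ncard =
      ∑ q ∈ pairWords k ×ˢ pairWords k,
        (L.circuits n (fun i => (q.1 i : ℕ)) ∩ L'.circuits n (fun i => (q.2 i : ℕ))).ncard := by
  classical
  set T : Finset (Fin (2 * k + 1) → Fin n) :=
    Finset.univ.filter fun π => π ∈ L.pairCircuits n k ∩ L'.pairCircuits n k
  have hT : (L.pairCircuits n k ∩ L'.pairCircuits n k).ncard = T.card := by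
    rw [← Set.ncard_coe_finset]; congr 1; ext; simp [T]
  rw [hT, Finset.card_eq_sum_card_fiberwise (t := pairWords k ×ˢ pairWords k)
    (f := fun π => (canonicalWord (L.word π), canonicalWord (L'.word π))) (fun π hπ => by
      have hπ' := (Finset.mem_filter.1 hπ).2
      simp only [pairWords, Finset.coe_product, Finset.coe_filter, Finset.mem_univ, true_and,
        Set.mem_prod, Set.mem_ofPred_eq, canonicalWord_canonicalWord, letterCount_canonicalWord]
      exact ⟨hπ'.1.2, hπ'.2.2⟩)]
  refine Finset.sum_congr rfl fun q hq => ?_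
  obtain ⟨hq1, hq2⟩ := Finset.mem_product.1 hq
  obtain ⟨hc1, hp1⟩ := (Finset.mem_filter.1 hq1).2
  obtain ⟨hc2, hp2⟩ := (Finset.mem_filter.1 hq2).2
  rw [← Set.ncard_coe_finset]
  congr 1
  ext π
  simp only [Finset.coe_filter, Set.mem_ofPred_eq, Set.mem_inter_iff, mem_circuits_iff _ hc1,
    mem_circuits_iff _ hc2, T, Finset.mem_filter, Finset.mem_univ, true_and, pairCircuits,
    Prod.ext_iff]
  constructor
  · rintro ⟨⟨⟨h1, -⟩, -⟩, h3, h4⟩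
    exact ⟨⟨h1, h3⟩, h1, h4⟩
  · rintro ⟨⟨h1, h3⟩, -, h4⟩
    refine ⟨⟨⟨h1, ?_⟩, h1, ?_⟩, h3, h4⟩
    · rw [← letterCount_canonicalWord, h3]; exact hp1
    · rw [← letterCount_canonicalWord, h4]; exact hp2

end Link

/-! ### Traces as sums over circuits, and moments of products of inputs -/

lemma Matrix.pow_apply_eq_sum_paths {n : ℕ} (M : Matrix (Fin n) (Fin n) ℝ) (h : ℕ) (a b : Fin n) :
    (M ^ h) a b = ∑ π : Fin (h + 1) → Fin n, if π 0 = a ∧ π (Fin.last h) = b then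
      ∏ i : Fin h, M (π i.castSucc) (π i.succ) else 0 := by
  induction h generalizing b with
  | zero =>
    rw [← (Equiv.funUnique (Fin 1) (Fin n)).symm.sum_comp]
    simp only [pow_zero, Matrix.one_apply, Equiv.funUnique_symm_apply, uniqueElim_const,
      Finset.univ_eq_empty, Finset.prod_empty]
    by_cases hab : a = b
    · subst hab; simp
    · rw [if_neg hab, Finset.sum_eq_zero]
      rintro c -
      rw [if_neg]
      rintro ⟨rfl, rfl⟩
      exact hab rfl
  | succ h ih =>
    rw [pow_succ, Matrix.mul_apply, ← (Fin.snocEquiv (fun _ : Fin (h + 1 + 1) => Fin n)).sum_comp,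
      Fintype.sum_prod_type]
    simp_rw [ih, Finset.sum_mul]
    rw [Finset.sum_comm]
    conv_rhs => rw [Finset.sum_comm]
    refine Finset.sum_congr rfl fun π _ => ?_
    simp only [Fin.snocEquiv_apply, Fin.snoc_last, Fin.prod_univ_castSucc, Fin.succ_last]
    have h0 : ∀ c : Fin n, (Fin.snoc π c : Fin (h + 1 + 1) → Fin n) 0 = π 0 := fun c =>
      Fin.snoc_castSucc (α := fun _ => Fin n) c π 0
    have hs : ∀ (c : Fin n) (i : Fin h), (Fin.snoc π c : Fin (h + 1 + 1) → Fin n) i.castSucc.succ =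
        π i.succ := fun c i => Fin.snoc_castSucc (α := fun _ => Fin n) c π i.succ
    have hc : ∀ (c : Fin n) (i : Fin (h + 1)), (Fin.snoc π c : Fin (h + 1 + 1) → Fin n) i.castSucc =
        π i := fun c i => Fin.snoc_castSucc (α := fun _ => Fin n) c π i
    simp only [h0, hs, hc]
    rw [Finset.sum_eq_single (π (Fin.last h)) (by
        intro c _ hne; rw [if_neg fun hh => hne hh.2.symm, zero_mul]) (by simp),
      Finset.sum_eq_single b (by intro c _ hne; rw [if_neg fun hh => hne hh.2]) (by simp)]
    by_cases hπ : π 0 = a <;> simp [hπ]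

lemma Matrix.trace_pow_eq_sum_circuits {n : ℕ} (M : Matrix (Fin n) (Fin n) ℝ) (h : ℕ) :
    (M ^ h).trace = ∑ π : Fin (h + 1) → Fin n, if π 0 = π (Fin.last h) then
      ∏ i : Fin h, M (π i.castSucc) (π i.succ) else 0 := by
  simp only [Matrix.trace, Matrix.diag_apply, Matrix.pow_apply_eq_sum_paths]
  rw [Finset.sum_comm]
  refine Finset.sum_congr rfl fun π _ => ?_
  split_ifs with hπ
  · rw [Finset.sum_eq_single (π 0)]
    · simp [hπ]
    · intro c _ hne; rw [if_neg fun hh => hne hh.1.symm]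
    · simp
  · refine Finset.sum_eq_zero fun c _ => if_neg ?_
    rintro ⟨rfl, h2⟩
    exact hπ h2.symm

/-- The product is at most the `h`-th power of its largest factor; the summand `1` covers the empty
product. It reduces mixed moments to pure ones. -/
lemma abs_prod_le_one_add_sum_pow {h : ℕ} (a : Fin h → ℝ) :
    |∏ i, a i| ≤ 1 + ∑ i, |a i| ^ h := by
  rcases h.eq_zero_or_pos with rfl | hpos
  · simp
  · have : Nonempty (Fin h) := ⟨⟨0, hpos⟩⟩
    obtain ⟨i₀, -, hi₀⟩ := Finset.exists_max_image (Finset.univ : Finset (Fin h)) (fun i => |a i|)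
      Finset.univ_nonempty
    rw [Finset.abs_prod]
    calc ∏ i, |a i| ≤ ∏ _i : Fin h, |a i₀| :=
          Finset.prod_le_prod (fun i _ => abs_nonneg _) fun i hi => hi₀ i hi
      _ = |a i₀| ^ h := by simp
      _ ≤ ∑ i, |a i| ^ h := Finset.single_le_sum (f := fun i => |a i| ^ h)
          (fun i _ => by positivity) (Finset.mem_univ i₀)
      _ ≤ _ := by linarith

lemma one_le_letterCount {α : Type*} {h : ℕ} (f : Fin h → α) (i : Fin h) : 1 ≤ letterCount f i := by
  rw [letterCount, Nat.one_le_iff_ne_zero, Ne, Set.ncard_eq_zero]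
  exact fun h => Set.notMem_empty i (h ▸ (rfl : f i = f i))

namespace MomentInput

variable {ι Ω : Type*} [MeasurableSpace Ω] {x : ι → Ω → ℝ} {P : Measure Ω}

lemma of_bounded [IsProbabilityMeasure P] (hx : BoundedInput x P) : MomentInput x P where
  measurable := hx.measurable
  indep := hx.indep
  moments p := by
    obtain ⟨C, hC⟩ := hx.bounded
    refine ⟨(max C 0) ^ p, fun k => ?_⟩
    have hle : ∀ᵐ ω ∂P, |x k ω| ^ p ≤ (max C 0) ^ p := (hC k).mono fun ω hω =>
      pow_le_pow_left₀ (abs_nonneg _) (hω.trans (le_max_left _ _)) p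
    have hint : Integrable (fun ω => |x k ω| ^ p) P := by
      refine Integrable.of_bound ((hx.measurable k).abs.pow_const p).aestronglyMeasurable
        ((max C 0) ^ p) (hle.mono fun ω hω => ?_)
      rwa [Real.norm_of_nonneg (by positivity)]
    refine ⟨hint, ?_⟩
    have := integral_mono_ae hint (integrable_const _) hle
    simpa using this
  mean := hx.mean
  variance := hx.variance

lemma integral_sq [IsProbabilityMeasure P] (hx : MomentInput x P) (k : ι) :
    ∫ ω, x k ω ^ 2 ∂P = 1 := by
  have := variance_eq_integral (hx.measurable k).aemeasurable (μ := P)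
  rw [hx.variance, hx.mean] at this
  simpa using this.symm

lemma exists_bound_prod [IsProbabilityMeasure P] (hx : MomentInput x P) (h : ℕ) :
    ∃ C : ℝ, ∀ f : Fin h → ι, Integrable (fun ω => ∏ i, x (f i) ω) P ∧
      ∫ ω, |∏ i, x (f i) ω| ∂P ≤ C := by
  obtain ⟨C, hC⟩ := hx.moments h
  refine ⟨1 + h * C, fun f => ?_⟩
  have hm : Measurable fun ω => ∏ i, x (f i) ω :=
    Finset.measurable_fun_prod _ fun i _ => hx.measurable (f i)
  have hi : Integrable (fun ω => 1 + ∑ i, |x (f i) ω| ^ h) P :=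
    (integrable_const _).add (integrable_finsetSum _ fun i _ => (hC (f i)).1)
  have hle : ∀ ω, |∏ i, x (f i) ω| ≤ 1 + ∑ i, |x (f i) ω| ^ h := fun ω =>
    abs_prod_le_one_add_sum_pow fun i => x (f i) ω
  have hint : Integrable (fun ω => ∏ i, x (f i) ω) P :=
    hi.mono' hm.aestronglyMeasurable (Eventually.of_forall hle)
  refine ⟨hint, ?_⟩
  calc ∫ ω, |∏ i, x (f i) ω| ∂P ≤ ∫ ω, 1 + ∑ i, |x (f i) ω| ^ h ∂P :=
        integral_mono hint.abs hi hle
    _ = 1 + ∑ i, ∫ ω, |x (f i) ω| ^ h ∂P := by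
        rw [integral_add (integrable_const _) (integrable_finsetSum _ fun i _ => (hC (f i)).1),
          integral_finsetSum _ fun i _ => (hC (f i)).1]
        simp
    _ ≤ 1 + ∑ _i : Fin h, C := by
        gcongr with i
        exact (hC (f i)).2
    _ = _ := by simp

open Classical in
lemma integral_prod_eq [IsProbabilityMeasure P] (hx : MomentInput x P) {h : ℕ} (f : Fin h → ι) :
    ∫ ω, ∏ i, x (f i) ω ∂P = ∏ t ∈ Finset.univ.image f,
      ∫ ω, x t ω ^ (Finset.univ.filter fun i => f i = t).card ∂P := by
  have hi := (hx.indep.precomp (g := ((↑) : ↥(Finset.univ.image f) → ι)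
    ) Subtype.val_injective).integral_fun_prod_comp
    (f := fun t r => r ^ (Finset.univ.filter fun i => f i = t.1).card)
    (fun t => (hx.measurable t.1).aemeasurable) (fun t => by fun_prop)
  rw [← Finset.prod_coe_sort (Finset.univ.image f)]
  refine Eq.trans ?_ hi
  congr 1
  ext ω
  rw [Finset.prod_comp (fun t => x t ω) f, ← Finset.prod_coe_sort (Finset.univ.image f)]

lemma integral_prod_eq_zero [IsProbabilityMeasure P] (hx : MomentInput x P) {h : ℕ} {f : Fin h → ι}
    {i : Fin h} (hi : letterCount f i = 1) : ∫ ω, ∏ i, x (f i) ω ∂P = 0 := by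
  classical
  rw [hx.integral_prod_eq]
  refine Finset.prod_eq_zero (Finset.mem_image_of_mem f (Finset.mem_univ i)) ?_
  have : (Finset.univ.filter fun j => f j = f i).card = 1 := by
    rw [← hi, letterCount, ← Set.ncard_coe_finset]; simp
  rw [this]
  simpa using hx.mean (f i)

lemma integral_prod_eq_one [IsProbabilityMeasure P] (hx : MomentInput x P) {h : ℕ} {f : Fin h → ι}
    (hf : ∀ i, letterCount f i = 2) : ∫ ω, ∏ i, x (f i) ω ∂P = 1 := by
  classical
  rw [hx.integral_prod_eq]
  refine Finset.prod_eq_one fun t ht => ?_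
  obtain ⟨i, -, rfl⟩ := Finset.mem_image.1 ht
  have : (Finset.univ.filter fun j => f j = f i).card = 2 := by
    rw [← hf i, letterCount, ← Set.ncard_coe_finset]; simp
  rw [this, hx.integral_sq]

end MomentInput

/-! ### Expected traces of the entrywise product -/

section Hadamard

variable {ιX ιY Ω : Type*} {LX : Link ιX} {LY : Link ιY} {x : ιX → Ω → ℝ} {y : ιY → Ω → ℝ}

/-- The entrywise product of two patterned matrices. -/
def hadamardPatterned (LX : Link ιX) (x : ιX → Ω → ℝ) (LY : Link ιY) (y : ιY → Ω → ℝ) (n : ℕ) (ω : Ω) :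
    Matrix (Fin n) (Fin n) ℝ :=
  patternedMatrix LX x n ω ⊙ patternedMatrix LY y n ω

lemma hadamardPatterned_apply (n : ℕ) (ω : Ω) (i j : Fin n) :
    hadamardPatterned LX x LY y n ω i j = x (LX n i j) ω * y (LY n i j) ω := rfl

lemma scaledHadamard_eq (n : ℕ) (ω : Ω) :
    scaledHadamard LX x LY y n ω = (Real.sqrt n)⁻¹ • hadamardPatterned LX x LY y n ω := rfl

variable [MeasurableSpace Ω] {P : Measure Ω}

lemma IndepPatterned.indepFun_word (hxy : IndepPatterned LX x LY y P) {n h : ℕ}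
    (π : Fin (h + 1) → Fin n) :
    IndepFun (fun ω => ∏ i, x (LX.word π i) ω) (fun ω => ∏ i, y (LY.word π i) ω) P := by
  have hm : Measurable fun a : (n : ℕ) → Fin n → Fin n → ℝ =>
      ∏ i : Fin h, a n (π i.castSucc) (π i.succ) := by fun_prop
  have := IndepFun.comp (φ := fun a : (n : ℕ) → Fin n → Fin n → ℝ =>
    ∏ i : Fin h, a n (π i.castSucc) (π i.succ)) (ψ := fun a : (n : ℕ) → Fin n → Fin n → ℝ =>
    ∏ i : Fin h, a n (π i.castSucc) (π i.succ)) hxy hm hm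
  exact this

/-- Up to an error of relative order `n^(-1/2)`, the expected trace counts the circuits whose two
words are both pair-matched. -/
lemma exists_integral_trace_bound [IsProbabilityMeasure P] (hXB : LX.PropertyB) (hYB : LY.PropertyB)
    (hx : MomentInput x P) (hy : MomentInput y P) (hxy : IndepPatterned LX x LY y P) (h : ℕ) :
    ∃ C : ℝ, ∀ n : ℕ, n ≠ 0 →
      Integrable (fun ω => (hadamardPatterned LX x LY y n ω ^ h).trace) P ∧
      |(∫ ω, (hadamardPatterned LX x LY y n ω ^ h).trace ∂P) / (n * Real.sqrt n ^ h) -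
        ({π : Fin (h + 1) → Fin n | π 0 = π (Fin.last h) ∧ (∀ i, letterCount (LX.word π) i = 2) ∧
          ∀ i, letterCount (LY.word π) i = 2}.ncard : ℝ) / (n * Real.sqrt n ^ h)| ≤
        C / Real.sqrt n := by
  classical
  obtain ⟨CX, hCX⟩ := hx.exists_bound_prod h
  obtain ⟨CY, hCY⟩ := hy.exists_bound_prod h
  obtain ⟨BX, hBX0, hBX⟩ := LX.ncard_nonPairPaths_le hXB h
  obtain ⟨BY, hBY0, hBY⟩ := LY.ncard_nonPairPaths_le hYB h
  refine ⟨|CX| * |CY| * (BX + BY), fun n hn => ?_⟩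
  have hprod : ∀ ω, (hadamardPatterned LX x LY y n ω ^ h).trace =
      ∑ π : Fin (h + 1) → Fin n, if π 0 = π (Fin.last h) then
        (∏ i, x (LX.word π i) ω) * ∏ i, y (LY.word π i) ω else 0 := by
    intro ω
    rw [Matrix.trace_pow_eq_sum_circuits]
    simp only [hadamardPatterned_apply, Finset.prod_mul_distrib, Link.word]
  have hint : ∀ π : Fin (h + 1) → Fin n, Integrable (fun ω => if π 0 = π (Fin.last h) then
      (∏ i, x (LX.word π i) ω) * ∏ i, y (LY.word π i) ω else 0) P := by
    intro π
    by_cases hπ : π 0 = π (Fin.last h)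
    · simp only [hπ, if_true]
      exact (hxy.indepFun_word π).integrable_mul (hCX _).1 (hCY _).1
    · simp [hπ]
  simp_rw [hprod]
  refine ⟨integrable_finsetSum _ fun π _ => hint π, ?_⟩
  rw [integral_finsetSum _ fun π _ => hint π]
  set E : (Fin (h + 1) → Fin n) → ℝ := fun π => ∫ ω, (if π 0 = π (Fin.last h) then
      (∏ i, x (LX.word π i) ω) * ∏ i, y (LY.word π i) ω else 0) ∂P
  have hE : ∀ π, π 0 = π (Fin.last h) → E π =
      (∫ ω, ∏ i, x (LX.word π i) ω ∂P) * ∫ ω, ∏ i, y (LY.word π i) ω ∂P := by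
    intro π hπ
    simp only [E, hπ, if_true]
    exact (hxy.indepFun_word π).integral_fun_mul_eq_mul_integral
      (hCX _).1.aestronglyMeasurable (hCY _).1.aestronglyMeasurable
  set W := {π : Fin (h + 1) → Fin n | π 0 = π (Fin.last h) ∧ (∀ i, letterCount (LX.word π) i = 2) ∧
          ∀ i, letterCount (LY.word π) i = 2} with hW
  -- A letter occurring once in either word makes the expectation zero, and two pair-matched words
  -- make it one. In the only other case the path is non-pair for one of the links, and its
  -- expectation is bounded by the constants for mixed moments.
  have hbd : ∀ π, |E π - if π ∈ W then 1 else 0| ≤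
      |CX| * |CY| * ((if π ∈ LX.nonPairPaths n h then 1 else 0) +
        if π ∈ LY.nonPairPaths n h then 1 else 0) := by
    intro π
    have hnn : 0 ≤ |CX| * |CY| * ((if π ∈ LX.nonPairPaths n h then 1 else 0) +
        if π ∈ LY.nonPairPaths n h then (1 : ℝ) else 0) := by positivity
    by_cases hπ : π 0 = π (Fin.last h)
    · by_cases hX1 : ∃ i, letterCount (LX.word π) i = 1
      · obtain ⟨i, hi⟩ := hX1
        rw [hE π hπ, hx.integral_prod_eq_zero hi, if_neg]
        · simpa using hnn
        · rintro ⟨-, h1, -⟩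
          have := h1 i; omega
      by_cases hY1 : ∃ i, letterCount (LY.word π) i = 1
      · obtain ⟨i, hi⟩ := hY1
        rw [hE π hπ, hy.integral_prod_eq_zero hi, if_neg]
        · simpa using hnn
        · rintro ⟨-, -, h1⟩
          have := h1 i; omega
      push Not at hX1 hY1
      have hX2 : ∀ i, 2 ≤ letterCount (LX.word π) i := fun i => by
        have := hX1 i; have := one_le_letterCount (LX.word π) i; omega
      have hY2 : ∀ i, 2 ≤ letterCount (LY.word π) i := fun i => by
        have := hY1 i; have := one_le_letterCount (LY.word π) i; omega
      by_cases hXp : ∀ i, letterCount (LX.word π) i = 2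
      · by_cases hYp : ∀ i, letterCount (LY.word π) i = 2
        · rw [hE π hπ, hx.integral_prod_eq_one hXp, hy.integral_prod_eq_one hYp,
            if_pos ⟨hπ, hXp, hYp⟩]
          simpa using hnn
        · have hmem : π ∈ LY.nonPairPaths n h := ⟨hY2, hYp⟩
          rw [if_neg fun hh => hYp hh.2.2, hE π hπ, sub_zero, abs_mul, if_pos hmem]
          refine (mul_le_mul ((abs_integral_le_integral_abs.trans (hCX _).2).trans (le_abs_self _))
            ((abs_integral_le_integral_abs.trans (hCY _).2).trans (le_abs_self _)) (abs_nonneg _)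
            (abs_nonneg _)).trans ?_
          refine le_mul_of_one_le_right (by positivity) ?_
          split_ifs <;> norm_num
      · have hmem : π ∈ LX.nonPairPaths n h := ⟨hX2, hXp⟩
        rw [if_neg fun hh => hXp hh.2.1, hE π hπ, sub_zero, abs_mul, if_pos hmem]
        refine (mul_le_mul ((abs_integral_le_integral_abs.trans (hCX _).2).trans (le_abs_self _))
          ((abs_integral_le_integral_abs.trans (hCY _).2).trans (le_abs_self _)) (abs_nonneg _)
          (abs_nonneg _)).trans ?_
        refine le_mul_of_one_le_right (by positivity) ?_
        split_ifs <;> norm_num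
    · have : E π = 0 := by simp [E, hπ]
      rw [this, if_neg fun hh => hπ hh.1]
      simpa using hnn
  have hcard : ∀ (S : Set (Fin (h + 1) → Fin n)) [DecidablePred (· ∈ S)], ∑ π, (if π ∈ S then (1 : ℝ) else 0) = S.ncard := by
    intro S _
    rw [Finset.sum_boole, ← Set.ncard_coe_finset]
    simp
  have hsum : |∑ π, E π - W.ncard| ≤
      |CX| * |CY| * ((LX.nonPairPaths n h).ncard + (LY.nonPairPaths n h).ncard) := by
    rw [← hcard W, ← hcard, ← hcard, ← Finset.sum_sub_distrib, ← Finset.sum_add_distrib,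
      Finset.mul_sum]
    refine (Finset.abs_sum_le_sum_abs _ _).trans (Finset.sum_le_sum fun π _ => ?_)
    exact hbd π
  have hn0 : (0 : ℝ) < n := Nat.cast_pos.2 (Nat.pos_of_ne_zero hn)
  have hd : 0 < (n : ℝ) * Real.sqrt n ^ h := by positivity
  rw [← sub_div, abs_div, abs_of_pos hd]
  calc |∑ π, E π - W.ncard| / (n * Real.sqrt n ^ h)
      ≤ |CX| * |CY| * ((LX.nonPairPaths n h).ncard + (LY.nonPairPaths n h).ncard) /
        (n * Real.sqrt n ^ h) := by gcongr
    _ = |CX| * |CY| * ((LX.nonPairPaths n h).ncard / (n * Real.sqrt n ^ h) +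
        (LY.nonPairPaths n h).ncard / (n * Real.sqrt n ^ h)) := by ring
    _ ≤ |CX| * |CY| * (BX / Real.sqrt n + BY / Real.sqrt n) := by
        exact mul_le_mul_of_nonneg_left (add_le_add (hBX n hn) (hBY n hn)) (by positivity)
    _ = _ := by ring

end Hadamard

/-! ### The moment method through characteristic functions -/

section MomentMethod

open Complex in
-- The derivative of the remainder of order `N + 1` is `c` times the remainder of order `N`, so the
-- bound integrates up. Using `c = ±i` with `t ≥ 0` covers both signs of the real argument.
lemma norm_exp_mul_sub_sum_le {c : ℂ} (hre : c.re = 0) (hc : ‖c‖ = 1) (N : ℕ) {t : ℝ} (ht : 0 ≤ t) :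
    ‖exp (c * t) - ∑ j ∈ Finset.range N, (c * t) ^ j / (j.factorial : ℂ)‖ ≤
      t ^ N / (N.factorial : ℝ) := by
  induction N generalizing t with
  | zero => simp [Complex.norm_exp, hre]
  | succ N ih =>
    have hlin : ∀ s : ℝ, HasDerivAt (fun s : ℝ => c * (s : ℂ)) c s := fun s => by
      simpa using (Complex.ofRealCLM.hasDerivAt (x := s)).const_mul c
    have hd : ∀ s : ℝ, HasDerivAt (fun s : ℝ => exp (c * s) -
        ∑ j ∈ Finset.range (N + 1), (c * s) ^ j / (j.factorial : ℂ))
        (c * (exp (c * s) - ∑ j ∈ Finset.range N, (c * s) ^ j / (j.factorial : ℂ))) s := by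
      intro s
      have h1 : HasDerivAt (fun s : ℝ => exp (c * s)) (exp (c * s) * c) s := (hlin s).cexp
      have h2 : HasDerivAt (fun s : ℝ => ∑ j ∈ Finset.range (N + 1), (c * s) ^ j / (j.factorial : ℂ))
          (∑ j ∈ Finset.range (N + 1), (j * (c * s) ^ (j - 1) * c) / (j.factorial : ℂ)) s :=
        HasDerivAt.fun_sum fun j _ => ((hlin s).fun_pow j).div_const _
      refine (h1.sub h2).congr_deriv ?_
      rw [Finset.sum_range_succ', mul_sub, Finset.mul_sum]
      simp only [Nat.cast_zero, zero_mul, zero_div, add_zero]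
      congr 1
      · ring
      · refine Finset.sum_congr rfl fun j _ => ?_
        have : (j.factorial : ℂ) ≠ 0 := by exact_mod_cast j.factorial_ne_zero
        have h3 : ((j : ℂ) + 1) ≠ 0 := by exact_mod_cast j.succ_ne_zero
        rw [Nat.factorial_succ, Nat.add_sub_cancel]
        push_cast
        field_simp
    have hB : ∀ s : ℝ, HasDerivAt (fun s : ℝ => s ^ (N + 1) / ((N + 1).factorial : ℝ))
        (s ^ N / (N.factorial : ℝ)) s := by
      intro s
      refine ((hasDerivAt_pow (N + 1) s).div_const _).congr_deriv ?_
      have : (N.factorial : ℝ) ≠ 0 := by exact_mod_cast N.factorial_ne_zero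
      rw [Nat.factorial_succ, Nat.add_sub_cancel]
      push_cast
      field_simp
    refine image_norm_le_of_norm_deriv_right_le_deriv_boundary (a := 0) (b := t)
      (fun s _ => (hd s).continuousAt.continuousWithinAt) (fun s _ => (hd s).hasDerivWithinAt)
      ?_ hB (fun s hs => ?_) ⟨ht, le_rfl⟩
    · rw [Finset.sum_range_succ']
      simp
    · rw [norm_mul, hc, one_mul]
      exact ih hs.1

open Complex in
lemma norm_exp_mul_I_sub_sum_le (x : ℝ) (N : ℕ) :
    ‖exp (x * I) - ∑ j ∈ Finset.range N, (x * I) ^ j / (j.factorial : ℂ)‖ ≤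
      |x| ^ N / (N.factorial : ℝ) := by
  rcases le_total 0 x with hx | hx
  · rw [abs_of_nonneg hx, mul_comm]
    exact norm_exp_mul_sub_sum_le (by simp) (by simp) N hx
  · have := norm_exp_mul_sub_sum_le (c := -I) (by simp) (by simp) N (neg_nonneg.2 hx)
    rw [abs_of_nonpos hx]
    convert this using 4 <;> push_cast <;> ring_nf

lemma norm_charFun_sub_sum_le {ν : Measure ℝ} [IsProbabilityMeasure ν]
    (hν : ∀ h : ℕ, Integrable (fun x : ℝ => x ^ h) ν) (s : ℝ) (N : ℕ) :
    ‖charFun ν s - ∑ j ∈ Finset.range N, (s * Complex.I) ^ j / (j.factorial : ℂ) *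
      ((∫ x, x ^ j ∂ν : ℝ) : ℂ)‖ ≤ |s| ^ N / (N.factorial : ℝ) * ∫ x, |x| ^ N ∂ν := by
  have hi : ∀ j : ℕ, Integrable (fun x : ℝ =>
      (s * Complex.I) ^ j / (j.factorial : ℂ) * ((x ^ j : ℝ) : ℂ)) ν :=
    fun j => ((hν j).ofReal (𝕜 := ℂ)).const_mul _
  have he : Integrable (fun x : ℝ => Complex.exp (s * x * Complex.I)) ν := by
    refine Integrable.of_bound (by fun_prop) 1 (Eventually.of_forall fun x => ?_)
    have := Complex.norm_exp_ofReal_mul_I (s * x)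
    push_cast at this
    exact this.le
  have h1 : charFun ν s - ∑ j ∈ Finset.range N, (s * Complex.I) ^ j / (j.factorial : ℂ) *
      ((∫ x, x ^ j ∂ν : ℝ) : ℂ) = ∫ x, (Complex.exp (s * x * Complex.I) -
        ∑ j ∈ Finset.range N, (s * Complex.I) ^ j / (j.factorial : ℂ) * ((x ^ j : ℝ) : ℂ)) ∂ν := by
    rw [integral_sub he (integrable_finsetSum _ fun j _ => hi j), charFun_apply_real,
      integral_finsetSum _ fun j _ => hi j]
    congr 1
    refine Finset.sum_congr rfl fun j _ => ?_
    rw [integral_const_mul]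
    congr 1
    exact (integral_ofReal (𝕜 := ℂ)).symm
  rw [h1, ← integral_const_mul]
  have ha : Integrable (fun x : ℝ => |x| ^ N) ν := by
    simpa [abs_pow] using (hν N).abs
  refine norm_integral_le_of_norm_le (ha.const_mul _) (Eventually.of_forall fun x => ?_)
  have := norm_exp_mul_I_sub_sum_le (s * x) N
  rw [abs_mul, mul_pow, mul_div_right_comm] at this
  have h2 : Complex.exp (s * x * Complex.I) -
      ∑ j ∈ Finset.range N, (s * Complex.I) ^ j / (j.factorial : ℂ) * ((x ^ j : ℝ) : ℂ) =
      Complex.exp ((s * x : ℝ) * Complex.I) -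
        ∑ j ∈ Finset.range N, ((s * x : ℝ) * Complex.I) ^ j / (j.factorial : ℂ) := by
    push_cast
    congr 1
    refine Finset.sum_congr rfl fun j _ => ?_
    ring
  rw [h2]
  exact this

/-- The moments of the measures `ν n` converge to the numbers `m h`. -/
structure HasMomentLimits (ν : ℕ → ProbabilityMeasure ℝ) (m : ℕ → ℝ) : Prop where
  integrable : ∀ n h, Integrable (fun x : ℝ => x ^ h) (ν n : Measure ℝ)
  tendsto : ∀ h, Tendsto (fun n => ∫ x, x ^ h ∂(ν n : Measure ℝ)) atTop (𝓝 (m h))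

/-- The Taylor polynomial of even order `2K` has an error controlled by the moment of order `2K`
itself, which converges. The approximant `z` depends on `m` and `s` only, not on `ν`; this gives
both the Cauchy property and the equality of limits for different sequences. -/
lemma exists_eventually_norm_charFun_sub_lt {m : ℕ → ℝ}
    (hm : ∀ s : ℝ, Tendsto (fun K : ℕ => s ^ (2 * K) / ((2 * K).factorial : ℝ) * m (2 * K)) atTop (𝓝 0))
    (s : ℝ) {ε : ℝ} (hε : 0 < ε) : ∃ z : ℂ, ∀ ν : ℕ → ProbabilityMeasure ℝ, HasMomentLimits ν m →
      ∀ᶠ n in atTop, ‖charFun (ν n : Measure ℝ) s - z‖ < ε := by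
  obtain ⟨K, hK⟩ := ((hm s).eventually_lt_const (half_pos hε)).exists
  refine ⟨∑ j ∈ Finset.range (2 * K), (s * Complex.I) ^ j / (j.factorial : ℂ) * (m j : ℂ),
    fun ν hν => ?_⟩
  have h1 : Tendsto (fun n => ‖∑ j ∈ Finset.range (2 * K), (s * Complex.I) ^ j / (j.factorial : ℂ) *
      ((∫ x, x ^ j ∂(ν n : Measure ℝ) : ℝ) : ℂ) - ∑ j ∈ Finset.range (2 * K),
        (s * Complex.I) ^ j / (j.factorial : ℂ) * (m j : ℂ)‖) atTop (𝓝 0) := by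
    rw [← tendsto_iff_norm_sub_tendsto_zero]
    refine tendsto_finsetSum _ fun j _ => Tendsto.const_mul _ ?_
    exact (Complex.continuous_ofReal.tendsto _).comp (hν.tendsto j)
  have h2 := ((hν.tendsto (2 * K)).const_mul (s ^ (2 * K) / ((2 * K).factorial : ℝ))).eventually_lt_const hK
  filter_upwards [h1.eventually_lt_const (half_pos hε), h2] with n hn1 hn2
  have h3 := norm_charFun_sub_sum_le (hν.integrable n) s (2 * K)
  have heven : Even (2 * K) := even_two_mul K
  simp only [heven.pow_abs] at h3
  calc _ ≤ _ := norm_sub_le_norm_sub_add_norm_sub _ _ _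
    _ < ε / 2 + ε / 2 := add_lt_add (h3.trans_lt hn2) hn1
    _ = ε := add_halves ε

/-- The characteristic functions converge pointwise to a function `f` that is the same for all
sequences with these limit moments. Continuity of `f` at zero gives tightness, and any subsequential
limit `μ` has characteristic function `f`. Having one `μ` for all `ν'` is the source of
universality. -/
theorem exists_tendsto_of_hasMomentLimits {m : ℕ → ℝ}
    (hm : ∀ s : ℝ, Tendsto (fun K : ℕ => s ^ (2 * K) / ((2 * K).factorial : ℝ) * m (2 * K)) atTop (𝓝 0))
    {ν : ℕ → ProbabilityMeasure ℝ} (hν : HasMomentLimits ν m) :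
    ∃ μ : ProbabilityMeasure ℝ, ∀ ν' : ℕ → ProbabilityMeasure ℝ, HasMomentLimits ν' m →
      Tendsto ν' atTop (𝓝 μ) := by
  have hex : ∀ s, ∃ f : ℂ, Tendsto (fun n => charFun (ν n : Measure ℝ) s) atTop (𝓝 f) := by
    refine fun s => cauchySeq_tendsto_of_complete (Metric.cauchySeq_iff.2 fun ε hε => ?_)
    obtain ⟨z, hz⟩ := exists_eventually_norm_charFun_sub_lt hm s (half_pos hε)
    obtain ⟨N, hN⟩ := eventually_atTop.1 (hz ν hν)
    refine ⟨N, fun a ha b hb => ?_⟩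
    rw [dist_eq_norm]
    have h1 := hN a ha
    have h2 := hN b hb
    rw [norm_sub_rev] at h2
    linarith [norm_sub_le_norm_sub_add_norm_sub (charFun (ν a : Measure ℝ) s) z
      (charFun (ν b : Measure ℝ) s)]
  choose f hf using hex
  have huniq : ∀ ν' : ℕ → ProbabilityMeasure ℝ, HasMomentLimits ν' m → ∀ s,
      Tendsto (fun n => charFun (ν' n : Measure ℝ) s) atTop (𝓝 (f s)) := by
    intro ν' hν' s
    refine Metric.tendsto_nhds.2 fun ε hε => ?_
    obtain ⟨z, hz⟩ := exists_eventually_norm_charFun_sub_lt hm s (half_pos hε)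
    have h1 : ‖f s - z‖ ≤ ε / 2 := le_of_tendsto ((hf s).sub_const z).norm
      ((hz ν hν).mono fun n hn => hn.le)
    filter_upwards [hz ν' hν'] with n hn
    rw [dist_eq_norm]
    rw [norm_sub_rev] at h1
    linarith [norm_sub_le_norm_sub_add_norm_sub (charFun (ν' n : Measure ℝ) s) z (f s)]
  have hcont : ContinuousAt f 0 := by
    -- First order Taylor bound together with `|x| ≤ 1 + x²`.
    have hbd : ∀ s, ‖f s - 1‖ ≤ |s| * (1 + m 2) := by
      intro s
      refine le_of_tendsto_of_tendsto ((hf s).sub_const 1).norm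
        (((hν.tendsto 2).const_add 1).const_mul |s|) (Eventually.of_forall fun n => ?_)
      have h1 := norm_charFun_sub_sum_le (hν.integrable n) s 1
      simp only [Finset.range_one, Finset.sum_singleton, pow_zero, Nat.factorial, Nat.cast_one,
        div_one, integral_const, probReal_univ, smul_eq_mul, mul_one, Complex.ofReal_one,
        pow_one] at h1
      refine h1.trans (mul_le_mul_of_nonneg_left ?_ (abs_nonneg _))
      have hi1 : Integrable (fun x : ℝ => |x|) (ν n : Measure ℝ) := by
        simpa using (hν.integrable n 1).abs
      have hi2 : Integrable (fun x : ℝ => 1 + x ^ 2) (ν n : Measure ℝ) :=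
        (integrable_const 1).add (hν.integrable n 2)
      refine (integral_mono hi1 hi2 fun x => ?_).trans_eq ?_
      · show |x| ≤ 1 + x ^ 2
        rw [← sq_abs]
        nlinarith [sq_nonneg (|x| - 1), abs_nonneg x]
      · rw [integral_add (integrable_const 1) (hν.integrable n 2)]
        simp
    have h0 : f 0 = 1 := by
      have := hbd 0
      simp only [abs_zero, zero_mul, norm_le_zero_iff] at this
      exact sub_eq_zero.1 this
    rw [ContinuousAt, h0, tendsto_iff_norm_sub_tendsto_zero]
    refine squeeze_zero (fun _ => norm_nonneg _) hbd ?_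
    have : Continuous fun s : ℝ => |s| * (1 + m 2) := by fun_prop
    simpa using this.tendsto 0
  have htight := isTightMeasureSet_of_tendsto_charFun (μ := fun n => (ν n : Measure ℝ)) hcont hf
  have hcpt : IsCompact (closure (Set.range ν)) := by
    refine isCompact_closure_of_isTightMeasureSet ?_
    convert htight using 1
    ext; simp
  let := TopologicalSpace.metrizableSpaceMetric (ProbabilityMeasure ℝ)
  obtain ⟨μ, -, φ, hφ, hμ⟩ := hcpt.isSeqCompact (x := ν)
    fun n => subset_closure (Set.mem_range_self n)
  refine ⟨μ, fun ν' hν' => ProbabilityMeasure.tendsto_iff_tendsto_charFun.2 fun s => ?_⟩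
  have h1 := ProbabilityMeasure.tendsto_iff_tendsto_charFun.1 hμ s
  rw [tendsto_nhds_unique h1 ((hf s).comp hφ.tendsto_atTop)]
  exact huniq ν' hν' s

end MomentMethod

/-! ### Limit moments, and their invariance under relabelling -/

namespace Link

variable {ι κ : Type*}

/-- The normalized number of circuits of length `2 k` that are pair-matched for both link functions
converges to `β k`. -/
def HasWordMoments (L : Link ι) (L' : Link κ) (β : ℕ → ℝ) : Prop :=
  ∀ k, Tendsto (fun n : ℕ => ((L.pairCircuits n k ∩ L'.pairCircuits n k).ncard : ℝ) / (n : ℝ) ^ (1 + k))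
    atTop (𝓝 (β k))

lemma isPairMatched_of_mem_pairWords {k : ℕ} {w : Fin (2 * k) → Fin (2 * k)} (hw : w ∈ pairWords k) :
    IsPairMatched fun i => (w i : ℕ) := by
  intro i
  have := (Finset.mem_filter.1 hw).2.2 i
  simpa [letterCount, Fin.ext_iff] using this

lemma exists_hasWordMoments {L : Link ι} {L' : Link κ} (h : WordLimitsExist L L') :
    ∃ β, L.HasWordMoments L' β := by
  have hk : ∀ k, ∃ b, Tendsto (fun n : ℕ =>
      ((L.pairCircuits n k ∩ L'.pairCircuits n k).ncard : ℝ) / (n : ℝ) ^ (1 + k)) atTop (𝓝 b) := by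
    intro k
    have hq : ∀ q : (Fin (2 * k) → Fin (2 * k)) × (Fin (2 * k) → Fin (2 * k)), ∃ p : ℝ,
        q ∈ pairWords k ×ˢ pairWords k → Tendsto (fun n : ℕ =>
          ((L.circuits n (fun i => (q.1 i : ℕ)) ∩ L'.circuits n (fun i => (q.2 i : ℕ))).ncard : ℝ) /
            (n : ℝ) ^ (1 + k)) atTop (𝓝 p) := by
      intro q
      by_cases hq : q ∈ pairWords k ×ˢ pairWords k
      · obtain ⟨h1, h2⟩ := Finset.mem_product.1 hq
        obtain ⟨p, hp⟩ := h k _ _ (isPairMatched_of_mem_pairWords h1)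
          (isPairMatched_of_mem_pairWords h2)
        exact ⟨p, fun _ => hp⟩
      · exact ⟨0, fun h => absurd h hq⟩
    choose p hp using hq
    refine ⟨∑ q ∈ pairWords k ×ˢ pairWords k, p q, ?_⟩
    simp only [ncard_pairCircuits_inter, Nat.cast_sum, Finset.sum_div]
    exact tendsto_finsetSum _ hp
  choose β hβ using hk
  exact ⟨β, hβ⟩

variable {ι' κ' : Type*} {ρ : ℕ → ι → ι'} {ρ' : ℕ → κ → κ'}

lemma PropertyB.comp {L : Link ι} (hL : L.PropertyB) (hρ : ∀ n, Function.Injective (ρ n)) :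
    (L.comp ρ).PropertyB := by
  obtain ⟨Δ, hΔ⟩ := hL
  refine ⟨Δ, fun n t k => ?_⟩
  by_cases ht : ∃ s, ρ n s = t
  · obtain ⟨s, rfl⟩ := ht
    simpa only [Link.comp, (hρ n).eq_iff] using hΔ n s k
  · have : {l : Fin n | L.comp ρ n k l = t} = ∅ := by
      ext l
      simp only [Set.mem_ofPred_eq, Set.mem_empty_iff_false, iff_false]
      exact fun h => ht ⟨_, h⟩
    simp [this]

/-- Only equalities between values of the link enter, so an injection changes nothing, even one that
varies with `n`. -/
lemma pairCircuits_comp (L : Link ι) (hρ : ∀ n, Function.Injective (ρ n)) (n k : ℕ) :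
    (L.comp ρ).pairCircuits n k = L.pairCircuits n k := by
  ext π
  simp only [pairCircuits, Set.mem_ofPred_eq, letterCount, word, Link.comp, (hρ n).eq_iff]

lemma HasWordMoments.comp {L : Link ι} {L' : Link κ} {β : ℕ → ℝ} (h : L.HasWordMoments L' β)
    (hρ : ∀ n, Function.Injective (ρ n)) (hρ' : ∀ n, Function.Injective (ρ' n)) :
    (L.comp ρ).HasWordMoments (L'.comp ρ') β := by
  intro k
  simpa only [pairCircuits_comp _ hρ, pairCircuits_comp _ hρ'] using h k

lemma HasWordMoments.exists_le {L : Link ι} {L' : Link κ} {β : ℕ → ℝ} (h : L.HasWordMoments L' β)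
    (hL : L.PropertyB) : ∃ Δ : ℕ, ∀ k, 0 ≤ β k ∧ β k ≤ 4 ^ k * (2 * k) ^ k * Δ ^ k := by
  obtain ⟨Δ, hΔ⟩ := hL
  refine ⟨Δ, fun k => ⟨ge_of_tendsto' (h k) fun n => by positivity, ?_⟩⟩
  refine le_of_tendsto (h k) ?_
  filter_upwards [eventually_gt_atTop 0] with n hn
  have hn' : (0 : ℝ) < n := Nat.cast_pos.2 hn
  rw [div_le_iff₀ (by positivity)]
  have h1 := (Set.ncard_le_ncard
    (Set.inter_subset_left (t := L'.pairCircuits n k)) (Set.toFinite _)).trans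
    (L.ncard_pairCircuits_le (n := n) hΔ k)
  exact_mod_cast h1

end Link

/-- The moments of the limit law: `β k` in degree `2 k`, and `0` in odd degrees. -/
def evenMoments (β : ℕ → ℝ) (h : ℕ) : ℝ := if Even h then β (h / 2) else 0

lemma evenMoments_two_mul (β : ℕ → ℝ) (k : ℕ) : evenMoments β (2 * k) = β k := by
  simp [evenMoments]

/-- Since `(2K)! ≥ K! K^K`, the factor `K^K` in the bound on `β K` cancels and a term `(8 s² Δ)^K /
K!` remains. -/
lemma tendsto_evenMoments_div_factorial {β : ℕ → ℝ} {Δ : ℕ}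
    (h : ∀ k, 0 ≤ β k ∧ β k ≤ 4 ^ k * (2 * k) ^ k * Δ ^ k) (s : ℝ) :
    Tendsto (fun K : ℕ => s ^ (2 * K) / ((2 * K).factorial : ℝ) * evenMoments β (2 * K)) atTop (𝓝 0) := by
  refine squeeze_zero (fun K => ?_) (fun K => ?_)
    (FloorSemiring.tendsto_pow_div_factorial_atTop (8 * s ^ 2 * Δ))
  · rw [evenMoments_two_mul, pow_mul]
    have := (h K).1
    positivity
  · rw [evenMoments_two_mul, pow_mul]
    have hfac : ((K.factorial : ℝ)) * K ^ K ≤ ((2 * K).factorial : ℝ) := by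
      have h1 := Nat.factorial_mul_pow_le_factorial (m := K) (n := K)
      rw [← two_mul] at h1
      refine le_trans ?_ (Nat.cast_le.2 h1)
      push_cast
      gcongr
      linarith
    have hK : (0 : ℝ) < K ^ K := by
      rcases K.eq_zero_or_pos with rfl | hK
      · simp
      · positivity
    calc (s ^ 2) ^ K / ((2 * K).factorial : ℝ) * β K
        ≤ (s ^ 2) ^ K / ((2 * K).factorial : ℝ) * (4 ^ K * (2 * K) ^ K * Δ ^ K) :=
          mul_le_mul_of_nonneg_left (h K).2 (by positivity)
      _ ≤ (s ^ 2) ^ K / ((K.factorial : ℝ) * K ^ K) * (4 ^ K * (2 * K) ^ K * Δ ^ K) := by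
          gcongr
      _ = (8 * s ^ 2 * Δ) ^ K / (K.factorial : ℝ) := by
          rw [mul_pow 2 (K : ℝ), mul_pow, mul_pow, show (8 : ℝ) = 4 * 2 by norm_num, mul_pow 4]
          field_simp

section Hadamard

variable {ιX ιY Ω : Type*} {LX : Link ιX} {LY : Link ιY} {x : ιX → Ω → ℝ} {y : ιY → Ω → ℝ}

lemma isHermitian_hadamardPatterned (hX : LX.Symm) (hY : LY.Symm) (n : ℕ) (ω : Ω) :
    (hadamardPatterned LX x LY y n ω).IsHermitian := by
  ext i j
  simp [hadamardPatterned_apply, hX n j i, hY n j i]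

lemma isHermitian_scaledHadamard (hX : LX.Symm) (hY : LY.Symm) (n : ℕ) (ω : Ω) :
    (scaledHadamard LX x LY y n ω).IsHermitian := by
  ext i j
  simp [scaledHadamard_eq, hadamardPatterned_apply, hX n j i, hY n j i]

lemma trace_scaledHadamard_pow (n h : ℕ) (ω : Ω) : (scaledHadamard LX x LY y n ω ^ h).trace =
    (hadamardPatterned LX x LY y n ω ^ h).trace / Real.sqrt n ^ h := by
  rw [scaledHadamard_eq, smul_pow, Matrix.trace_smul, smul_eq_mul, inv_pow, inv_mul_eq_div]

variable [MeasurableSpace Ω] {P : Measure Ω}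

lemma measurable_scaledHadamard (hx : ∀ t, Measurable (x t)) (hy : ∀ t, Measurable (y t)) (n : ℕ)
    (i j : Fin n) : Measurable fun ω => scaledHadamard LX x LY y n ω i j := by
  simp only [scaledHadamard_eq, Matrix.smul_apply, hadamardPatterned_apply, smul_eq_mul]
  exact ((hx _).mul (hy _)).const_mul _

lemma tendsto_integral_trace [IsProbabilityMeasure P] (hXB : LX.PropertyB) (hYB : LY.PropertyB)
    (hx : MomentInput x P) (hy : MomentInput y P) (hxy : IndepPatterned LX x LY y P) {β : ℕ → ℝ}
    (hβ : LX.HasWordMoments LY β) (h : ℕ) :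
    Tendsto (fun n : ℕ => (∫ ω, (hadamardPatterned LX x LY y n ω ^ h).trace ∂P) /
      (n * Real.sqrt n ^ h)) atTop (𝓝 (evenMoments β h)) := by
  obtain ⟨C, hC⟩ := exists_integral_trace_bound hXB hYB hx hy hxy h
  have hmain : Tendsto (fun n : ℕ => ({π : Fin (h + 1) → Fin n | π 0 = π (Fin.last h) ∧
      (∀ i, letterCount (LX.word π) i = 2) ∧ ∀ i, letterCount (LY.word π) i = 2}.ncard : ℝ) /
        (n * Real.sqrt n ^ h)) atTop (𝓝 (evenMoments β h)) := by
    rcases Nat.even_or_odd' h with ⟨k, rfl | rfl⟩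
    · rw [evenMoments_two_mul]
      refine (hβ k).congr fun n => ?_
      rw [pow_mul, Real.sq_sqrt n.cast_nonneg, pow_add, pow_one]
      congr 3
      ext π
      simp only [Link.pairCircuits, Set.mem_inter_iff, Set.mem_ofPred_eq]
      tauto
    -- No word of odd length is pair-matched, so the count is zero for every `n`.
    · have : ¬ Even (2 * k + 1) := by simp
      rw [evenMoments, if_neg this]
      refine tendsto_const_nhds.congr fun n => ?_
      rw [eq_comm, div_eq_zero_iff, Nat.cast_eq_zero, Set.ncard_eq_zero]
      left
      rw [Set.eq_empty_iff_forall_notMem]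
      rintro π ⟨-, hπ, -⟩
      have := two_mul_card_firstPositions_of_pairMatched hπ
      omega
  have hz : Tendsto (fun n : ℕ => C / Real.sqrt n) atTop (𝓝 0) :=
    tendsto_const_nhds.div_atTop (Real.tendsto_sqrt_atTop.comp tendsto_natCast_atTop_atTop)
  have hdiff : Tendsto (fun n : ℕ => (∫ ω, (hadamardPatterned LX x LY y n ω ^ h).trace ∂P) /
      (n * Real.sqrt n ^ h) - ({π : Fin (h + 1) → Fin n | π 0 = π (Fin.last h) ∧
      (∀ i, letterCount (LX.word π) i = 2) ∧ ∀ i, letterCount (LY.word π) i = 2}.ncard : ℝ) /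
        (n * Real.sqrt n ^ h)) atTop (𝓝 0) := by
    refine squeeze_zero_norm' ?_ hz
    filter_upwards [eventually_ne_atTop 0] with n hn
    exact (hC n hn).2
  simpa using hdiff.add hmain

end Hadamard

/-! ### Expected empirical spectral distributions -/

section ExpectedESD

variable {Ω : Type*} [MeasurableSpace Ω] {P : Measure Ω} {n : ℕ} {A : Ω → Matrix (Fin n) (Fin n) ℝ}

/-- The expected empirical spectral distribution of a random Hermitian matrix. -/
noncomputable def expectedESD (hA : ∀ ω, (A ω).IsHermitian) (P : Measure Ω) : Measure ℝ :=
  (n : ENNReal)⁻¹ • ∑ i, P.map fun ω => (hA ω).eigenvalues i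

lemma isProbabilityMeasure_expectedESD [IsProbabilityMeasure P] (hA : ∀ ω, (A ω).IsHermitian)
    (hm : ∀ i j, Measurable fun ω => A ω i j) (hn : n ≠ 0) :
    IsProbabilityMeasure (expectedESD hA P) := by
  refine ⟨?_⟩
  have h1 : ∀ i, P.map (fun ω => (hA ω).eigenvalues i) Set.univ = 1 := fun i => by
    rw [Measure.map_apply (Matrix.IsHermitian.measurable_eigenvalues hA hm i) MeasurableSet.univ]
    simp
  simp only [expectedESD, Measure.smul_apply, Measure.coe_finsetSum, Finset.sum_apply, h1,
    Finset.sum_const, Finset.card_univ, Fintype.card_fin, smul_eq_mul, nsmul_eq_mul, mul_one]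
  exact ENNReal.inv_mul_cancel (by exact_mod_cast hn) (by simp)

lemma integrable_expectedESD (hA : ∀ ω, (A ω).IsHermitian)
    (hm : ∀ i j, Measurable fun ω => A ω i j) (hn : n ≠ 0) {f : ℝ → ℝ} (hf : Measurable f)
    (hi : ∀ i, Integrable (fun ω => f ((hA ω).eigenvalues i)) P) : Integrable f (expectedESD hA P) := by
  refine Integrable.smul_measure (integrable_finsetSum_measure.2 fun i _ => ?_) (by simpa using hn)
  exact (integrable_map_measure hf.aestronglyMeasurable
    (Matrix.IsHermitian.measurable_eigenvalues hA hm i).aemeasurable).2 (hi i)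

lemma integral_expectedESD (hA : ∀ ω, (A ω).IsHermitian)
    (hm : ∀ i j, Measurable fun ω => A ω i j) {f : ℝ → ℝ} (hf : Measurable f)
    (hi : ∀ i, Integrable (fun ω => f ((hA ω).eigenvalues i)) P) :
    ∫ t, f t ∂(expectedESD hA P) = (∫ ω, ∑ i, f ((hA ω).eigenvalues i) ∂P) / n := by
  have hmi := Matrix.IsHermitian.measurable_eigenvalues hA hm
  rw [expectedESD, integral_smul_measure, integral_finsetSum_measure, integral_finsetSum _ fun i _ => hi i]
  · simp only [ENNReal.toReal_inv, ENNReal.toReal_natCast, smul_eq_mul]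
    rw [inv_mul_eq_div]
    congr 1
    refine Finset.sum_congr rfl fun i _ => ?_
    exact integral_map (hmi i).aemeasurable hf.aestronglyMeasurable
  · exact fun i _ => (integrable_map_measure hf.aestronglyMeasurable (hmi i).aemeasurable).2 (hi i)

/-- The power `λᵢ^h` is dominated by `1 + λᵢ^(2h)`, and `λᵢ^(2h)` by the trace of the even power. A
trace of order `h` alone would not bound single eigenvalues for odd `h`. -/
lemma integrable_eigenvalues_pow [IsProbabilityMeasure P] (hA : ∀ ω, (A ω).IsHermitian)
    (hm : ∀ i j, Measurable fun ω => A ω i j) {h : ℕ}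
    (hi : Integrable (fun ω => (A ω ^ (2 * h)).trace) P) (i : Fin n) :
    Integrable (fun ω => (hA ω).eigenvalues i ^ h) P := by
  have hmi := Matrix.IsHermitian.measurable_eigenvalues hA hm i
  have hi' : Integrable (fun ω => 1 + (A ω ^ (2 * h)).trace) P := (integrable_const 1).add hi
  refine hi'.mono' (hmi.pow_const h).aestronglyMeasurable (Eventually.of_forall fun ω => ?_)
  rw [← (hA ω).sum_eigenvalues_pow, Real.norm_eq_abs]
  have h1 : ((hA ω).eigenvalues i ^ h) ^ 2 ≤ ∑ k, (hA ω).eigenvalues k ^ (2 * h) := by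
    rw [← pow_mul, mul_comm h 2]
    exact Finset.single_le_sum (f := fun k => (hA ω).eigenvalues k ^ (2 * h))
      (fun k _ => (even_two_mul h).pow_nonneg _) (Finset.mem_univ i)
  rw [← sq_abs] at h1
  nlinarith [sq_nonneg (|(hA ω).eigenvalues i ^ h| - 1), abs_nonneg ((hA ω).eigenvalues i ^ h)]

end ExpectedESD

section Limit

variable {ιX ιY Ω : Type*} {LX : Link ιX} {LY : Link ιY} {x : ιX → Ω → ℝ} {y : ιY → Ω → ℝ}
  [MeasurableSpace Ω] {P : Measure Ω} [IsProbabilityMeasure P]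

lemma integrable_trace_scaledHadamard_pow (hXB : LX.PropertyB) (hYB : LY.PropertyB)
    (hx : MomentInput x P) (hy : MomentInput y P) (hxy : IndepPatterned LX x LY y P) {n : ℕ}
    (hn : n ≠ 0) (h : ℕ) : Integrable (fun ω => (scaledHadamard LX x LY y n ω ^ h).trace) P := by
  obtain ⟨C, hC⟩ := exists_integral_trace_bound hXB hYB hx hy hxy h
  simp only [trace_scaledHadamard_pow]
  exact (hC n hn).1.div_const _

/-- The expected empirical spectral distributions of the scaled products, indexed from size `1`. -/
noncomputable def expectedESDSeq (hX : LX.Symm) (hY : LY.Symm) (hx : ∀ t, Measurable (x t))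
    (hy : ∀ t, Measurable (y t)) (P : Measure Ω) [IsProbabilityMeasure P] (n : ℕ) :
    ProbabilityMeasure ℝ :=
  ⟨expectedESD (isHermitian_scaledHadamard (x := x) (y := y) hX hY (n + 1)) P,
    isProbabilityMeasure_expectedESD _ (measurable_scaledHadamard hx hy _) n.succ_ne_zero⟩

theorem hasMomentLimits_expectedESDSeq (hX : LX.Symm) (hY : LY.Symm)
    (hXB : LX.PropertyB) (hYB : LY.PropertyB)
    (hx : MomentInput x P) (hy : MomentInput y P) (hxy : IndepPatterned LX x LY y P) {β : ℕ → ℝ}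
    (hβ : LX.HasWordMoments LY β) :
    HasMomentLimits (expectedESDSeq hX hY hx.measurable hy.measurable P) (evenMoments β) where
  integrable n h := integrable_expectedESD _ (measurable_scaledHadamard hx.measurable hy.measurable _)
    n.succ_ne_zero (by fun_prop) (integrable_eigenvalues_pow _
      (measurable_scaledHadamard hx.measurable hy.measurable _)
      (integrable_trace_scaledHadamard_pow hXB hYB hx hy hxy n.succ_ne_zero _))
  tendsto h := by
    refine ((tendsto_integral_trace hXB hYB hx hy hxy hβ h).comp (tendsto_add_atTop_nat 1)).congr
      fun n => ?_
    have := integral_expectedESD (P := P) (isHermitian_scaledHadamard (x := x) (y := y) hX hY (n + 1))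
      (measurable_scaledHadamard hx.measurable hy.measurable _) (f := fun t => t ^ h) (by fun_prop)
      (integrable_eigenvalues_pow _ (measurable_scaledHadamard hx.measurable hy.measurable _)
        (integrable_trace_scaledHadamard_pow hXB hYB hx hy hxy n.succ_ne_zero _))
    refine Eq.trans ?_ this.symm
    simp only [Matrix.IsHermitian.sum_eigenvalues_pow, trace_scaledHadamard_pow, integral_div,
      Function.comp_apply]
    rw [div_div, mul_comm]

end Limit

/-! ### Fluctuations of a convex spectral functional for clipped inputs -/

section Clip

/-- The number `r` clipped to the interval `[-R, R]`. -/
def clip (R r : ℝ) : ℝ := max (-R) (min r R)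

lemma abs_clip_le {R : ℝ} (hR : 0 ≤ R) (r : ℝ) : |clip R r| ≤ R :=
  abs_le.2 ⟨le_max_left _ _, max_le (by linarith) (min_le_right _ _)⟩

lemma clip_of_abs_le {R r : ℝ} (h : |r| ≤ R) : clip R r = r := by
  rw [clip, min_eq_left (abs_le.1 h).2, max_eq_right (abs_le.1 h).1]

lemma measurable_clip (R : ℝ) : Measurable (clip R) := by
  unfold clip; fun_prop

variable {n : ℕ} {α β : Type*} {f : Fin n → Fin n → α} {g : Fin n → Fin n → β}

/-- The scaled entrywise product of the matrices with patterns `f` and `g` and clipped entries. -/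
noncomputable def clippedMatrix (f : Fin n → Fin n → α) (g : Fin n → Fin n → β) (R : ℝ)
    (z : α ⊕ β → ℝ) : Matrix (Fin n) (Fin n) ℝ :=
  Matrix.of fun i j => (Real.sqrt n)⁻¹ * (clip R (z (Sum.inl (f i j))) * clip R (z (Sum.inr (g i j))))

lemma isHermitian_clippedMatrix (hf : ∀ i j, f i j = f j i) (hg : ∀ i j, g i j = g j i) (R : ℝ)
    (z : α ⊕ β → ℝ) : (clippedMatrix f g R z).IsHermitian := by
  ext i j
  simp [clippedMatrix, hf j i, hg j i]

lemma measurable_clippedMatrix (R : ℝ) (i j : Fin n) :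
    Measurable fun z : α ⊕ β → ℝ => clippedMatrix f g R z i j := by
  exact (((measurable_clip R).comp (measurable_pi_apply _)).mul
    ((measurable_clip R).comp (measurable_pi_apply _))).const_mul _

lemma abs_clippedMatrix_le {R : ℝ} (hR : 0 ≤ R) (z : α ⊕ β → ℝ) (i j : Fin n) :
    |clippedMatrix f g R z i j| ≤ (Real.sqrt n)⁻¹ * R ^ 2 := by
  simp only [clippedMatrix, Matrix.of_apply, abs_mul, abs_inv, abs_of_nonneg (Real.sqrt_nonneg _), sq]
  gcongr <;> exact abs_clip_le hR _

/-- The normalized sum of the positive parts of the eigenvalues shifted by `t`. -/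
noncomputable def eigenPosPart {A : Matrix (Fin n) (Fin n) ℝ} (hA : A.IsHermitian) (t : ℝ) : ℝ :=
  (∑ i, max (hA.eigenvalues i - t) 0) / n

lemma measurable_eigenPosPart {Ω : Type*} [MeasurableSpace Ω] {A : Ω → Matrix (Fin n) (Fin n) ℝ}
    (hA : ∀ ω, (A ω).IsHermitian) (hm : ∀ i j, Measurable fun ω => A ω i j) (t : ℝ) :
    Measurable fun ω => eigenPosPart (hA ω) t := by
  have := Matrix.IsHermitian.measurable_eigenvalues hA hm
  unfold eigenPosPart
  refine Measurable.div_const (Finset.measurable_fun_sum _ fun i _ => ?_) _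
  exact ((this i).sub_const t).max measurable_const

lemma abs_eigenPosPart_le (hf : ∀ i j, f i j = f j i) (hg : ∀ i j, g i j = g j i) (hn : n ≠ 0) {R : ℝ}
    (hR : 0 ≤ R) (t : ℝ) (z : α ⊕ β → ℝ) :
    |eigenPosPart (isHermitian_clippedMatrix hf hg R z) t| ≤ 1 + |t| + R ^ 4 := by
  have hn0 : (0 : ℝ) < n := Nat.cast_pos.2 (Nat.pos_of_ne_zero hn)
  have hA := isHermitian_clippedMatrix hf hg R z
  have h0 : ∀ i, 0 ≤ max (hA.eigenvalues i - t) 0 := fun i => le_max_right _ _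
  rw [eigenPosPart, abs_of_nonneg (div_nonneg (Finset.sum_nonneg fun i _ => h0 i) hn0.le),
    div_le_iff₀ hn0]
  have h1 : ∑ i, hA.eigenvalues i ^ 2 ≤ n * R ^ 4 := by
    rw [hA.sum_eigenvalues_sq]
    calc ∑ i, ∑ j, clippedMatrix f g R z i j ^ 2
        ≤ ∑ _i : Fin n, ∑ _j : Fin n, ((Real.sqrt n)⁻¹ * R ^ 2) ^ 2 := by
          refine Finset.sum_le_sum fun i _ => Finset.sum_le_sum fun j _ => ?_
          rw [← sq_abs]
          exact pow_le_pow_left₀ (abs_nonneg _) (abs_clippedMatrix_le hR z i j) 2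
      _ = n * R ^ 4 := by
          simp only [Finset.sum_const, Finset.card_univ, Fintype.card_fin, nsmul_eq_mul, mul_pow,
            inv_pow, Real.sq_sqrt hn0.le]
          field_simp
  calc ∑ i, max (hA.eigenvalues i - t) 0 ≤ ∑ i, (1 + |t| + hA.eigenvalues i ^ 2) := by
        refine Finset.sum_le_sum fun i _ => max_le ?_ (by positivity)
        nlinarith [sq_nonneg (hA.eigenvalues i - 1), neg_abs_le t, sq_nonneg (hA.eigenvalues i)]
    _ = (1 + |t|) * n + ∑ i, hA.eigenvalues i ^ 2 := by
        rw [Finset.sum_add_distrib]; simp; ring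
    _ ≤ _ := by linarith

lemma card_filter_le_of_row [DecidableEq α] {Δ : ℕ}
    (hfΔ : ∀ i a, (Finset.univ.filter fun j => f i j = a).card ≤ Δ) (a : α) :
    (Finset.univ.filter fun p : Fin n × Fin n => f p.1 p.2 = a).card ≤ n * Δ := by
  rw [Finset.card_filter, Fintype.sum_prod_type]
  calc ∑ i, ∑ j, (if f i j = a then 1 else 0) ≤ ∑ _i : Fin n, Δ := by
        refine Finset.sum_le_sum fun i _ => ?_
        rw [← Finset.card_filter]; exact hfΔ i a
    _ = n * Δ := by simp

/-- By convexity every decrease is bounded by the same linear functional `Q`, taken at `z`. Changing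
variable `k` alters only the at most `nΔ` entries of its cell, each by at most `2R² / √n`, so
Cauchy–Schwarz bounds the squared decrease by `4R⁴Δ / n²` times the mass of `Q²` on the cell. Each
entry lies in two cells, one for each factor, and the total mass of `Q²` is at most `n`. -/
lemma sum_sq_max_eigenPosPart_le [Fintype α] [Fintype β] [DecidableEq α] [DecidableEq β]
    (hf : ∀ i j, f i j = f j i) (hg : ∀ i j, g i j = g j i)
    {Δ : ℕ} (hfΔ : ∀ i a, (Finset.univ.filter fun j => f i j = a).card ≤ Δ)
    (hgΔ : ∀ i b, (Finset.univ.filter fun j => g i j = b).card ≤ Δ) (hn : n ≠ 0) {R : ℝ} (hR : 0 ≤ R)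
    (t : ℝ) (z z' : α ⊕ β → ℝ) :
    ∑ k, max (eigenPosPart (isHermitian_clippedMatrix hf hg R z) t -
      eigenPosPart (isHermitian_clippedMatrix hf hg R (Function.update z k (z' k))) t) 0 ^ 2 ≤
      8 * R ^ 4 * Δ / n := by
  have hn0 : (0 : ℝ) < n := Nat.cast_pos.2 (Nat.pos_of_ne_zero hn)
  obtain ⟨Q, hQ, hQd⟩ := (isHermitian_clippedMatrix hf hg R z).exists_support_sum_posPart t
  let cell : α ⊕ β → Finset (Fin n × Fin n) := Sum.elim
    (fun a => Finset.univ.filter fun p => f p.1 p.2 = a) fun b => Finset.univ.filter fun p => g p.1 p.2 = b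
  have hcell : ∀ k, ((cell k).card : ℝ) ≤ n * Δ := by
    rintro (a | b)
    · exact_mod_cast card_filter_le_of_row hfΔ a
    · exact_mod_cast card_filter_le_of_row hgΔ b
  have hsum : ∑ k, ∑ p ∈ cell k, Q p.1 p.2 ^ 2 ≤ 2 * n := by
    rw [Fintype.sum_sum_type]
    simp only [cell, Sum.elim_inl, Sum.elim_inr]
    rw [Finset.sum_fiberwise, Finset.sum_fiberwise, Fintype.sum_prod_type]
    linarith
  have hk : ∀ k, max (eigenPosPart (isHermitian_clippedMatrix hf hg R z) t -
      eigenPosPart (isHermitian_clippedMatrix hf hg R (Function.update z k (z' k))) t) 0 ^ 2 ≤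
      4 * R ^ 4 * Δ / n ^ 2 * ∑ p ∈ cell k, Q p.1 p.2 ^ 2 := by
    intro k
    set A := clippedMatrix f g R z
    set A' := clippedMatrix f g R (Function.update z k (z' k)) with hA'
    have h1 := hQd (isHermitian_clippedMatrix hf hg R (Function.update z k (z' k)))
    have hout : ∀ p ∉ cell k, A p.1 p.2 - A' p.1 p.2 = 0 := by
      intro p hp
      have hl : Sum.inl (f p.1 p.2) ≠ k := by
        rintro rfl; simp [cell] at hp
      have hr : Sum.inr (g p.1 p.2) ≠ k := by
        rintro rfl; simp [cell] at hp
      simp [A, A', clippedMatrix, Function.update_of_ne hl, Function.update_of_ne hr]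
    have hin : ∀ p : Fin n × Fin n, |A p.1 p.2 - A' p.1 p.2| ≤ 2 * ((Real.sqrt n)⁻¹ * R ^ 2) := by
      intro p
      have h2 := abs_clippedMatrix_le (f := f) (g := g) hR z p.1 p.2
      have h3 := abs_clippedMatrix_le (f := f) (g := g) hR (Function.update z k (z' k)) p.1 p.2
      exact (abs_sub _ _).trans (by linarith)
    have h2 : ∑ i, ∑ j, Q i j * (A i j - A' i j) = ∑ p ∈ cell k, Q p.1 p.2 * (A p.1 p.2 - A' p.1 p.2) := by
      rw [← Fintype.sum_prod_type' (f := fun i j => Q i j * (A i j - A' i j))]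
      refine (Finset.sum_subset (Finset.subset_univ _) fun p _ hp => ?_).symm
      rw [hout p hp, mul_zero]
    have h3 : (∑ p ∈ cell k, Q p.1 p.2 * (A p.1 p.2 - A' p.1 p.2)) ^ 2 ≤
        (∑ p ∈ cell k, Q p.1 p.2 ^ 2) * (4 * R ^ 4 * Δ) := by
      refine (Finset.sum_mul_sq_le_sq_mul_sq _ _ _).trans ?_
      refine mul_le_mul_of_nonneg_left ?_ (Finset.sum_nonneg fun _ _ => sq_nonneg _)
      calc ∑ p ∈ cell k, (A p.1 p.2 - A' p.1 p.2) ^ 2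
          ≤ ∑ _p ∈ cell k, (2 * ((Real.sqrt n)⁻¹ * R ^ 2)) ^ 2 := by
            refine Finset.sum_le_sum fun p _ => ?_
            rw [← sq_abs]
            exact pow_le_pow_left₀ (abs_nonneg _) (hin p) 2
        _ = (cell k).card * (4 * R ^ 4 / n) := by
            rw [Finset.sum_const, nsmul_eq_mul, mul_pow, mul_pow, inv_pow, Real.sq_sqrt hn0.le]
            ring
        _ ≤ n * Δ * (4 * R ^ 4 / n) := by gcongr; exact hcell k
        _ = 4 * R ^ 4 * Δ := by field_simp
    have h4 : eigenPosPart (isHermitian_clippedMatrix hf hg R z) t -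
        eigenPosPart (isHermitian_clippedMatrix hf hg R (Function.update z k (z' k))) t ≤
        (∑ p ∈ cell k, Q p.1 p.2 * (A p.1 p.2 - A' p.1 p.2)) / n := by
      rw [eigenPosPart, eigenPosPart, ← sub_div, ← h2]
      gcongr
    have h5 : ∀ a b : ℝ, a ≤ b → max a 0 ^ 2 ≤ b ^ 2 := by
      intro a b hab
      rcases le_total a 0 with ha | ha
      · rw [max_eq_right ha]; simpa using sq_nonneg b
      · rw [max_eq_left ha]; exact pow_le_pow_left₀ ha hab 2
    refine (h5 _ _ h4).trans ?_
    rw [div_pow, div_le_iff₀ (by positivity)]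
    refine h3.trans_eq ?_
    field_simp
  calc _ ≤ ∑ k, 4 * R ^ 4 * Δ / n ^ 2 * ∑ p ∈ cell k, Q p.1 p.2 ^ 2 :=
        Finset.sum_le_sum fun k _ => hk k
    _ ≤ 4 * R ^ 4 * Δ / n ^ 2 * (2 * n) := by
        rw [← Finset.mul_sum]; gcongr
    _ = _ := by field_simp; ring

lemma integral_eigenPosPart_sub_pow_four_le [Fintype α] [Fintype β]
    (hf : ∀ i j, f i j = f j i) (hg : ∀ i j, g i j = g j i)
    {Δ : ℕ} (hfΔ : ∀ i a, {j | f i j = a}.ncard ≤ Δ) (hgΔ : ∀ i b, {j | g i j = b}.ncard ≤ Δ)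
    (hn : n ≠ 0) {R : ℝ} (hR : 0 ≤ R) (t : ℝ) (μ : α ⊕ β → Measure ℝ) [∀ k, IsProbabilityMeasure (μ k)] :
    ∫ z, (eigenPosPart (isHermitian_clippedMatrix hf hg R z) t -
      ∫ z', eigenPosPart (isHermitian_clippedMatrix hf hg R z') t ∂Measure.pi μ) ^ 4 ∂Measure.pi μ ≤
      11 * (8 * R ^ 4 * Δ / n) ^ 2 := by
  classical
  refine EfronStein.integral_sub_integral_pow_four_le
    (G := fun z => eigenPosPart (isHermitian_clippedMatrix hf hg R z) t)
    (measurable_eigenPosPart _ (measurable_clippedMatrix R) t) (abs_eigenPosPart_le hf hg hn hR t)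
    (sum_sq_max_eigenPosPart_le hf hg (fun i a => ?_) (fun i a => ?_) hn hR t)
  · convert hfΔ i a; rw [← Set.ncard_coe_finset]; simp
  · convert hgΔ i a; rw [← Set.ncard_coe_finset]; simp

end Clip

/-- The sum of the functions has finite expectation, hence is finite almost everywhere. This
replaces Chebyshev's inequality followed by Borel–Cantelli. -/
lemma ae_tendsto_zero_of_summable_integral {Ω : Type*} [MeasurableSpace Ω] {P : Measure Ω}
    {F : ℕ → Ω → ℝ} (hi : ∀ n, Integrable (F n) P) (h0 : ∀ n ω, 0 ≤ F n ω)
    (hs : Summable fun n => ∫ ω, F n ω ∂P) : ∀ᵐ ω ∂P, Tendsto (fun n => F n ω) atTop (𝓝 0) := by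
  have hm : ∀ n, AEMeasurable (fun ω => ENNReal.ofReal (F n ω)) P := fun n =>
    (hi n).aestronglyMeasurable.aemeasurable.ennreal_ofReal
  have h1 : ∫⁻ ω, ∑' n, ENNReal.ofReal (F n ω) ∂P ≠ ⊤ := by
    rw [lintegral_tsum hm]
    have h2 : ∀ n, ∫⁻ ω, ENNReal.ofReal (F n ω) ∂P = ENNReal.ofReal (∫ ω, F n ω ∂P) := fun n =>
      (ofReal_integral_eq_lintegral_ofReal (hi n) (Eventually.of_forall (h0 n))).symm
    simp_rw [h2]
    exact hs.tsum_ofReal_ne_top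
  filter_upwards [ae_lt_top' (AEMeasurable.tsum hm) h1] with ω hω
  have h3 := ENNReal.tendsto_atTop_zero_of_tsum_ne_top hω.ne
  have h4 := (ENNReal.tendsto_toReal ENNReal.zero_ne_top).comp h3
  refine h4.congr fun n => ?_
  simp [ENNReal.toReal_ofReal (h0 n ω)]

namespace Link

/-- The values of a link function on `{1, …, n}²`. -/
def values {ι : Type*} (L : Link ι) (n : ℕ) : Set ι := Set.range fun p : Fin n × Fin n => L n p.1 p.2

noncomputable instance {ι : Type*} (L : Link ι) (n : ℕ) : Fintype (L.values n) :=
  (Set.finite_range _).fintype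

/-- A link function with codomain restricted to its values. -/
def toValues {ι : Type*} (L : Link ι) (n : ℕ) (i j : Fin n) : L.values n := ⟨L n i j, (i, j), rfl⟩

lemma card_values_le {ι : Type*} (L : Link ι) (n : ℕ) : Fintype.card (L.values n) ≤ n ^ 2 := by
  rw [← Nat.card_eq_fintype_card]
  refine (Finite.card_range_le _).trans ?_
  simp [sq]

end Link

/-! ### Almost sure concentration for inputs with all moments -/

section Concentration

variable {ιX ιY Ω : Type*} {LX : Link ιX} {LY : Link ιY} {x : ιX → Ω → ℝ} {y : ιY → Ω → ℝ}

/-- The input variables that occur in the matrices of size `n`. -/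
def jointInput (LX : Link ιX) (x : ιX → Ω → ℝ) (LY : Link ιY) (y : ιY → Ω → ℝ) (n : ℕ) (ω : Ω) :
    LX.values n ⊕ LY.values n → ℝ := Sum.elim (fun a => x a ω) fun b => y b ω

lemma clippedMatrix_jointInput {n : ℕ} {R : ℝ} {ω : Ω} (h : ∀ k, |jointInput LX x LY y n ω k| ≤ R) :
    clippedMatrix (LX.toValues n) (LY.toValues n) R (jointInput LX x LY y n ω) =
      scaledHadamard LX x LY y n ω := by
  ext i j
  simp only [clippedMatrix, Matrix.of_apply, clip_of_abs_le (h _)]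
  rfl

lemma eigenPosPart_congr {n : ℕ} {A B : Matrix (Fin n) (Fin n) ℝ} (hA : A.IsHermitian)
    (hB : B.IsHermitian) (h : A = B) (t : ℝ) : eigenPosPart hA t = eigenPosPart hB t := by
  subst h; rfl

variable [MeasurableSpace Ω] {P : Measure Ω}

lemma measurable_jointInput (hx : ∀ t, Measurable (x t)) (hy : ∀ t, Measurable (y t)) (n : ℕ) :
    Measurable (jointInput LX x LY y n) := by
  rw [measurable_pi_iff]
  rintro (a | b)
  · exact hx a
  · exact hy b

/-- Independence of the two inputs is only known through the matrices. Choosing for each value of a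
link a position where it occurs recovers the variables from the entries, and then the two product
laws combine. -/
lemma IndepPatterned.map_jointInput [IsProbabilityMeasure P] (hxy : IndepPatterned LX x LY y P)
    (hx : ∀ t, Measurable (x t)) (hy : ∀ t, Measurable (y t))
    (hxi : iIndepFun x P) (hyi : iIndepFun y P) (n : ℕ) :
    P.map (jointInput LX x LY y n) =
      Measure.pi fun k => P.map fun ω => jointInput LX x LY y n ω k := by
  choose pX hpX using fun a : LX.values n => a.2
  choose pY hpY using fun b : LY.values n => b.2
  have h1 : IndepFun (fun ω (a : LX.values n) => x a ω) (fun ω (b : LY.values n) => y b ω) P := by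
    have := IndepFun.comp (φ := fun (A : (n : ℕ) → Fin n → Fin n → ℝ) (a : LX.values n) =>
      A n (pX a).1 (pX a).2) (ψ := fun (A : (n : ℕ) → Fin n → Fin n → ℝ) (b : LY.values n) =>
      A n (pY b).1 (pY b).2) hxy (by fun_prop) (by fun_prop)
    convert this using 1
    · ext ω a
      exact congrArg (x · ω) (hpX a).symm
    · ext ω b
      exact congrArg (y · ω) (hpY b).symm
  have hmx : Measurable fun ω (a : LX.values n) => x a ω := measurable_pi_iff.2 fun a => hx a
  have hmy : Measurable fun ω (b : LY.values n) => y b ω := measurable_pi_iff.2 fun b => hy b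
  have h2 := (indepFun_iff_map_prod_eq_prod_map_map hmx.aemeasurable hmy.aemeasurable).1 h1
  have hX := (iIndepFun_iff_map_fun_eq_pi_map fun a : LX.values n => (hx a).aemeasurable).1
    (hxi.precomp (g := ((↑) : LX.values n → ιX)) Subtype.val_injective)
  have hY := (iIndepFun_iff_map_fun_eq_pi_map fun b : LY.values n => (hy b).aemeasurable).1
    (hyi.precomp (g := ((↑) : LY.values n → ιY)) Subtype.val_injective)
  have hprob : ∀ k, IsProbabilityMeasure (P.map fun ω => jointInput LX x LY y n ω k) := fun k =>
    Measure.isProbabilityMeasure_map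
      ((measurable_pi_apply k).comp (measurable_jointInput hx hy n)).aemeasurable
  have h3 := (measurePreserving_sumPiEquivProdPi_symm
    (fun k => P.map fun ω => jointInput LX x LY y n ω k)).map_eq
  rw [← h3]
  have h4 : (Measure.pi fun i : LX.values n => P.map fun ω => jointInput LX x LY y n ω (Sum.inl i)).prod
      (Measure.pi fun i : LY.values n => P.map fun ω => jointInput LX x LY y n ω (Sum.inr i)) =
      P.map fun ω => (fun a : LX.values n => x a ω, fun b : LY.values n => y b ω) := by
    rw [h2, hX, hY]
    rfl
  rw [h4, Measure.map_map (MeasurableEquiv.measurable _) (hmx.prodMk hmy)]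
  rfl

/-- There are at most `2n²` variables and `(n^(1/16))^64 = n⁴`, so bounded moments of order `64`
give expectations of order `n⁻²`, which are summable. -/
lemma ae_eventually_abs_jointInput_le [IsProbabilityMeasure P] (hx : MomentInput x P)
    (hy : MomentInput y P) : ∀ᵐ ω ∂P, ∀ᶠ n : ℕ in atTop, ∀ k,
      |jointInput LX x LY y n ω k| ≤ (n : ℝ) ^ (1 / 16 : ℝ) := by
  obtain ⟨CX, hCX⟩ := hx.moments 64
  obtain ⟨CY, hCY⟩ := hy.moments 64
  set C := max (max CX CY) 0
  have hk : ∀ n (k : LX.values n ⊕ LY.values n), Integrable (fun ω => |jointInput LX x LY y n ω k| ^ 64) P ∧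
      ∫ ω, |jointInput LX x LY y n ω k| ^ 64 ∂P ≤ C := by
    rintro n (a | b)
    · exact ⟨(hCX a).1, (hCX a).2.trans ((le_max_left _ _).trans (le_max_left _ _))⟩
    · exact ⟨(hCY b).1, (hCY b).2.trans ((le_max_right _ _).trans (le_max_left _ _))⟩
  have hC0 : 0 ≤ C := le_max_right _ _
  have hae := ae_tendsto_zero_of_summable_integral (P := P)
    (F := fun n ω => (∑ k, |jointInput LX x LY y n ω k| ^ 64) / (n : ℝ) ^ 4)
    (fun n => (integrable_finsetSum _ fun k _ => (hk n k).1).div_const _)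
    (fun n ω => by positivity) (by
      refine Summable.of_nonneg_of_le (fun n => integral_nonneg fun ω => by positivity) (fun n => ?_)
        ((Real.summable_nat_pow_inv.2 one_lt_two).mul_left (2 * C))
      rw [integral_div, integral_finsetSum _ fun k _ => (hk n k).1]
      rcases n.eq_zero_or_pos with rfl | hn
      · simp
      have hn0 : (0 : ℝ) < n := Nat.cast_pos.2 hn
      rw [div_le_iff₀ (by positivity)]
      calc ∑ k, ∫ ω, |jointInput LX x LY y n ω k| ^ 64 ∂P
          ≤ ∑ _k : LX.values n ⊕ LY.values n, C := Finset.sum_le_sum fun k _ => (hk n k).2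
        _ = (Fintype.card (LX.values n) + Fintype.card (LY.values n)) * C := by simp
        _ ≤ (n ^ 2 + n ^ 2) * C := by
            gcongr
            · exact_mod_cast LX.card_values_le n
            · exact_mod_cast LY.card_values_le n
        _ = 2 * C * ((n : ℝ) ^ 2)⁻¹ * n ^ 4 := by field_simp; ring)
  filter_upwards [hae] with ω hω
  filter_upwards [hω.eventually_lt_const one_pos, eventually_gt_atTop 0] with n hn hn0 k
  have hn0' : (0 : ℝ) < n := Nat.cast_pos.2 hn0
  rw [div_lt_one (by positivity)] at hn
  have h1 : |jointInput LX x LY y n ω k| ^ 64 ≤ (n : ℝ) ^ 4 :=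
    (Finset.single_le_sum (f := fun k => |jointInput LX x LY y n ω k| ^ 64)
      (fun k _ => by positivity) (Finset.mem_univ k)).trans hn.le
  refine le_of_pow_le_pow_left₀ (n := 64) (by norm_num) (by positivity) (h1.trans_eq ?_)
  rw [← Real.rpow_natCast, ← Real.rpow_natCast, ← Real.rpow_mul hn0'.le]
  norm_num

/-- Clipping at `R = n^(1/16)` eventually changes nothing, and for clipped inputs the fourth central
moment is of order `R⁸ / n² = n^(-3/2)`. The centering `c n` is the mean of the clipped functional;
its convergence is not needed here. -/
lemma exists_ae_tendsto_eigenPosPart_sub [IsProbabilityMeasure P] (hX : LX.Symm) (hY : LY.Symm)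
    (hXB : LX.PropertyB) (hYB : LY.PropertyB) (hx : MomentInput x P) (hy : MomentInput y P)
    (hxy : IndepPatterned LX x LY y P) (t : ℝ) : ∃ c : ℕ → ℝ, ∀ᵐ ω ∂P,
      Tendsto (fun n => eigenPosPart (isHermitian_scaledHadamard (x := x) (y := y) hX hY n ω) t - c n)
        atTop (𝓝 0) := by
  obtain ⟨ΔX, hΔX⟩ := hXB
  obtain ⟨ΔY, hΔY⟩ := hYB
  set Δ := max ΔX ΔY
  set R : ℕ → ℝ := fun n => (n : ℝ) ^ (1 / 16 : ℝ)
  have hR : ∀ n, 0 ≤ R n := fun n => by positivity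
  have hsX : ∀ n i j, LX.toValues n i j = LX.toValues n j i := fun n i j => Subtype.ext (hX n i j)
  have hsY : ∀ n i j, LY.toValues n i j = LY.toValues n j i := fun n i j => Subtype.ext (hY n i j)
  set G : (n : ℕ) → (LX.values n ⊕ LY.values n → ℝ) → ℝ := fun n z =>
    eigenPosPart (isHermitian_clippedMatrix (hsX n) (hsY n) (R n) z) t
  set c : ℕ → ℝ := fun n => ∫ z, G n z ∂(Measure.pi fun k => P.map fun ω => jointInput LX x LY y n ω k)
  have hGm : ∀ n, Measurable (G n) := fun n =>
    measurable_eigenPosPart _ (measurable_clippedMatrix (R n)) t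
  have hJm := measurable_jointInput (LX := LX) (LY := LY) hx.measurable hy.measurable
  have hprob : ∀ n k, IsProbabilityMeasure (P.map fun ω => jointInput LX x LY y n ω k) := fun n k =>
    Measure.isProbabilityMeasure_map ((measurable_pi_apply k).comp (hJm n)).aemeasurable
  have hi : ∀ n, Integrable (fun ω => (G n (jointInput LX x LY y n ω) - c n) ^ 4) P := by
    intro n
    have hm : Measurable fun ω => (G n (jointInput LX x LY y n ω) - c n) ^ 4 :=
      (((hGm n).comp (hJm n)).sub_const _).pow_const 4
    rcases n.eq_zero_or_pos with rfl | hn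
    · have : ∀ z, G 0 z = 0 := fun z => by simp [G, eigenPosPart]
      simp [this]
    refine Integrable.of_bound hm.aestronglyMeasurable ((1 + |t| + R n ^ 4 + |c n|) ^ 4)
      (Eventually.of_forall fun ω => ?_)
    rw [norm_pow, Real.norm_eq_abs]
    refine pow_le_pow_left₀ (abs_nonneg _) ((abs_sub _ _).trans ?_) 4
    gcongr
    exact abs_eigenPosPart_le (hsX n) (hsY n) hn.ne' (hR n) t _
  have hae := ae_tendsto_zero_of_summable_integral hi (fun n ω => by positivity) (by
    refine Summable.of_nonneg_of_le (fun n => integral_nonneg fun ω => by positivity) (fun n => ?_)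
      -- The constant is `704 = 11 · 8²`.
      ((Real.summable_nat_rpow (p := -(3 / 2 : ℝ)).2 (by norm_num)).mul_left (704 * (Δ : ℝ) ^ 2))
    rcases n.eq_zero_or_pos with rfl | hn
    · have : ∀ z, G 0 z = 0 := fun z => by simp [G, eigenPosPart]
      simp [this, c]
    have hn0 : (0 : ℝ) < n := Nat.cast_pos.2 hn
    have h1 : ∫ ω, (G n (jointInput LX x LY y n ω) - c n) ^ 4 ∂P =
        ∫ z, (G n z - c n) ^ 4 ∂(Measure.pi fun k => P.map fun ω => jointInput LX x LY y n ω k) := by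
      rw [← hxy.map_jointInput hx.measurable hy.measurable hx.indep hy.indep,
        integral_map (hJm n).aemeasurable]
      exact (((hGm n).sub_const _).pow_const 4).aestronglyMeasurable
    rw [h1]
    refine (integral_eigenPosPart_sub_pow_four_le (hsX n) (hsY n) (Δ := Δ) (fun i a => ?_)
      (fun i b => ?_) hn.ne' (hR n) t _).trans_eq ?_
    · refine le_trans ?_ ((hΔX n a i).trans (le_max_left _ _))
      simp only [Link.toValues, Subtype.ext_iff, le_refl]
    · refine le_trans ?_ ((hΔY n b i).trans (le_max_right _ _))
      simp only [Link.toValues, Subtype.ext_iff, le_refl]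
    · have h8 : R n ^ 8 = (n : ℝ) ^ (1 / 2 : ℝ) := by
        rw [← Real.rpow_natCast, ← Real.rpow_mul hn0.le]; norm_num
      have h9 : (n : ℝ) ^ (-(3 / 2) : ℝ) = (n : ℝ) ^ (1 / 2 : ℝ) / n ^ 2 := by
        rw [← Real.rpow_natCast, ← Real.rpow_sub hn0]; norm_num
      rw [h9, ← h8]
      field_simp
      ring)
  refine ⟨c, ?_⟩
  filter_upwards [hae, ae_eventually_abs_jointInput_le (LX := LX) (LY := LY) hx hy] with ω h1 h2
  have h3 : Tendsto (fun n => G n (jointInput LX x LY y n ω) - c n) atTop (𝓝 0) := by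
    rw [tendsto_zero_iff_abs_tendsto_zero]
    have h4 := (Real.continuous_sqrt.tendsto _).comp ((Real.continuous_sqrt.tendsto _).comp h1)
    simp only [Real.sqrt_zero] at h4
    refine h4.congr fun n => ?_
    simp only [Function.comp_apply]
    rw [show (G n (jointInput LX x LY y n ω) - c n) ^ 4 =
      ((G n (jointInput LX x LY y n ω) - c n) ^ 2) ^ 2 by ring, Real.sqrt_sq (sq_nonneg _),
      Real.sqrt_sq_eq_abs]
  refine h3.congr' ?_
  filter_upwards [h2] with n hn
  rw [sub_left_inj]
  exact eigenPosPart_congr _ _ (clippedMatrix_jointInput hn) t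

end Concentration

/-! ### Ramps and convergence of distribution functions -/

/-- The function that vanishes below `s`, has slope one on `[s, s + δ]`, and is constant afterwards. -/
noncomputable def ramp (s δ r : ℝ) : ℝ := min (max (r - s) 0) δ

lemma ramp_eq_sub {s δ : ℝ} (hδ : 0 ≤ δ) (r : ℝ) :
    ramp s δ r = max (r - s) 0 - max (r - (s + δ)) 0 := by
  unfold ramp
  rcases le_total r s with h1 | h1
  · rw [max_eq_right (by linarith), max_eq_right (by linarith), min_eq_left hδ, sub_zero]
  · rw [max_eq_left (by linarith)]
    rcases le_total r (s + δ) with h2 | h2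
    · rw [max_eq_right (by linarith), min_eq_left (by linarith), sub_zero]
    · rw [max_eq_left (by linarith), min_eq_right (by linarith)]; ring

lemma ramp_nonneg {s δ : ℝ} (hδ : 0 ≤ δ) (r : ℝ) : 0 ≤ ramp s δ r := le_min (le_max_right _ _) hδ

lemma ramp_le (s δ r : ℝ) : ramp s δ r ≤ δ := min_le_right _ _

lemma continuous_ramp (s δ : ℝ) : Continuous (ramp s δ) := by unfold ramp; fun_prop

lemma ramp_of_le {s δ r : ℝ} (hδ : 0 ≤ δ) (h : r ≤ s) : ramp s δ r = 0 := by
  rw [ramp, max_eq_right (by linarith), min_eq_left hδ]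

lemma ramp_of_ge {s δ r : ℝ} (hδ : 0 ≤ δ) (h : s + δ ≤ r) : ramp s δ r = δ := by
  rw [ramp, max_eq_left (by linarith), min_eq_right (by linarith)]

section CDF

variable {μ : Measure ℝ} [IsProbabilityMeasure μ]

lemma integrable_ramp {s δ : ℝ} (hδ : 0 ≤ δ) : Integrable (ramp s δ) μ :=
  Integrable.of_bound (continuous_ramp s δ).aestronglyMeasurable δ (Eventually.of_forall fun r => by
    rw [Real.norm_of_nonneg (ramp_nonneg hδ r)]; exact ramp_le s δ r)

lemma integral_ramp_le {s δ : ℝ} (hδ : 0 ≤ δ) : ∫ r, ramp s δ r ∂μ ≤ δ * (1 - cdf μ s) := by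
  have h1 : 1 - cdf μ s = μ.real (Set.Ioi s) := by
    rw [cdf_eq_real, ← Set.compl_Iic, probReal_compl_eq_one_sub measurableSet_Iic]
  rw [h1, mul_comm, ← smul_eq_mul, ← integral_indicator_const δ measurableSet_Ioi]
  refine integral_mono (integrable_ramp hδ)
    ((integrable_const δ).indicator measurableSet_Ioi) fun r => ?_
  by_cases hr : r ∈ Set.Ioi s
  · rw [Set.indicator_of_mem hr]; exact ramp_le s δ r
  · rw [Set.indicator_of_notMem hr, ramp_of_le hδ (not_lt.1 hr)]

lemma le_integral_ramp {s δ : ℝ} (hδ : 0 ≤ δ) : δ * (1 - cdf μ (s + δ)) ≤ ∫ r, ramp s δ r ∂μ := by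
  have h1 : 1 - cdf μ (s + δ) = μ.real (Set.Ioi (s + δ)) := by
    rw [cdf_eq_real, ← Set.compl_Iic, probReal_compl_eq_one_sub measurableSet_Iic]
  rw [h1, mul_comm, ← smul_eq_mul, ← integral_indicator_const δ measurableSet_Ioi]
  refine integral_mono ((integrable_const δ).indicator measurableSet_Ioi) (integrable_ramp hδ)
    fun r => ?_
  by_cases hr : r ∈ Set.Ioi (s + δ)
  · rw [Set.indicator_of_mem hr, ramp_of_ge hδ (le_of_lt hr)]
  · rw [Set.indicator_of_notMem hr]; exact ramp_nonneg hδ r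

lemma sum_ramp_le {n : ℕ} (hn : n ≠ 0) {A : Matrix (Fin n) (Fin n) ℝ} (hA : A.IsHermitian) {s δ : ℝ}
    (hδ : 0 ≤ δ) : (∑ i, ramp s δ (hA.eigenvalues i)) / n ≤ δ * (1 - esdCDF A s) := by
  have hn0 : (0 : ℝ) < n := Nat.cast_pos.2 (Nat.pos_of_ne_zero hn)
  rw [hA.esdCDF_eq hn, sub_sub_cancel, mul_div_assoc']
  gcongr
  rw [mul_comm, ← nsmul_eq_mul, ← Finset.sum_const, Finset.sum_filter]
  refine Finset.sum_le_sum fun i _ => ?_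
  split_ifs with h
  · exact ramp_le s δ _
  · rw [ramp_of_le hδ (not_lt.1 h)]

lemma le_sum_ramp {n : ℕ} (hn : n ≠ 0) {A : Matrix (Fin n) (Fin n) ℝ} (hA : A.IsHermitian) {s δ : ℝ}
    (hδ : 0 ≤ δ) : δ * (1 - esdCDF A (s + δ)) ≤ (∑ i, ramp s δ (hA.eigenvalues i)) / n := by
  have hn0 : (0 : ℝ) < n := Nat.cast_pos.2 (Nat.pos_of_ne_zero hn)
  rw [hA.esdCDF_eq hn, sub_sub_cancel, mul_div_assoc']
  gcongr
  rw [mul_comm, ← nsmul_eq_mul, ← Finset.sum_const, Finset.sum_filter]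
  refine Finset.sum_le_sum fun i _ => ?_
  split_ifs with h
  · rw [ramp_of_ge hδ h.le]
  · exact ramp_nonneg hδ _

/-- Divided by `δ`, the ramp on `[s, s + δ]` lies between the indicators of `(s + δ, ∞)` and `(s,
∞)`. A ramp just left of `t` gives the lower bound, one just right of `t` the upper bound. Rational
`s` and `δ` are enough, so that countably many almost sure statements can be intersected. -/
lemma tendsto_esdCDF_of_tendsto_ramp {A : (n : ℕ) → Matrix (Fin n) (Fin n) ℝ}
    (hA : ∀ n, (A n).IsHermitian)
    (h : ∀ s δ : ℚ, 0 < δ → Tendsto (fun n => (∑ i, ramp s δ ((hA n).eigenvalues i)) / n) atTop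
      (𝓝 (∫ r, ramp s δ r ∂μ))) {t : ℝ} (ht : ContinuousAt (cdf μ) t) :
    Tendsto (fun n => esdCDF (A n) t) atTop (𝓝 (cdf μ t)) := by
  have hmono : ∀ n ≠ 0, Monotone fun t => esdCDF (A n) t := by
    intro n hn a b hab
    simp only [(hA n).esdCDF_eq hn]
    gcongr
  refine tendsto_order.2 ⟨fun a ha => ?_, fun a ha => ?_⟩
  · obtain ⟨ε, hε, hball⟩ := Metric.eventually_nhds_iff.1 (ht.eventually_const_lt ha)
    obtain ⟨s, hs1, hs2⟩ := exists_rat_btwn (show t - ε < t by linarith)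
    obtain ⟨q, hq1, hq2⟩ := exists_rat_btwn hs2
    have hδ : (0 : ℚ) < q - s := by
      have : (s : ℝ) < q := hq1
      exact sub_pos.2 (by exact_mod_cast this)
    have hδ' : (0 : ℝ) < ((q - s : ℚ) : ℝ) := by exact_mod_cast hδ
    have has : a < cdf μ s := hball (by rw [Real.dist_eq, abs_lt]; constructor <;> linarith)
    have h1 := integral_ramp_le (μ := μ) (s := s) hδ'.le
    have h2 : ∫ r, ramp s (q - s : ℚ) r ∂μ < ((q - s : ℚ) : ℝ) * (1 - a) :=
      h1.trans_lt (mul_lt_mul_of_pos_left (by linarith) hδ')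
    filter_upwards [(h s (q - s) hδ).eventually_lt_const h2, eventually_ne_atTop 0] with n hn hn0
    have h3 := (le_sum_ramp hn0 (hA n) hδ'.le).trans_lt hn
    have h4 := lt_of_mul_lt_mul_left h3 hδ'.le
    have h5 : (s : ℝ) + ((q - s : ℚ) : ℝ) = q := by push_cast; ring
    rw [h5] at h4
    have := hmono n hn0 hq2.le
    simp only at this
    linarith
  · obtain ⟨ε, hε, hball⟩ := Metric.eventually_nhds_iff.1 (ht.eventually_lt_const ha)
    obtain ⟨q, hq1, hq2⟩ := exists_rat_btwn (show t < t + ε by linarith)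
    obtain ⟨s, hs1, hs2⟩ := exists_rat_btwn hq1
    have hδ : (0 : ℚ) < q - s := by
      have : (s : ℝ) < q := hs2
      exact sub_pos.2 (by exact_mod_cast this)
    have hδ' : (0 : ℝ) < ((q - s : ℚ) : ℝ) := by exact_mod_cast hδ
    have has : cdf μ q < a := hball (by rw [Real.dist_eq, abs_lt]; constructor <;> linarith)
    have h5 : (s : ℝ) + ((q - s : ℚ) : ℝ) = q := by push_cast; ring
    have h1 := le_integral_ramp (μ := μ) (s := s) hδ'.le
    rw [h5] at h1
    have h2 : ((q - s : ℚ) : ℝ) * (1 - a) < ∫ r, ramp s (q - s : ℚ) r ∂μ :=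
      (mul_lt_mul_of_pos_left (by linarith) hδ').trans_le h1
    filter_upwards [(h s (q - s) hδ).eventually_const_lt h2, eventually_ne_atTop 0] with n hn hn0
    have h3 := hn.trans_le (sum_ramp_le hn0 (hA n) hδ'.le)
    have h4 := lt_of_mul_lt_mul_left h3 hδ'.le
    have := hmono n hn0 hs1.le
    simp only at this
    linarith

end CDF

/-! ### Almost sure limits for inputs with all moments -/

section LSD

variable {ιX ιY Ω : Type*} {LX : Link ιX} {LY : Link ιY} {x : ιX → Ω → ℝ} {y : ιY → Ω → ℝ}
  [MeasurableSpace Ω] {P : Measure Ω} [IsProbabilityMeasure P]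

/-- A ramp is a difference of two positive parts, so its spectral average concentrates around `c₁ n
- c₂ n`. Dominated convergence allows this centering to be replaced by the expectation, which
converges because the ramp is bounded and continuous. -/
lemma ae_tendsto_sum_ramp (hX : LX.Symm) (hY : LY.Symm)
    (hXB : LX.PropertyB) (hYB : LY.PropertyB) (hx : MomentInput x P) (hy : MomentInput y P)
    (hxy : IndepPatterned LX x LY y P) {μ : ProbabilityMeasure ℝ}
    (hμ : Tendsto (expectedESDSeq hX hY hx.measurable hy.measurable P) atTop (𝓝 μ)) {s δ : ℝ}
    (hδ : 0 ≤ δ) : ∀ᵐ ω ∂P, Tendsto (fun n => (∑ i, ramp s δ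
      ((isHermitian_scaledHadamard (x := x) (y := y) hX hY n ω).eigenvalues i)) / n) atTop
        (𝓝 (∫ r, ramp s δ r ∂(μ : Measure ℝ))) := by
  obtain ⟨c₁, hc₁⟩ := exists_ae_tendsto_eigenPosPart_sub hX hY hXB hYB hx hy hxy s
  obtain ⟨c₂, hc₂⟩ := exists_ae_tendsto_eigenPosPart_sub hX hY hXB hYB hx hy hxy (s + δ)
  set T : ℕ → Ω → ℝ := fun n ω => (∑ i, ramp s δ
      ((isHermitian_scaledHadamard (x := x) (y := y) hX hY n ω).eigenvalues i)) / n
  have hTeq : ∀ n ω, T n ω =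
      eigenPosPart (isHermitian_scaledHadamard (x := x) (y := y) hX hY n ω) s -
      eigenPosPart (isHermitian_scaledHadamard (x := x) (y := y) hX hY n ω) (s + δ) := by
    intro n ω
    simp only [T, eigenPosPart, ramp_eq_sub hδ, Finset.sum_sub_distrib, sub_div]
  have hTm : ∀ n, Measurable (T n) := by
    intro n
    have hm := measurable_scaledHadamard (LX := LX) (LY := LY) hx.measurable hy.measurable n
    simp only [funext (hTeq n)]
    exact (measurable_eigenPosPart _ hm s).sub (measurable_eigenPosPart _ hm _)
  have hT0 : ∀ n ω, |T n ω| ≤ δ := by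
    intro n ω
    rw [abs_of_nonneg (div_nonneg (Finset.sum_nonneg fun i _ => ramp_nonneg hδ _) n.cast_nonneg)]
    refine div_le_of_le_mul₀ n.cast_nonneg hδ ?_
    refine (Finset.sum_le_sum fun i _ => ramp_le s δ _).trans_eq ?_
    simp [mul_comm]
  have hTd : ∀ᵐ ω ∂P, Tendsto (fun n => T n ω - (c₁ n - c₂ n)) atTop (𝓝 0) := by
    filter_upwards [hc₁, hc₂] with ω h1 h2
    have := h1.sub h2
    rw [sub_zero] at this
    refine this.congr fun n => ?_
    rw [hTeq]; ring
  -- The centering is deterministic, so a single good `ω₀` shows that it is bounded.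
  obtain ⟨ω₀, hω₀⟩ := hTd.exists
  obtain ⟨B, hB⟩ := (Metric.isBounded_range_of_tendsto _ hω₀).exists_norm_le
  have hd : ∀ n, |c₁ n - c₂ n| ≤ δ + B := by
    intro n
    have h1 := hB _ (Set.mem_range_self n)
    have h2 := hT0 n ω₀
    have h3 := abs_sub (T n ω₀) (T n ω₀ - (c₁ n - c₂ n))
    rw [sub_sub_cancel] at h3
    rw [Real.norm_eq_abs] at h1
    linarith
  have hint : Tendsto (fun n => ∫ ω, (T n ω - (c₁ n - c₂ n)) ∂P) atTop (𝓝 0) := by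
    have := tendsto_integral_of_dominated_convergence (μ := P) (F := fun n ω => T n ω - (c₁ n - c₂ n))
      (f := fun _ => 0) (fun _ => δ + (δ + B))
      (fun n => ((hTm n).sub_const _).aestronglyMeasurable) (integrable_const _)
      (fun n => Eventually.of_forall fun ω => (abs_sub _ _).trans (add_le_add (hT0 n ω) (hd n))) hTd
    simpa using this
  have hTi : ∀ n, Integrable (T n) P := fun n =>
    Integrable.of_bound (hTm n).aestronglyMeasurable δ (Eventually.of_forall (hT0 n))
  have hlim : Tendsto (fun n => ∫ ω, T n ω ∂P) atTop (𝓝 (∫ r, ramp s δ r ∂(μ : Measure ℝ))) := by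
    rw [← tendsto_add_atTop_iff_nat 1]
    have h1 := ProbabilityMeasure.tendsto_iff_forall_integral_tendsto.1 hμ
      (BoundedContinuousFunction.ofNormedAddCommGroup (ramp s δ) (continuous_ramp s δ) δ fun r => by
        rw [Real.norm_of_nonneg (ramp_nonneg hδ r)]; exact ramp_le s δ r)
    refine h1.congr fun n => ?_
    have hm := measurable_scaledHadamard (LX := LX) (LY := LY) hx.measurable hy.measurable (n + 1)
    have h2 := integral_expectedESD (P := P)
      (isHermitian_scaledHadamard (x := x) (y := y) hX hY (n + 1)) hm
      (f := ramp s δ) (continuous_ramp s δ).measurable fun i =>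
        Integrable.of_bound ((continuous_ramp s δ).measurable.comp
          (Matrix.IsHermitian.measurable_eigenvalues _ hm i)).aestronglyMeasurable δ
          (Eventually.of_forall fun ω => by
            rw [Real.norm_of_nonneg (ramp_nonneg hδ _)]; exact ramp_le s δ _)
    refine Eq.trans h2 ?_
    rw [integral_div]
  filter_upwards [hTd] with ω hω
  have := (hω.sub hint).add hlim
  rw [sub_zero, zero_add] at this
  refine this.congr fun n => ?_
  rw [integral_sub (hTi n) (integrable_const _), integral_const, probReal_univ, one_smul]
  ring

theorem hasLSDAlmostSurely_of_momentInput (hX : LX.Symm) (hY : LY.Symm)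
    (hXB : LX.PropertyB) (hYB : LY.PropertyB) (hx : MomentInput x P) (hy : MomentInput y P)
    (hxy : IndepPatterned LX x LY y P) {μ : ProbabilityMeasure ℝ}
    (hμ : Tendsto (expectedESDSeq hX hY hx.measurable hy.measurable P) atTop (𝓝 μ)) :
    HasLSDAlmostSurely (scaledHadamard LX x LY y) (μ : Measure ℝ) P := by
  have h : ∀ᵐ ω ∂P, ∀ s δ : ℚ, 0 < δ → Tendsto (fun n => (∑ i, ramp s δ
      ((isHermitian_scaledHadamard (x := x) (y := y) hX hY n ω).eigenvalues i)) / n) atTop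
        (𝓝 (∫ r, ramp s δ r ∂(μ : Measure ℝ))) := by
    refine ae_all_iff.2 fun s => ae_all_iff.2 fun δ => ?_
    by_cases hδ : 0 < δ
    · filter_upwards [ae_tendsto_sum_ramp hX hY hXB hYB hx hy hxy hμ (s := s)
        (δ := δ) (by exact_mod_cast hδ.le)] with ω hω _
      exact hω
    · exact Eventually.of_forall fun ω h => absurd h hδ
  filter_upwards [h] with ω hω t ht
  exact tendsto_esdCDF_of_tendsto_ramp _ hω ht

lemma measurable_esdCDF {n : ℕ} {A : Ω → Matrix (Fin n) (Fin n) ℝ} (hA : ∀ ω, (A ω).IsHermitian)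
    (hm : ∀ i j, Measurable fun ω => A ω i j) (t : ℝ) : Measurable fun ω => esdCDF (A ω) t := by
  rcases n.eq_zero_or_pos with rfl | hn
  · have : (fun ω => esdCDF (A ω) t) = fun _ => 0 := by
      ext ω; simp [esdCDF]
    rw [this]; exact measurable_const
  simp only [fun ω => (hA ω).esdCDF_eq hn.ne' t, Finset.card_filter, Nat.cast_sum]
  refine measurable_const.sub (Measurable.div_const (Finset.measurable_fun_sum _ fun i _ => ?_) _)
  exact Measurable.comp (g := fun m : ℕ => (m : ℝ)) measurable_from_nat (Measurable.ite
    (measurableSet_lt measurable_const (Matrix.IsHermitian.measurable_eigenvalues hA hm i))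
    measurable_const measurable_const)

lemma HasLSDAlmostSurely.inProbability {A : (n : ℕ) → Ω → Matrix (Fin n) (Fin n) ℝ}
    (hA : ∀ n ω, (A n ω).IsHermitian) (hm : ∀ n i j, Measurable fun ω => A n ω i j) {μ : Measure ℝ}
    (h : HasLSDAlmostSurely A μ P) : HasLSDInProbability A μ P := fun t ht =>
  tendstoInMeasure_of_tendsto_ae (fun n => (measurable_esdCDF (hA n) (hm n) t).aestronglyMeasurable)
    (h.mono fun _ hω => hω t ht)

end LSD

/-! ### Bounded standardized approximations of square integrable inputs -/

section Truncation

variable {Ω : Type*} [MeasurableSpace Ω] {P : Measure Ω} [IsProbabilityMeasure P]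

/-- A standardized square integrable variable is approximated in `L²` by bounded standardized functions
of itself. -/
lemma exists_bounded_standardized {X : Ω → ℝ} (hX : Measurable X) (h2 : MemLp X 2 P)
    (hmean : ∫ ω, X ω ∂P = 0) (hvar : variance X P = 1) {ε : ℝ} (hε : 0 < ε) :
    ∃ f : ℝ → ℝ, Measurable f ∧ (∃ C, ∀ r, |f r| ≤ C) ∧ ∫ ω, f (X ω) ∂P = 0 ∧
      variance (fun ω => f (X ω)) P = 1 ∧ ∫ ω, (X ω - f (X ω)) ^ 2 ∂P < ε := by
  have hsq : ∫ ω, X ω ^ 2 ∂P = 1 := by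
    have := variance_eq_integral hX.aemeasurable (μ := P)
    rw [hvar, hmean] at this
    simpa using this.symm
  have hi1 : Integrable X P := h2.integrable (by norm_num)
  have hi2 : Integrable (fun ω => X ω ^ 2) P := h2.integrable_sq
  have hcm : ∀ n : ℕ, Measurable fun ω => clip n (X ω) := fun n => (measurable_clip n).comp hX
  have hcb : ∀ (n : ℕ) r, |clip n r| ≤ n := fun n r => abs_clip_le n.cast_nonneg r
  have hcle : ∀ (n : ℕ) r, |clip n r| ≤ |r| := by
    intro n r
    rcases le_total |r| n with h | h
    · rw [clip_of_abs_le h]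
    · exact (hcb n r).trans h
  have hev : ∀ r, ∀ᶠ n : ℕ in atTop, clip n r = r := fun r =>
    (eventually_ge_atTop ⌈|r|⌉₊).mono fun n hn => clip_of_abs_le (Nat.ceil_le.1 hn)
  set m : ℕ → ℝ := fun n => ∫ ω, clip n (X ω) ∂P
  have hm : Tendsto m atTop (𝓝 0) := by
    rw [← hmean]
    refine tendsto_integral_of_dominated_convergence (fun ω => |X ω|)
      (fun n => (hcm n).aestronglyMeasurable) hi1.abs
      (fun n => Eventually.of_forall fun ω => hcle n _) (Eventually.of_forall fun ω => ?_)
    exact tendsto_const_nhds.congr' ((hev (X ω)).mono fun n hn => hn.symm)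
  have hq : Tendsto (fun n : ℕ => ∫ ω, clip n (X ω) ^ 2 ∂P) atTop (𝓝 1) := by
    rw [← hsq]
    refine tendsto_integral_of_dominated_convergence (fun ω => X ω ^ 2)
      (fun n => ((hcm n).pow_const 2).aestronglyMeasurable) hi2
      (fun n => Eventually.of_forall fun ω => ?_) (Eventually.of_forall fun ω => ?_)
    · rw [Real.norm_of_nonneg (sq_nonneg _)]
      exact sq_le_sq.2 (hcle n _)
    · exact tendsto_const_nhds.congr' ((hev (X ω)).mono fun n hn => by simp only [hn])
  set v : ℕ → ℝ := fun n => variance (fun ω => clip n (X ω)) P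
  have hv : Tendsto v atTop (𝓝 1) := by
    have h3 := hq.sub (hm.pow 2)
    norm_num at h3
    refine h3.congr fun n => ?_
    have hLp : MemLp (fun ω => clip n (X ω)) 2 P :=
      MemLp.of_bound (hcm n).aestronglyMeasurable n (Eventually.of_forall fun ω => hcb n _)
    exact (variance_eq_sub hLp).symm
  set s : ℕ → ℝ := fun n => Real.sqrt (v n)
  have hs : Tendsto s atTop (𝓝 1) := by
    have := (Real.continuous_sqrt.tendsto 1).comp hv
    rwa [Real.sqrt_one] at this
  have hs1 : ∀ᶠ n in atTop, 1 / 2 < s n := hs.eventually_const_lt (by norm_num)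
  have hm1 : ∀ᶠ n in atTop, |m n| < 1 := by
    have := hm.abs
    rw [abs_zero] at this
    exact this.eventually_lt_const one_pos
  have hlim : Tendsto (fun n : ℕ => ∫ ω, (X ω - (clip n (X ω) - m n) / s n) ^ 2 ∂P) atTop (𝓝 0) := by
    have : (0 : ℝ) = ∫ _ω : Ω, (0 : ℝ) ∂P := by simp
    rw [this]
    -- Once `s n > 1/2` and `|m n| < 1`, the difference is at most `3|X| + 2`, whose square is at
    -- most `18 X² + 8`.
    refine tendsto_integral_filter_of_dominated_convergence (fun ω => 18 * X ω ^ 2 + 8)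
      (Eventually.of_forall fun n =>
        ((hX.sub (((hcm n).sub_const _).div_const _)).pow_const 2).aestronglyMeasurable) ?_
      ((hi2.const_mul 18).add (integrable_const 8)) (Eventually.of_forall fun ω => ?_)
    · filter_upwards [hs1, hm1] with n hn1 hn2
      refine Eventually.of_forall fun ω => ?_
      rw [Real.norm_of_nonneg (sq_nonneg _)]
      have h3 : |(clip n (X ω) - m n) / s n| ≤ 2 * (|X ω| + 1) := by
        rw [abs_div, abs_of_pos (by linarith : 0 < s n), div_le_iff₀ (by linarith)]
        have h4 := abs_sub (clip n (X ω)) (m n)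
        have h5 := hcle n (X ω)
        nlinarith [abs_nonneg (X ω)]
      have h6 := abs_sub (X ω) ((clip n (X ω) - m n) / s n)
      have h7 : |X ω - (clip n (X ω) - m n) / s n| ≤ 3 * |X ω| + 2 := by linarith
      rw [← sq_abs (X ω - _), ← sq_abs (X ω)]
      nlinarith [abs_nonneg (X ω), abs_nonneg (X ω - (clip n (X ω) - m n) / s n),
        sq_nonneg (3 * |X ω| - 2)]
    · have h3 : Tendsto (fun n : ℕ => clip n (X ω)) atTop (𝓝 (X ω)) :=
        tendsto_const_nhds.congr' ((hev (X ω)).mono fun n hn => hn.symm)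
      have h4 := ((tendsto_const_nhds (x := X ω)).sub ((h3.sub hm).div hs one_ne_zero)).pow 2
      simpa using h4
  obtain ⟨n, hn1, hn2⟩ := (hs1.and (hlim.eventually_lt_const hε)).exists
  have hsn : s n ≠ 0 := by linarith
  have hci : Integrable (fun ω => clip n (X ω)) P :=
    Integrable.of_bound (hcm n).aestronglyMeasurable n (Eventually.of_forall fun ω => hcb n _)
  refine ⟨fun r => (clip n r - m n) / s n, ((measurable_clip n).sub_const _).div_const _,
    ⟨(n + |m n|) / |s n|, fun r => ?_⟩, ?_, ?_, hn2⟩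
  · rw [abs_div]
    gcongr
    exact (abs_sub _ _).trans (by linarith [hcb n r])
  · rw [integral_div, integral_sub hci (integrable_const _)]
    simp [m]
  · have h3 : (fun ω => (clip n (X ω) - m n) / s n) = fun ω => (s n)⁻¹ * (clip n (X ω) - m n) := by
      ext ω; ring
    rw [h3, variance_const_mul, variance_sub_const hci.aestronglyMeasurable]
    have h4 : s n ^ 2 = v n := Real.sq_sqrt (variance_nonneg _ _)
    rw [inv_pow, h4, inv_mul_cancel₀]
    rw [← h4]; positivity

variable {ι κ : Type*} {x : ι → Ω → ℝ} {y : κ → Ω → ℝ} {L : Link ι} {L' : Link κ}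

lemma IIDInput.exists_truncation (hx : IIDInput x P) {ε : ℝ} (hε : 0 < ε) :
    ∃ f : ℝ → ℝ, Measurable f ∧ BoundedInput (fun k ω => f (x k ω)) P ∧
      ∀ k, ∫ ω, (x k ω - f (x k ω)) ^ 2 ∂P ≤ ε := by
  -- The function `f` is built from the common law of the variables, which requires one variable to
  -- exist.
  rcases isEmpty_or_nonempty ι with hι | ⟨⟨k₀⟩⟩
  · exact ⟨id, measurable_id, ⟨fun k => hι.elim k, hx.indep, ⟨0, fun k => hι.elim k⟩,
      fun k => hι.elim k, fun k => hι.elim k⟩, fun k => hι.elim k⟩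
  obtain ⟨f, hf, ⟨C, hC⟩, hf0, hf1, hfε⟩ := exists_bounded_standardized (hx.measurable k₀) (hx.memLp k₀)
    (hx.mean k₀) (hx.variance k₀) hε
  have hid : ∀ k, IdentDistrib (fun ω => f (x k ω)) (fun ω => f (x k₀ ω)) P P := fun k =>
    (hx.identDistrib k k₀).comp hf
  refine ⟨f, hf, ⟨fun k => hf.comp (hx.measurable k), hx.indep.comp (fun _ => f) fun _ => hf,
    ⟨C, fun k => Eventually.of_forall fun ω => hC _⟩, fun k => ?_, fun k => ?_⟩, fun k => ?_⟩
  · rw [(hid k).integral_eq, hf0]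
  · rw [(hid k).variance_eq, hf1]
  · have := ((hx.identDistrib k k₀).comp (u := fun r => (r - f r) ^ 2) (by fun_prop)).integral_eq
    simp only [Function.comp_apply] at this
    exact this.trans_le hfε.le

omit [IsProbabilityMeasure P] in
lemma IndepPatterned.comp_left (h : IndepPatterned L x L' y P) {f : ℝ → ℝ} (hf : Measurable f) :
    IndepPatterned L (fun k ω => f (x k ω)) L' y P :=
  IndepFun.comp (φ := fun (a : (n : ℕ) → Fin n → Fin n → ℝ) n i j => f (a n i j)) (ψ := id) h
    (by fun_prop) measurable_id

omit [IsProbabilityMeasure P] in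
lemma IndepPatterned.symm (h : IndepPatterned L x L' y P) : IndepPatterned L' y L x P :=
  IndepFun.symm h

omit [MeasurableSpace Ω] in
lemma scaledHadamard_comm (L : Link ι) (x : ι → Ω → ℝ) (L' : Link κ) (y : κ → Ω → ℝ) :
    scaledHadamard L x L' y = scaledHadamard L' y L x := by
  ext n ω i j
  simp [scaledHadamard_eq, hadamardPatterned_apply, mul_comm]

end Truncation

/-! ### Stability of limits under spectrally close approximation -/

section Approximation

variable {Ω : Type*} [MeasurableSpace Ω] {P : Measure Ω} {μ : Measure ℝ}

/-- The distribution functions of the empirical spectral distributions of `A` and `B` are close up to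
shifts, with error controlled by `q`. -/
def SpectrallyClose {n : ℕ} (A B : Matrix (Fin n) (Fin n) ℝ) (q : ℝ) : Prop :=
  ∀ t δ : ℝ, 0 < δ → esdCDF A t ≤ esdCDF B (t + δ) + (1 + (δ ^ 2)⁻¹) * q ∧
    esdCDF B t ≤ esdCDF A (t + δ) + (1 + (δ ^ 2)⁻¹) * q

/-- A monotone function has countably many discontinuities, so small shifts `δ` that avoid them on
both sides of `t` are dense. -/
lemma exists_continuousAt_cdf_near {t : ℝ} (ht : ContinuousAt (cdf μ) t) {η : ℝ} (hη : 0 < η) :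
    ∃ δ > 0, ContinuousAt (cdf μ) (t + δ) ∧ ContinuousAt (cdf μ) (t - δ) ∧
      cdf μ (t + δ) < cdf μ t + η ∧ cdf μ t - η < cdf μ (t - δ) := by
  obtain ⟨ε, hε, hball⟩ := Metric.eventually_nhds_iff.1
    ((ht.eventually_lt_const (show cdf μ t < cdf μ t + η by linarith)).and
      (ht.eventually_const_lt (show cdf μ t - η < cdf μ t by linarith)))
  have hc := (monotone_cdf μ).countable_not_continuousAt
  have hc1 : {δ : ℝ | ¬ ContinuousAt (cdf μ) (t + δ)}.Countable :=
    hc.preimage (add_right_injective t)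
  have hc2 : {δ : ℝ | ¬ ContinuousAt (cdf μ) (t - δ)}.Countable :=
    hc.preimage sub_right_injective
  have hd := (hc1.union hc2).dense_compl ℝ
  obtain ⟨δ, hδ, hδ1, hδ2⟩ := hd.exists_between hε
  simp only [Set.mem_compl_iff, Set.mem_union, Set.mem_ofPred_eq, not_or, not_not] at hδ
  refine ⟨δ, hδ1, hδ.1, hδ.2, (hball ?_).1, (hball ?_).2⟩
  · rw [Real.dist_eq, add_sub_cancel_left, abs_of_pos hδ1]; exact hδ2
  · rw [Real.dist_eq, sub_sub_cancel_left, abs_neg, abs_of_pos hδ1]; exact hδ2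

lemma SpectrallyClose.abs_esdCDF_sub_lt {n : ℕ} {A B : Matrix (Fin n) (Fin n) ℝ} {q t δ η c c₁ c₂ : ℝ}
    (h : SpectrallyClose A B q) (hδ : 0 < δ) (h1 : c₁ < c + η) (h2 : c - η < c₂)
    (hB1 : |esdCDF B (t + δ) - c₁| < η) (hB2 : |esdCDF B (t - δ) - c₂| < η)
    (hq : (1 + (δ ^ 2)⁻¹) * q < η) : |esdCDF A t - c| < 3 * η := by
  have h3 := (h t δ hδ).1
  have h4 := (h (t - δ) δ hδ).2
  rw [sub_add_cancel] at h4
  rw [abs_lt] at *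
  constructor <;> linarith

/-- Only the errors `1 / (k + 1)` are used, so that one null set serves all approximations; the
shift `δ` is fixed before `k` is chosen. -/
lemma HasLSDAlmostSurely.of_approx {A : (n : ℕ) → Ω → Matrix (Fin n) (Fin n) ℝ}
    (h : ∀ ε > 0, ∃ (B : (n : ℕ) → Ω → Matrix (Fin n) (Fin n) ℝ) (Q : ℕ → Ω → ℝ),
      HasLSDAlmostSurely B μ P ∧ (∀ n ≠ 0, ∀ ω, SpectrallyClose (A n ω) (B n ω) (Q n ω)) ∧
      ∀ᵐ ω ∂P, ∀ᶠ n in atTop, Q n ω ≤ ε) : HasLSDAlmostSurely A μ P := by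
  have h' : ∀ᵐ ω ∂P, ∀ k : ℕ, ∃ (B : (n : ℕ) → Matrix (Fin n) (Fin n) ℝ) (Q : ℕ → ℝ),
      (∀ t, ContinuousAt (cdf μ) t → Tendsto (fun n => esdCDF (B n) t) atTop (𝓝 (cdf μ t))) ∧
      (∀ n ≠ 0, SpectrallyClose (A n ω) (B n) (Q n)) ∧ ∀ᶠ n in atTop, Q n ≤ 1 / ((k : ℝ) + 1) := by
    refine ae_all_iff.2 fun k => ?_
    obtain ⟨B, Q, hB, hAB, hQ⟩ := h (1 / ((k : ℝ) + 1)) (by positivity)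
    filter_upwards [hB, hQ] with ω h1 h2
    exact ⟨fun n => B n ω, fun n => Q n ω, h1, fun n hn => hAB n hn ω, h2⟩
  filter_upwards [h'] with ω hω t ht
  refine Metric.tendsto_nhds.2 fun η hη => ?_
  obtain ⟨δ, hδ, hδ1, hδ2, h1, h2⟩ := exists_continuousAt_cdf_near ht (η := η / 3) (by positivity)
  obtain ⟨k, hk⟩ := exists_nat_one_div_lt (show 0 < η / 3 / (1 + (δ ^ 2)⁻¹) by positivity)
  obtain ⟨B, Q, hB, hAB, hQ⟩ := hω k
  filter_upwards [Metric.tendsto_nhds.1 (hB _ hδ1) (η / 3) (by positivity),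
    Metric.tendsto_nhds.1 (hB _ hδ2) (η / 3) (by positivity), hQ, eventually_ne_atTop 0]
    with n h3 h4 h5 hn
  have h6 : (1 + (δ ^ 2)⁻¹) * Q n < η / 3 := by
    rw [← lt_div_iff₀' (by positivity)]
    exact h5.trans_lt hk
  have := (hAB n hn).abs_esdCDF_sub_lt hδ h1 h2 h3 h4 h6
  rw [Real.dist_eq]
  linarith

lemma HasLSDInProbability.of_approx [IsProbabilityMeasure P]
    {A : (n : ℕ) → Ω → Matrix (Fin n) (Fin n) ℝ}
    (h : ∀ ε > 0, ∃ (B : (n : ℕ) → Ω → Matrix (Fin n) (Fin n) ℝ) (Q : ℕ → Ω → ℝ),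
      HasLSDInProbability B μ P ∧ (∀ n ≠ 0, ∀ ω, SpectrallyClose (A n ω) (B n ω) (Q n ω)) ∧
      (∀ n ω, 0 ≤ Q n ω) ∧ ∀ n, Integrable (Q n) P ∧ ∫ ω, Q n ω ∂P ≤ ε) :
    HasLSDInProbability A μ P := by
  intro t ht
  rw [tendstoInMeasure_iff_measureReal_norm]
  intro η hη
  obtain ⟨δ, hδ, hδ1, hδ2, h1, h2⟩ := exists_continuousAt_cdf_near ht (η := η / 3) (by positivity)
  set K := 1 + (δ ^ 2)⁻¹
  have hK : 0 < K := by positivity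
  refine Metric.tendsto_nhds.2 fun ε hε => ?_
  -- By Markov's inequality this level leaves probability at most `ε / 3` to `Q ≥ η / (3K)`; the two
  -- shifted points take the other two thirds.
  obtain ⟨B, Q, hB, hAB, hQ0, hQ⟩ := h (ε / 3 * (η / 3 / K)) (by positivity)
  have hB1 := tendstoInMeasure_iff_measureReal_norm.1 (hB _ hδ1) (η / 3) (by positivity)
  have hB2 := tendstoInMeasure_iff_measureReal_norm.1 (hB _ hδ2) (η / 3) (by positivity)
  filter_upwards [hB1.eventually_lt_const (show 0 < ε / 3 by positivity),
    hB2.eventually_lt_const (show 0 < ε / 3 by positivity), eventually_ne_atTop 0] with n h3 h4 hn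
  have h5 : P.real {ω | η / 3 / K ≤ Q n ω} ≤ ε / 3 := by
    have := mul_meas_ge_le_integral_of_nonneg (Eventually.of_forall (hQ0 n)) (hQ n).1 (η / 3 / K)
    have h6 := this.trans (hQ n).2
    rw [mul_comm] at h6
    exact le_of_mul_le_mul_right h6 (by positivity)
  have hsub : {ω | η ≤ ‖esdCDF (A n ω) t - cdf μ t‖} ⊆
      ({ω | η / 3 ≤ ‖esdCDF (B n ω) (t + δ) - cdf μ (t + δ)‖} ∪
        {ω | η / 3 ≤ ‖esdCDF (B n ω) (t - δ) - cdf μ (t - δ)‖}) ∪ {ω | η / 3 / K ≤ Q n ω} := by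
    intro ω hω
    by_contra hcon
    simp only [Set.mem_union, Set.mem_ofPred_eq, not_or, not_le] at hcon
    obtain ⟨⟨h6, h7⟩, h8⟩ := hcon
    have := (hAB n hn ω).abs_esdCDF_sub_lt hδ h1 h2 h6 h7 ((lt_div_iff₀' hK).1 h8)
    have h9 : η ≤ |esdCDF (A n ω) t - cdf μ t| := hω
    linarith
  rw [Real.dist_eq, sub_zero, abs_of_nonneg measureReal_nonneg]
  refine (measureReal_mono hsub).trans_lt ?_
  refine (measureReal_union_le _ _).trans_lt ?_
  have := measureReal_union_le (μ := P) {ω | η / 3 ≤ ‖esdCDF (B n ω) (t + δ) - cdf μ (t + δ)‖}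
    {ω | η / 3 ≤ ‖esdCDF (B n ω) (t - δ) - cdf μ (t - δ)‖}
  linarith

end Approximation

/-! ### The error of replacing one input by a function of it -/

section TruncationError

variable {ιX ιY Ω : Type*} {LX : Link ιX} {LY : Link ιY} {x : ιX → Ω → ℝ} {y : ιY → Ω → ℝ} {f : ℝ → ℝ}

/-- The error at the entry `(i, j)` caused by replacing `x` by `f ∘ x`, truncated at the level `N`. -/
noncomputable def cellError (LX : Link ιX) (x : ιX → Ω → ℝ) (LY : Link ιY) (y : ιY → Ω → ℝ) (f : ℝ → ℝ)
    (N : ℝ) (n : ℕ) (i j : Fin n) (ω : Ω) : ℝ :=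
  min N (((x (LX n i j) ω - f (x (LX n i j) ω)) * y (LY n i j) ω) ^ 2)

/-- The average error caused by replacing `x` by `f ∘ x`, truncated at the level `n`. -/
noncomputable def truncError (LX : Link ιX) (x : ιX → Ω → ℝ) (LY : Link ιY) (y : ιY → Ω → ℝ) (f : ℝ → ℝ)
    (n : ℕ) (ω : Ω) : ℝ := (∑ i, ∑ j, cellError LX x LY y f n n i j ω) / (n : ℝ) ^ 2

lemma cellError_nonneg {N : ℝ} (hN : 0 ≤ N) (n : ℕ) (i j : Fin n) (ω : Ω) :
    0 ≤ cellError LX x LY y f N n i j ω := le_min hN (sq_nonneg _)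

lemma truncError_nonneg (n : ℕ) (ω : Ω) : 0 ≤ truncError LX x LY y f n ω :=
  div_nonneg (Finset.sum_nonneg fun i _ => Finset.sum_nonneg fun j _ =>
    cellError_nonneg n.cast_nonneg n i j ω) (by positivity)

lemma spectrallyClose_truncError (hX : LX.Symm) (hY : LY.Symm) {n : ℕ} (hn : n ≠ 0) (ω : Ω) :
    SpectrallyClose (scaledHadamard LX x LY y n ω) (scaledHadamard LX (fun k ω => f (x k ω)) LY y n ω)
      (truncError LX x LY y f n ω) := by
  intro t δ hδ
  have hA := isHermitian_hadamardPatterned (x := x) (y := y) hX hY n ω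
  have hB := isHermitian_hadamardPatterned (x := fun k ω => f (x k ω)) (y := y) hX hY n ω
  have h1 := Matrix.IsHermitian.esdCDF_le_of_sub hA hB hn t hδ
  have h2 := Matrix.IsHermitian.esdCDF_le_of_sub hB hA hn t hδ
  have e1 : ∀ i j, (hadamardPatterned LX x LY y n ω i j -
      hadamardPatterned LX (fun k ω => f (x k ω)) LY y n ω i j) ^ 2 =
      ((x (LX n i j) ω - f (x (LX n i j) ω)) * y (LY n i j) ω) ^ 2 := by
    intro i j; simp only [hadamardPatterned_apply]; ring
  have e2 : ∀ i j, (hadamardPatterned LX (fun k ω => f (x k ω)) LY y n ω i j -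
      hadamardPatterned LX x LY y n ω i j) ^ 2 =
      ((x (LX n i j) ω - f (x (LX n i j) ω)) * y (LY n i j) ω) ^ 2 := by
    intro i j; simp only [hadamardPatterned_apply]; ring
  simp only [e1] at h1
  simp only [e2] at h2
  exact ⟨h1, h2⟩

variable [MeasurableSpace Ω] {P : Measure Ω} [IsProbabilityMeasure P]

lemma measurable_cellError (hx : ∀ t, Measurable (x t)) (hy : ∀ t, Measurable (y t)) (hf : Measurable f)
    (N : ℝ) (n : ℕ) (i j : Fin n) : Measurable (cellError LX x LY y f N n i j) :=
  measurable_const.min ((((hx _).sub (hf.comp (hx _))).mul (hy _)).pow_const 2)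

lemma integrable_cellError_pow (hx : ∀ t, Measurable (x t)) (hy : ∀ t, Measurable (y t))
    (hf : Measurable f) {N : ℝ} (hN : 0 ≤ N) (n : ℕ) (i j : Fin n) (p : ℕ) :
    Integrable (fun ω => cellError LX x LY y f N n i j ω ^ p) P :=
  Integrable.of_bound ((measurable_cellError hx hy hf N n i j).pow_const p).aestronglyMeasurable (N ^ p)
    (Eventually.of_forall fun ω => by
      rw [norm_pow, Real.norm_of_nonneg (cellError_nonneg hN n i j ω)]
      exact pow_le_pow_left₀ (cellError_nonneg hN n i j ω) (min_le_left _ _) p)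

lemma integrable_cellError (hx : ∀ t, Measurable (x t)) (hy : ∀ t, Measurable (y t))
    (hf : Measurable f) {N : ℝ} (hN : 0 ≤ N) (n : ℕ) (i j : Fin n) :
    Integrable (cellError LX x LY y f N n i j) P := by
  simpa using integrable_cellError_pow (P := P) (LX := LX) (LY := LY) hx hy hf hN n i j 1

lemma iIndepFun_jointInput (hxy : IndepPatterned LX x LY y P)
    (hx : ∀ t, Measurable (x t)) (hy : ∀ t, Measurable (y t))
    (hxi : iIndepFun x P) (hyi : iIndepFun y P) (n : ℕ) :
    iIndepFun (fun k ω => jointInput LX x LY y n ω k) P :=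
  (iIndepFun_iff_map_fun_eq_pi_map fun k =>
    ((measurable_pi_apply k).comp (measurable_jointInput hx hy n)).aemeasurable).2
    (hxy.map_jointInput hx hy hxi hyi n)

omit [IsProbabilityMeasure P] in
lemma IndepPatterned.indepFun_apply (hxy : IndepPatterned LX x LY y P) {n : ℕ} (i j : Fin n) :
    IndepFun (x (LX n i j)) (y (LY n i j)) P :=
  IndepFun.comp (φ := fun a : (n : ℕ) → Fin n → Fin n → ℝ => a n i j)
    (ψ := fun a : (n : ℕ) → Fin n → Fin n → ℝ => a n i j) hxy (by fun_prop) (by fun_prop)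

/-- The variables `y` have second moment one. -/
def UnitSecondMoment (y : ιY → Ω → ℝ) (P : Measure Ω) : Prop :=
  ∀ t, Integrable (fun ω => y t ω ^ 2) P ∧ ∫ ω, y t ω ^ 2 ∂P = 1

omit [IsProbabilityMeasure P] in
lemma IIDInput.unitSecondMoment (hy : IIDInput y P) : UnitSecondMoment y P := by
  refine fun t => ⟨(hy.memLp t).integrable_sq, ?_⟩
  have := variance_eq_integral (hy.measurable t).aemeasurable (μ := P)
  rw [hy.variance, hy.mean] at this
  simpa using this.symm

lemma MomentInput.unitSecondMoment (hy : MomentInput y P) : UnitSecondMoment y P := by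
  refine fun t => ⟨?_, hy.integral_sq t⟩
  obtain ⟨C, hC⟩ := hy.moments 2
  simpa using (hC t).1

omit [IsProbabilityMeasure P] in
lemma integral_sq_mul_le (hxy : IndepPatterned LX x LY y P) (hf : Measurable f)
    (hy2 : UnitSecondMoment y P) (hfi : ∀ t, Integrable (fun ω => (x t ω - f (x t ω)) ^ 2) P) {ε : ℝ}
    (hfε : ∀ t, ∫ ω, (x t ω - f (x t ω)) ^ 2 ∂P ≤ ε) {n : ℕ} (i j : Fin n) :
    Integrable (fun ω => ((x (LX n i j) ω - f (x (LX n i j) ω)) * y (LY n i j) ω) ^ 2) P ∧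
    ∫ ω, ((x (LX n i j) ω - f (x (LX n i j) ω)) * y (LY n i j) ω) ^ 2 ∂P ≤ ε := by
  have hind : IndepFun (fun ω => (x (LX n i j) ω - f (x (LX n i j) ω)) ^ 2)
      (fun ω => y (LY n i j) ω ^ 2) P :=
    (hxy.indepFun_apply i j).comp (φ := fun r => (r - f r) ^ 2) (ψ := fun r => r ^ 2)
      (by fun_prop) (by fun_prop)
  simp only [mul_pow]
  refine ⟨hind.integrable_mul (hfi _) (hy2 _).1, ?_⟩
  rw [hind.integral_fun_mul_eq_mul_integral (hfi _).aestronglyMeasurable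
    (hy2 _).1.aestronglyMeasurable, (hy2 _).2, mul_one]
  exact hfε _

lemma integral_cellError_le (hx : ∀ t, Measurable (x t)) (hy : ∀ t, Measurable (y t))
    (hxy : IndepPatterned LX x LY y P) (hf : Measurable f)
    (hy2 : UnitSecondMoment y P) (hfi : ∀ t, Integrable (fun ω => (x t ω - f (x t ω)) ^ 2) P) {ε : ℝ}
    (hfε : ∀ t, ∫ ω, (x t ω - f (x t ω)) ^ 2 ∂P ≤ ε) {N : ℝ} (hN : 0 ≤ N) {n : ℕ} (i j : Fin n) :
    ∫ ω, cellError LX x LY y f N n i j ω ∂P ≤ ε := by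
  obtain ⟨h1, h2⟩ := integral_sq_mul_le hxy hf hy2 hfi hfε i j
  exact (integral_mono (integrable_cellError hx hy hf hN n i j) h1 fun ω => min_le_right _ _).trans h2

lemma integral_sum_cellError_le (hx : ∀ t, Measurable (x t)) (hy : ∀ t, Measurable (y t))
    (hxy : IndepPatterned LX x LY y P) (hf : Measurable f)
    (hy2 : UnitSecondMoment y P) (hfi : ∀ t, Integrable (fun ω => (x t ω - f (x t ω)) ^ 2) P) {ε : ℝ}
    (hε : 0 ≤ ε) (hfε : ∀ t, ∫ ω, (x t ω - f (x t ω)) ^ 2 ∂P ≤ ε) (n : ℕ) :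
    Integrable (truncError LX x LY y f n) P ∧ ∫ ω, truncError LX x LY y f n ω ∂P ≤ ε := by
  have hi := integrable_cellError (P := P) (LX := LX) (LY := LY) hx hy hf n.cast_nonneg n
  refine ⟨(integrable_finsetSum _ fun i _ => integrable_finsetSum _ fun j _ => hi i j).div_const _, ?_⟩
  unfold truncError
  rw [integral_div, integral_finsetSum _ fun i _ => integrable_finsetSum _ fun j _ => hi i j]
  refine div_le_of_le_mul₀ (by positivity) hε ?_
  calc ∑ i, ∫ ω, ∑ j, cellError LX x LY y f n n i j ω ∂P ≤ ∑ _i : Fin n, ∑ _j : Fin n, ε := by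
        refine Finset.sum_le_sum fun i _ => ?_
        rw [integral_finsetSum _ fun j _ => hi i j]
        exact Finset.sum_le_sum fun j _ =>
          integral_cellError_le hx hy hxy hf hy2 hfi hfε n.cast_nonneg i j
    _ = ε * (n : ℝ) ^ 2 := by simp; ring

lemma BoundedInput.integrable_sub_sq (hx : IIDInput x P) (hf : Measurable f)
    (hfx : BoundedInput (fun k ω => f (x k ω)) P) (t : ιX) :
    Integrable (fun ω => (x t ω - f (x t ω)) ^ 2) P := by
  obtain ⟨C, hC⟩ := hfx.bounded
  have : MemLp (fun ω => f (x t ω)) 2 P := MemLp.of_bound (hfx.measurable t).aestronglyMeasurable C (hC t)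
  exact ((hx.memLp t).sub this).integrable_sq

theorem HasLSDInProbability.of_truncation (hX : LX.Symm) (hY : LY.Symm) (hx : IIDInput x P)
    (hy : ∀ t, Measurable (y t)) (hy2 : UnitSecondMoment y P) (hxy : IndepPatterned LX x LY y P)
    {μ : Measure ℝ} (h : ∀ f : ℝ → ℝ, Measurable f → BoundedInput (fun k ω => f (x k ω)) P →
      HasLSDInProbability (scaledHadamard LX (fun k ω => f (x k ω)) LY y) μ P) :
    HasLSDInProbability (scaledHadamard LX x LY y) μ P := by
  refine HasLSDInProbability.of_approx fun ε hε => ?_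
  obtain ⟨f, hf, hfb, hfε⟩ := hx.exists_truncation hε
  exact ⟨_, truncError LX x LY y f, h f hf hfb, fun n hn ω => spectrallyClose_truncError hX hY hn ω,
    fun n ω => truncError_nonneg n ω, integral_sum_cellError_le hx.measurable hy hxy hf hy2
      (BoundedInput.integrable_sub_sq hx hf hfb) hε.le hfε⟩

end TruncationError

/-! ### Truncated second moments and variances along powers of two -/

/-- The terms grow geometrically while `2ᵐ ≤ z` and decay geometrically afterwards, so the sum is of
order `z`. The sharper bound `6z · 2ᴷ / (2ᴷ + z)` is chosen so that the induction closes. -/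
lemma sum_min_two_pow_sq_div_le {z : ℝ} (hz : 0 ≤ z) (K : ℕ) :
    ∑ m ∈ Finset.range K, min ((2 : ℝ) ^ m) z ^ 2 / 2 ^ m ≤ 6 * z := by
  have key : ∑ m ∈ Finset.range K, min ((2 : ℝ) ^ m) z ^ 2 / 2 ^ m ≤ 6 * z * (2 ^ K / (2 ^ K + z)) := by
    induction K with
    | zero => simp; positivity
    | succ K ih =>
      rw [Finset.sum_range_succ]
      set u : ℝ := 2 ^ K
      have hu : 0 < u := by positivity
      have h2 : (2 : ℝ) ^ (K + 1) = 2 * u := by simp only [u]; ring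
      have h3 : 6 * z * (2 * u / (2 * u + z)) - 6 * z * (u / (u + z)) =
          6 * z ^ 2 * u / ((2 * u + z) * (u + z)) := by
        field_simp; ring
      have h4 : min u z ^ 2 / u ≤ 6 * z ^ 2 * u / ((2 * u + z) * (u + z)) := by
        rw [div_le_div_iff₀ hu (by positivity)]
        rcases le_total u z with h | h
        · rw [min_eq_left h]
          have : (2 * u + z) * (u + z) ≤ 6 * z ^ 2 := by nlinarith
          nlinarith [mul_le_mul_of_nonneg_left this (sq_nonneg u)]
        · rw [min_eq_right h]
          have : (2 * u + z) * (u + z) ≤ 6 * u ^ 2 := by nlinarith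
          nlinarith [mul_le_mul_of_nonneg_left this (sq_nonneg z)]
      rw [h2]
      linarith
  refine key.trans (mul_le_of_le_one_right (by positivity) ?_)
  rw [div_le_one (by positivity)]
  linarith

open Classical in
lemma Link.card_filter_row_le {ι : Type*} {L : Link ι} {Δ : ℕ}
    (hΔ : ∀ (n : ℕ) (t : ι) (k : Fin n), {l : Fin n | L n k l = t}.ncard ≤ Δ) {n : ℕ} (i : Fin n)
    (t : ι) : (Finset.univ.filter fun j => L n i j = t).card ≤ Δ := by
  convert hΔ n t i
  rw [← Set.ncard_coe_finset]; simp

section Dyadic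

variable {Ω : Type*} [MeasurableSpace Ω] {P : Measure Ω} [IsProbabilityMeasure P]

omit [IsProbabilityMeasure P] in
lemma integrable_min_sq [IsFiniteMeasure P] {W : Ω → ℝ} (hW : AEStronglyMeasurable W P)
    (h0 : ∀ ω, 0 ≤ W ω) {N : ℝ} (hN : 0 ≤ N) : Integrable (fun ω => min N (W ω) ^ 2) P := by
  have hm : AEStronglyMeasurable (fun ω => min N (W ω) ^ 2) P :=
    (aestronglyMeasurable_const.inf hW).pow 2
  refine Integrable.of_bound hm (N ^ 2) (Eventually.of_forall fun ω => ?_)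
  rw [Real.norm_of_nonneg (sq_nonneg _)]
  exact pow_le_pow_left₀ (le_min hN (h0 ω)) (min_le_left _ _) 2

lemma summable_integral_min_two_pow_sq {W : Ω → ℝ} (hW : Integrable W P) (h0 : ∀ ω, 0 ≤ W ω) :
    Summable fun m : ℕ => (∫ ω, min ((2 : ℝ) ^ m) (W ω) ^ 2 ∂P) / 2 ^ m := by
  have hi : ∀ m : ℕ, Integrable (fun ω => min ((2 : ℝ) ^ m) (W ω) ^ 2 / 2 ^ m) P := by
    exact fun m => (integrable_min_sq hW.aestronglyMeasurable h0 (by positivity)).div_const _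
  refine summable_of_sum_range_le (c := 6 * ∫ ω, W ω ∂P) (fun m => by positivity) fun K => ?_
  simp only [← integral_div]
  rw [← integral_finsetSum _ fun m _ => hi m, ← integral_const_mul]
  exact integral_mono (integrable_finsetSum _ fun m _ => hi m) (hW.const_mul 6) fun ω =>
    sum_min_two_pow_sq_div_le (h0 ω) K

variable {ιX ιY : Type*} {LX : Link ιX} {LY : Link ιY} {x : ιX → Ω → ℝ} {y : ιY → Ω → ℝ} {f : ℝ → ℝ}

/-- The second moments of the entrywise errors truncated at the levels `2 ^ m` are summable with the
weights `2 ^ (-m)`, uniformly in the entries. -/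
def SummableErrors (LX : Link ιX) (x : ιX → Ω → ℝ) (LY : Link ιY) (y : ιY → Ω → ℝ) (f : ℝ → ℝ)
    (P : Measure Ω) : Prop :=
  ∃ v : ℕ → ℝ, (Summable fun m : ℕ => v m / 2 ^ m) ∧ ∀ m (i j : Fin (2 ^ m)),
    ∫ ω, cellError LX x LY y f (2 ^ m) (2 ^ m) i j ω ^ 2 ∂P ≤ v m

/-- All entries of all sizes have one common error law, represented by the single entry of the
matrix of size one; its integrability is all that is needed. -/
lemma summableErrors_of_iidInput (hx : IIDInput x P) (hy : IIDInput y P)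
    (hxy : IndepPatterned LX x LY y P) (hf : Measurable f)
    (hfi : ∀ t, Integrable (fun ω => (x t ω - f (x t ω)) ^ 2) P) : SummableErrors LX x LY y f P := by
  obtain ⟨hi, -⟩ := integral_sq_mul_le hxy hf hy.unitSecondMoment hfi (fun t => le_of_eq
    ((hx.identDistrib t (LX 1 0 0)).comp (u := fun r => (r - f r) ^ 2) (by fun_prop)).integral_eq)
    (0 : Fin 1) 0
  refine ⟨_, summable_integral_min_two_pow_sq hi fun ω => sq_nonneg _, fun m i j => le_of_eq ?_⟩
  have hid := IdentDistrib.prodMk (hx.identDistrib (LX (2 ^ m) i j) (LX 1 0 0))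
    (hy.identDistrib (LY (2 ^ m) i j) (LY 1 0 0)) (hxy.indepFun_apply i j) (hxy.indepFun_apply 0 0)
  exact (hid.comp (u := fun q : ℝ × ℝ => min ((2 : ℝ) ^ m) (((q.1 - f q.1) * q.2) ^ 2) ^ 2)
    (by fun_prop)).integral_eq

/-- The `y` need not be identically distributed, so they are split off through `min N (a y²) ≤ min N
a · (1 + y²)`. Fourth moments bound the second factor uniformly, and the first has the same law for
all entries. -/
lemma summableErrors_of_momentInput (hx : IIDInput x P) (hy : MomentInput y P)
    (hxy : IndepPatterned LX x LY y P) (hf : Measurable f)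
    (hfi : ∀ t, Integrable (fun ω => (x t ω - f (x t ω)) ^ 2) P) : SummableErrors LX x LY y f P := by
  obtain ⟨C, hC⟩ := hy.moments 4
  have hC4 : ∀ t, Integrable (fun ω => y t ω ^ 4) P ∧ ∫ ω, y t ω ^ 4 ∂P ≤ C := by
    intro t
    have := hC t
    simpa only [(show Even 4 by decide).pow_abs] using this
  have hb : ∀ t, Integrable (fun ω => (1 + y t ω ^ 2) ^ 2) P ∧
      ∫ ω, (1 + y t ω ^ 2) ^ 2 ∂P ≤ 2 + 2 * C := by
    intro t
    have hi' : Integrable (fun ω => 2 + 2 * y t ω ^ 4) P :=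
      (integrable_const 2).add ((hC4 t).1.const_mul 2)
    have hle : ∀ ω, (1 + y t ω ^ 2) ^ 2 ≤ 2 + 2 * y t ω ^ 4 := fun ω => by
      nlinarith [sq_nonneg (y t ω ^ 2 - 1)]
    have hi : Integrable (fun ω => (1 + y t ω ^ 2) ^ 2) P := by
      refine hi'.mono' (((measurable_const.add ((hy.measurable t).pow_const 2)).pow_const
        2).aestronglyMeasurable) (Eventually.of_forall fun ω => ?_)
      rw [Real.norm_of_nonneg (sq_nonneg _)]
      exact hle ω
    refine ⟨hi, (integral_mono hi hi' hle).trans ?_⟩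
    rw [integral_add (integrable_const 2) ((hC4 t).1.const_mul 2), integral_const_mul]
    simpa using (hC4 t).2
  set a : ιX → Ω → ℝ := fun t ω => (x t ω - f (x t ω)) ^ 2
  refine ⟨fun m => (2 + 2 * C) * ∫ ω, min ((2 : ℝ) ^ m) (a (LX 1 0 0) ω) ^ 2 ∂P, ?_, fun m i j => ?_⟩
  · simp only [mul_div_assoc]
    exact (summable_integral_min_two_pow_sq (hfi _) fun ω => sq_nonneg _).mul_left _
  · have hN : (0 : ℝ) ≤ 2 ^ m := by positivity
    set s := LX (2 ^ m) i j
    set t := LY (2 ^ m) i j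
    have hid := ((hx.identDistrib s (LX 1 0 0)).comp
      (u := fun r : ℝ => min ((2 : ℝ) ^ m) ((r - f r) ^ 2) ^ 2) (by fun_prop)).integral_eq
    have hind : IndepFun (fun ω => min ((2 : ℝ) ^ m) (a s ω) ^ 2) (fun ω => (1 + y t ω ^ 2) ^ 2) P :=
      (hxy.indepFun_apply i j).comp (φ := fun r : ℝ => min ((2 : ℝ) ^ m) ((r - f r) ^ 2) ^ 2)
        (ψ := fun r => (1 + r ^ 2) ^ 2) (by fun_prop) (by fun_prop)
    have hia : Integrable (fun ω => min ((2 : ℝ) ^ m) (a s ω) ^ 2) P :=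
      integrable_min_sq (hfi s).aestronglyMeasurable (fun ω => sq_nonneg _) hN
    have hle : ∀ ω, cellError LX x LY y f (2 ^ m) (2 ^ m) i j ω ^ 2 ≤
        min ((2 : ℝ) ^ m) (a s ω) ^ 2 * (1 + y t ω ^ 2) ^ 2 := by
      intro ω
      rw [← mul_pow]
      refine pow_le_pow_left₀ (cellError_nonneg hN _ i j ω) ?_ 2
      have ha : 0 ≤ a s ω := sq_nonneg _
      rw [cellError, mul_pow, min_mul_of_nonneg _ _ (by positivity : 0 ≤ 1 + y t ω ^ 2)]
      refine min_le_min ?_ ?_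
      · nlinarith [mul_nonneg hN (sq_nonneg (y t ω))]
      · show a s ω * y t ω ^ 2 ≤ _
        nlinarith
    calc ∫ ω, cellError LX x LY y f (2 ^ m) (2 ^ m) i j ω ^ 2 ∂P
        ≤ ∫ ω, min ((2 : ℝ) ^ m) (a s ω) ^ 2 * (1 + y t ω ^ 2) ^ 2 ∂P :=
          integral_mono (integrable_cellError_pow hx.measurable hy.measurable hf hN _ i j 2)
            (hind.integrable_mul hia (hb t).1) hle
      _ = (∫ ω, min ((2 : ℝ) ^ m) (a s ω) ^ 2 ∂P) * ∫ ω, (1 + y t ω ^ 2) ^ 2 ∂P :=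
          hind.integral_fun_mul_eq_mul_integral hia.aestronglyMeasurable (hb t).1.aestronglyMeasurable
      _ ≤ (∫ ω, min ((2 : ℝ) ^ m) (a s ω) ^ 2 ∂P) * (2 + 2 * C) :=
          mul_le_mul_of_nonneg_left (hb t).2 (integral_nonneg fun ω => sq_nonneg _)
      _ = _ := by rw [mul_comm]; exact congrArg _ hid

lemma covariance_cellError_eq_zero (hxy : IndepPatterned LX x LY y P)
    (hx : ∀ t, Measurable (x t)) (hy : ∀ t, Measurable (y t)) (hxi : iIndepFun x P)
    (hyi : iIndepFun y P) (hf : Measurable f) {N : ℝ} (hN : 0 ≤ N) {n : ℕ} {i j i' j' : Fin n}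
    (hX : LX n i j ≠ LX n i' j') (hY : LY n i j ≠ LY n i' j') :
    cov[cellError LX x LY y f N n i j, cellError LX x LY y f N n i' j'; P] = 0 := by
  have hind := (iIndepFun_jointInput hxy hx hy hxi hyi n).indepFun_prodMk_prodMk
    (fun k => (measurable_pi_apply k).comp (measurable_jointInput hx hy n))
    (Sum.inl (LX.toValues n i j)) (Sum.inr (LY.toValues n i j))
    (Sum.inl (LX.toValues n i' j')) (Sum.inr (LY.toValues n i' j'))
    (fun h => hX (congrArg Subtype.val (Sum.inl_injective h))) (by simp) (by simp) 
    (fun h => hY (congrArg Subtype.val (Sum.inr_injective h)))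
  have hind' := hind.comp (φ := fun q : ℝ × ℝ => min N (((q.1 - f q.1) * q.2) ^ 2))
    (ψ := fun q : ℝ × ℝ => min N (((q.1 - f q.1) * q.2) ^ 2)) (by fun_prop) (by fun_prop)
  have hL : ∀ i j, MemLp (cellError LX x LY y f N n i j) 2 P := fun i j =>
    MemLp.of_bound (measurable_cellError hx hy hf N n i j).aestronglyMeasurable N
      (Eventually.of_forall fun ω => by
        rw [Real.norm_of_nonneg (cellError_nonneg hN n i j ω)]; exact min_le_left _ _)
  exact IndepFun.covariance_eq_zero hind' (hL i j) (hL i' j')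

open Classical in
-- Two cells are uncorrelated unless they share an `X`-value or a `Y`-value. For each of the `n²`
-- cells this leaves at most `n (ΔX + ΔY)` partners, and each covariance is at most `v` since the
-- cells are nonnegative.
lemma variance_sum_cellError_le (hxy : IndepPatterned LX x LY y P)
    (hx : ∀ t, Measurable (x t)) (hy : ∀ t, Measurable (y t)) (hxi : iIndepFun x P)
    (hyi : iIndepFun y P) (hf : Measurable f) {ΔX ΔY : ℕ}
    (hΔX : ∀ (n : ℕ) (t : ιX) (k : Fin n), {l : Fin n | LX n k l = t}.ncard ≤ ΔX)
    (hΔY : ∀ (n : ℕ) (t : ιY) (k : Fin n), {l : Fin n | LY n k l = t}.ncard ≤ ΔY)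
    {N : ℝ} (hN : 0 ≤ N) {n : ℕ} {v : ℝ}
    (hv : ∀ i j, ∫ ω, cellError LX x LY y f N n i j ω ^ 2 ∂P ≤ v) :
    variance (fun ω => ∑ i, ∑ j, cellError LX x LY y f N n i j ω) P ≤ (ΔX + ΔY) * n ^ 3 * v := by
  set Z : Fin n × Fin n → Ω → ℝ := fun p => cellError LX x LY y f N n p.1 p.2
  have hZm : ∀ p, Measurable (Z p) := fun p => measurable_cellError hx hy hf N n _ _
  have hZ0 : ∀ p ω, 0 ≤ Z p ω := fun p ω => cellError_nonneg hN n _ _ ω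
  have hL : ∀ p, MemLp (Z p) 2 P := fun p =>
    MemLp.of_bound (hZm p).aestronglyMeasurable N (Eventually.of_forall fun ω => by
      rw [Real.norm_of_nonneg (hZ0 p ω)]; exact min_le_left _ _)
  have hcov : ∀ p q, cov[Z p, Z q; P] ≤ v := by
    intro p q
    rw [covariance_eq_sub (hL p) (hL q)]
    have h1 : 0 ≤ P[Z p] * P[Z q] := mul_nonneg (integral_nonneg (hZ0 p)) (integral_nonneg (hZ0 q))
    have h2 : P[Z p * Z q] ≤ ∫ ω, (Z p ω ^ 2 + Z q ω ^ 2) / 2 ∂P := by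
      refine integral_mono ((hL p).integrable_mul (hL q))
        (((hL p).integrable_sq.add (hL q).integrable_sq).div_const 2) fun ω => ?_
      simp only [Pi.mul_apply]
      nlinarith [sq_nonneg (Z p ω - Z q ω)]
    rw [integral_div, integral_add (hL p).integrable_sq (hL q).integrable_sq] at h2
    have h3 := hv p.1 p.2
    have h4 := hv q.1 q.2
    change ∫ ω, Z p ω ^ 2 ∂P ≤ v at h3
    change ∫ ω, Z q ω ^ 2 ∂P ≤ v at h4
    linarith
  have hcov' : ∀ p q, cov[Z p, Z q; P] ≤
      (if LX n q.1 q.2 = LX n p.1 p.2 then v else 0) + if LY n q.1 q.2 = LY n p.1 p.2 then v else 0 := by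
    intro p q
    have hv0 : 0 ≤ v := (integral_nonneg fun ω => sq_nonneg _).trans (hv p.1 p.2)
    by_cases hX : LX n q.1 q.2 = LX n p.1 p.2
    · rw [if_pos hX]
      have : 0 ≤ if LY n q.1 q.2 = LY n p.1 p.2 then v else 0 := by split_ifs <;> simp [hv0]
      linarith [hcov p q]
    · by_cases hY : LY n q.1 q.2 = LY n p.1 p.2
      · rw [if_neg hX, if_pos hY, zero_add]; exact hcov p q
      · rw [if_neg hX, if_neg hY, add_zero]
        exact (covariance_cellError_eq_zero hxy hx hy hxi hyi hf hN (Ne.symm hX) (Ne.symm hY)).le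
  rcases isEmpty_or_nonempty (Fin n × Fin n) with hE | ⟨⟨p₀⟩⟩
  · have : n = 0 := by
      by_contra h
      exact hE.elim (⟨0, Nat.pos_of_ne_zero h⟩, ⟨0, Nat.pos_of_ne_zero h⟩)
    subst this
    simp only [Finset.univ_eq_empty, Finset.sum_empty, CharP.cast_eq_zero, ne_eq, OfNat.ofNat_ne_zero,
      not_false_eq_true, zero_pow, mul_zero, zero_mul]
    exact (variance_zero P).le
  have hv0 : 0 ≤ v := (integral_nonneg fun ω => sq_nonneg _).trans (hv p₀.1 p₀.2)
  have hsum : (fun ω => ∑ i, ∑ j, cellError LX x LY y f N n i j ω) = ∑ p, Z p := by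
    ext ω
    rw [Finset.sum_apply, Fintype.sum_prod_type]
  rw [hsum, ← covariance_self (memLp_finsetSum' _ fun p _ => hL p).aestronglyMeasurable.aemeasurable,
    covariance_sum_sum hL hL]
  calc ∑ p, ∑ q, cov[Z p, Z q; P] ≤ ∑ p : Fin n × Fin n, ((n * ΔX : ℕ) * v + (n * ΔY : ℕ) * v) := by
        refine Finset.sum_le_sum fun p _ => ?_
        refine (Finset.sum_le_sum fun q _ => hcov' p q).trans ?_
        rw [Finset.sum_add_distrib, ← Finset.sum_filter, ← Finset.sum_filter, Finset.sum_const,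
          Finset.sum_const, nsmul_eq_mul, nsmul_eq_mul]
        gcongr
        · exact card_filter_le_of_row (Link.card_filter_row_le hΔX) _
        · exact card_filter_le_of_row (Link.card_filter_row_le hΔY) _
    _ = (ΔX + ΔY) * n ^ 3 * v := by
        simp only [Finset.sum_const, Finset.card_univ, Fintype.card_prod, Fintype.card_fin, nsmul_eq_mul]
        push_cast; ring

end Dyadic

/-! ### Almost sure control of the truncation error for constant links -/

section AlmostSure

variable {ιX ιY Ω : Type*} {LX : Link ιX} {LY : Link ιY} {x : ιX → Ω → ℝ} {y : ιY → Ω → ℝ} {f : ℝ → ℝ}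

/-- For constant links the smaller array is a corner of the larger one, and raising the truncation
level from `n` to `N` only increases the nonnegative terms. The factor `4` is the worst ratio of
`N²` to `n²`. -/
lemma truncError_le_of_isConstant (hX : LX.IsConstant) (hY : LY.IsConstant) {n N : ℕ} (hn : n ≠ 0)
    (h1 : n ≤ N) (h2 : N ≤ 2 * n) (ω : Ω) :
    truncError LX x LY y f n ω ≤ 4 * ((∑ i, ∑ j, cellError LX x LY y f N N i j ω) / (N : ℝ) ^ 2) := by
  obtain ⟨lX, hlX⟩ := hX
  obtain ⟨lY, hlY⟩ := hY
  set e : ℝ → ℕ → ℕ → ℝ := fun K i j => min K (((x (lX i j) ω - f (x (lX i j) ω)) * y (lY i j) ω) ^ 2)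
  have he : ∀ (K : ℝ) (k : ℕ), ∑ i, ∑ j, cellError LX x LY y f K k i j ω =
      ∑ i ∈ Finset.range k, ∑ j ∈ Finset.range k, e K i j := by
    intro K k
    rw [Finset.sum_range]
    refine Finset.sum_congr rfl fun i _ => ?_
    rw [Finset.sum_range]
    refine Finset.sum_congr rfl fun j _ => ?_
    simp only [cellError, hlX, hlY, e]
  have he0 : ∀ i j, 0 ≤ e N i j := fun i j => le_min N.cast_nonneg (sq_nonneg _)
  have hsub := Finset.range_subset_range.2 h1
  have hle : ∑ i ∈ Finset.range n, ∑ j ∈ Finset.range n, e n i j ≤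
      ∑ i ∈ Finset.range N, ∑ j ∈ Finset.range N, e N i j := by
    calc _ ≤ ∑ i ∈ Finset.range n, ∑ j ∈ Finset.range N, e N i j := by
          refine Finset.sum_le_sum fun i _ => ?_
          refine (Finset.sum_le_sum fun j _ => ?_).trans
            (Finset.sum_le_sum_of_subset_of_nonneg hsub fun j _ _ => he0 i j)
          exact min_le_min_right _ (Nat.cast_le.2 h1)
      _ ≤ _ := Finset.sum_le_sum_of_subset_of_nonneg hsub fun i _ _ =>
          Finset.sum_nonneg fun j _ => he0 i j
  rw [truncError, he, he]
  have hn0 : (0 : ℝ) < n := Nat.cast_pos.2 (Nat.pos_of_ne_zero hn)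
  have hN0 : (0 : ℝ) < N := hn0.trans_le (Nat.cast_le.2 h1)
  have h2' : (N : ℝ) ≤ 2 * n := by exact_mod_cast h2
  have h0 : 0 ≤ ∑ i ∈ Finset.range N, ∑ j ∈ Finset.range N, e N i j :=
    Finset.sum_nonneg fun i _ => Finset.sum_nonneg fun j _ => he0 i j
  rw [mul_div_assoc', div_le_div_iff₀ (by positivity) (by positivity)]
  have h3 : (N : ℝ) ^ 2 ≤ 4 * n ^ 2 := by nlinarith
  nlinarith [mul_le_mul hle h3 (by positivity) h0]

variable [MeasurableSpace Ω] {P : Measure Ω} [IsProbabilityMeasure P]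

/-- At size `2ᵐ` the variance of the average is at most `(ΔX + ΔY) v m / 2ᵐ`, which is summable, so
the average approaches its mean, itself at most `ε / 8`. Eventually it is below `ε / 4`, and
interpolation between powers of two costs the factor `4`. -/
lemma ae_eventually_truncError_le (hX : LX.IsConstant) (hY : LY.IsConstant)
    (hXB : LX.PropertyB) (hYB : LY.PropertyB) (hx : ∀ t, Measurable (x t)) (hy : ∀ t, Measurable (y t))
    (hxi : iIndepFun x P) (hyi : iIndepFun y P) (hxy : IndepPatterned LX x LY y P) (hf : Measurable f)
    (hy2 : UnitSecondMoment y P) (hfi : ∀ t, Integrable (fun ω => (x t ω - f (x t ω)) ^ 2) P) {ε : ℝ}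
    (hε : 0 < ε) (hfε : ∀ t, ∫ ω, (x t ω - f (x t ω)) ^ 2 ∂P ≤ ε / 8)
    (hs : SummableErrors LX x LY y f P) :
    ∀ᵐ ω ∂P, ∀ᶠ n in atTop, truncError LX x LY y f n ω ≤ ε := by
  obtain ⟨ΔX, hΔX⟩ := hXB
  obtain ⟨ΔY, hΔY⟩ := hYB
  obtain ⟨v, hv, hvb⟩ := hs
  set Z : ℕ → Ω → ℝ := fun m ω => ∑ i, ∑ j, cellError LX x LY y f (2 ^ m) (2 ^ m) i j ω
  have hi : ∀ m i j, Integrable (cellError LX x LY y f (2 ^ m) (2 ^ m) i j) P := fun m i j =>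
    integrable_cellError hx hy hf (by positivity) _ i j
  have hZm : ∀ m, Measurable (Z m) := fun m => Finset.measurable_fun_sum _ fun i _ =>
    Finset.measurable_fun_sum _ fun j _ => measurable_cellError hx hy hf _ _ i j
  have hZ0 : ∀ m ω, 0 ≤ Z m ω := fun m ω => Finset.sum_nonneg fun i _ => Finset.sum_nonneg fun j _ =>
    cellError_nonneg (by positivity) _ i j ω
  have hZb : ∀ m ω, Z m ω ≤ (2 ^ m) ^ 3 := by
    intro m ω
    calc Z m ω ≤ ∑ _i : Fin (2 ^ m), ∑ _j : Fin (2 ^ m), (2 : ℝ) ^ m :=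
          Finset.sum_le_sum fun i _ => Finset.sum_le_sum fun j _ => min_le_left _ _
      _ = (2 ^ m) ^ 3 := by
          simp only [Finset.sum_const, Finset.card_univ, Fintype.card_fin, nsmul_eq_mul]
          push_cast; ring
  have hZL : ∀ m, MemLp (Z m) 2 P := fun m => MemLp.of_bound (hZm m).aestronglyMeasurable ((2 ^ m) ^ 3)
    (Eventually.of_forall fun ω => by rw [Real.norm_of_nonneg (hZ0 m ω)]; exact hZb m ω)
  have hmean : ∀ m, (∫ ω, Z m ω ∂P) / (2 ^ m) ^ 2 ≤ ε / 8 := by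
    intro m
    rw [div_le_iff₀ (by positivity)]
    calc ∫ ω, Z m ω ∂P ≤ ∑ _i : Fin (2 ^ m), ∑ _j : Fin (2 ^ m), ε / 8 := by
          rw [integral_finsetSum _ fun i _ => integrable_finsetSum _ fun j _ => hi m i j]
          refine Finset.sum_le_sum fun i _ => ?_
          rw [integral_finsetSum _ fun j _ => hi m i j]
          exact Finset.sum_le_sum fun j _ =>
            integral_cellError_le hx hy hxy hf hy2 hfi hfε (by positivity) i j
      _ = ε / 8 * (2 ^ m) ^ 2 := by
          simp only [Finset.sum_const, Finset.card_univ, Fintype.card_fin, nsmul_eq_mul]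
          push_cast; ring
  have hae := ae_tendsto_zero_of_summable_integral (P := P)
    (F := fun m ω => (Z m ω - ∫ ω', Z m ω' ∂P) ^ 2 / (2 ^ m) ^ 4)
    (fun m => (((hZL m).sub (memLp_const _)).integrable_sq).div_const _)
    (fun m ω => by positivity) (by
      refine Summable.of_nonneg_of_le (fun m => integral_nonneg fun ω => by positivity) (fun m => ?_)
        (hv.mul_left ((ΔX : ℝ) + ΔY))
      rw [integral_div, ← variance_eq_integral (hZm m).aemeasurable, div_le_iff₀ (by positivity)]
      refine (variance_sum_cellError_le hxy hx hy hxi hyi hf hΔX hΔY (by positivity)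
        (hvb m)).trans_eq ?_
      push_cast
      field_simp)
  filter_upwards [hae] with ω hω
  have h1 : ∀ᶠ m in atTop, Z m ω / (2 ^ m) ^ 2 ≤ ε / 4 := by
    filter_upwards [hω.eventually_lt_const (show 0 < (ε / 8) ^ 2 by positivity)] with m hm
    have h2 : ((Z m ω - ∫ ω', Z m ω' ∂P) / (2 ^ m) ^ 2) ^ 2 < (ε / 8) ^ 2 := by
      rw [div_pow, ← pow_mul]; exact hm
    have h3 := (abs_lt.1 (abs_lt_of_sq_lt_sq h2 (by positivity))).2
    rw [sub_div] at h3
    linarith [hmean m]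
  obtain ⟨M, hM⟩ := eventually_atTop.1 h1
  filter_upwards [eventually_ge_atTop (2 ^ M)] with n hn
  have hn0 : n ≠ 0 := by
    have : 0 < 2 ^ M := by positivity
    omega
  have hlog : M ≤ Nat.log 2 n := by
    have := Nat.log_mono_right (b := 2) hn
    rwa [Nat.log_pow one_lt_two] at this
  -- The comparison size is `2 ^ (log₂ n + 1)`, which lies between `n` and `2n`.
  have h2 := truncError_le_of_isConstant (x := x) (y := y) (f := f) hX hY hn0
    (Nat.lt_pow_succ_log_self one_lt_two n).le
    (by rw [pow_succ, mul_comm]; exact Nat.mul_le_mul_left 2 (Nat.pow_log_le_self 2 hn0)) ω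
  have h3 := hM (Nat.log 2 n + 1) (by omega)
  rw [Nat.succ_eq_add_one, Nat.cast_pow, Nat.cast_two] at h2
  have h4 : Z (Nat.log 2 n + 1) ω / (2 ^ (Nat.log 2 n + 1)) ^ 2 ≤ ε / 4 := h3
  simp only [Z] at h4
  linarith

theorem HasLSDAlmostSurely.of_truncation (hXs : LX.Symm) (hYs : LY.Symm)
    (hX : LX.IsConstant) (hY : LY.IsConstant)
    (hXB : LX.PropertyB) (hYB : LY.PropertyB) (hx : IIDInput x P) (hy : IIDInput y P ∨ MomentInput y P)
    (hxy : IndepPatterned LX x LY y P)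
    {μ : Measure ℝ} (h : ∀ f : ℝ → ℝ, Measurable f → BoundedInput (fun k ω => f (x k ω)) P →
      HasLSDAlmostSurely (scaledHadamard LX (fun k ω => f (x k ω)) LY y) μ P) :
    HasLSDAlmostSurely (scaledHadamard LX x LY y) μ P := by
  refine HasLSDAlmostSurely.of_approx fun ε hε => ?_
  obtain ⟨f, hf, hfb, hfε⟩ := hx.exists_truncation (show 0 < ε / 8 by positivity)
  have hfi := BoundedInput.integrable_sub_sq hx hf hfb
  refine ⟨_, truncError LX x LY y f, h f hf hfb,
    fun n hn ω => spectrallyClose_truncError hXs hYs hn ω, ?_⟩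
  rcases hy with hy | hy
  · exact ae_eventually_truncError_le hX hY hXB hYB hx.measurable hy.measurable hx.indep hy.indep hxy hf
      hy.unitSecondMoment hfi hε hfε (summableErrors_of_iidInput hx hy hxy hf hfi)
  · exact ae_eventually_truncError_le hX hY hXB hYB hx.measurable hy.measurable hx.indep hy.indep hxy hf
      hy.unitSecondMoment hfi hε hfε (summableErrors_of_momentInput hx hy hxy hf hfi)

end AlmostSure

/-! ### From bounded inputs to all admissible inputs -/

section Universality

variable {ιX ιY Ω : Type*} [MeasurableSpace Ω] {P : Measure Ω} [IsProbabilityMeasure P]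
  {LX : Link ιX} {LY : Link ιY} {x : ιX → Ω → ℝ} {y : ιY → Ω → ℝ} {μ : Measure ℝ}

/-- The products of independent patterned matrices on `(Ω, P)` with inputs that have moments of all
orders have limiting spectral distribution `μ` almost surely. -/
def IsMomentLSD (LX : Link ιX) (LY : Link ιY) (μ : Measure ℝ) (P : Measure Ω) : Prop :=
  ∀ (x : ιX → Ω → ℝ) (y : ιY → Ω → ℝ), MomentInput x P → MomentInput y P → IndepPatterned LX x LY y P →
    HasLSDAlmostSurely (scaledHadamard LX x LY y) μ P

/-- The inputs are truncated one at a time. With `x` already having all moments, an i.i.d. `y` is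
removed by exchanging the roles of the two factors; then an i.i.d. `x` is truncated against the
original `y`, for which a unit second moment is enough. -/
lemma IsMomentLSD.hasLSDInProbability (h : IsMomentLSD LX LY μ P) (hX : LX.Symm) (hY : LY.Symm)
    (hx : IIDInput x P ∨ MomentInput x P) (hy : IIDInput y P ∨ MomentInput y P)
    (hxy : IndepPatterned LX x LY y P) : HasLSDInProbability (scaledHadamard LX x LY y) μ P := by
  have hM : ∀ x : ιX → Ω → ℝ, MomentInput x P → IndepPatterned LX x LY y P →
      HasLSDInProbability (scaledHadamard LX x LY y) μ P := by
    intro x hx hxy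
    have hMM : ∀ y : ιY → Ω → ℝ, MomentInput y P → IndepPatterned LX x LY y P →
        HasLSDInProbability (scaledHadamard LX x LY y) μ P := fun y hy hxy =>
      (h x y hx hy hxy).inProbability (isHermitian_scaledHadamard hX hY)
        (measurable_scaledHadamard hx.measurable hy.measurable)
    rcases hy with hy | hy
    · rw [scaledHadamard_comm]
      refine .of_truncation hY hX hy hx.measurable hx.unitSecondMoment hxy.symm fun f hf hfb => ?_
      rw [scaledHadamard_comm]
      exact hMM _ (.of_bounded hfb) (hxy.symm.comp_left hf).symm
    · exact hMM y hy hxy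
  rcases hx with hx | hx
  · exact .of_truncation hX hY hx (hy.elim (·.measurable) (·.measurable))
      (hy.elim (·.unitSecondMoment) (·.unitSecondMoment)) hxy fun f hf hfb =>
        hM _ (.of_bounded hfb) (hxy.comp_left hf)
  · exact hM x hx hxy

lemma IsMomentLSD.hasLSDAlmostSurely (h : IsMomentLSD LX LY μ P) (hX : LX.Symm) (hY : LY.Symm)
    (hXc : LX.IsConstant) (hYc : LY.IsConstant) (hXB : LX.PropertyB) (hYB : LY.PropertyB)
    (hx : IIDInput x P ∨ MomentInput x P) (hy : IIDInput y P ∨ MomentInput y P)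
    (hxy : IndepPatterned LX x LY y P) : HasLSDAlmostSurely (scaledHadamard LX x LY y) μ P := by
  have hM : ∀ x : ιX → Ω → ℝ, MomentInput x P → IndepPatterned LX x LY y P →
      HasLSDAlmostSurely (scaledHadamard LX x LY y) μ P := by
    intro x hx hxy
    rcases hy with hy | hy
    · rw [scaledHadamard_comm]
      refine .of_truncation hY hX hYc hXc hYB hXB hy (.inr hx) hxy.symm fun f hf hfb => ?_
      rw [scaledHadamard_comm]
      exact h x _ hx (.of_bounded hfb) (hxy.symm.comp_left hf).symm
    · exact h x y hx hy hxy
  rcases hx with hx | hx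
  · exact .of_truncation hX hY hXc hYc hXB hYB hx hy hxy fun f hf hfb =>
      hM _ (.of_bounded hfb) (hxy.comp_left hf)
  · exact hM x hx hxy

lemma exists_measurable_momentInput (hx : IIDInput x P ∨ MomentInput x P) :
    ∃ f : ℝ → ℝ, Measurable f ∧ MomentInput (fun k ω => f (x k ω)) P := by
  rcases hx with hx | hx
  · obtain ⟨f, hf, hfb, -⟩ := hx.exists_truncation one_pos
    exact ⟨f, hf, .of_bounded hfb⟩
  · exact ⟨id, measurable_id, hx⟩

lemma iidInput_or_momentInput (hx : BoundedInput x P ∨ IIDInput x P ∨ MomentInput x P) :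
    IIDInput x P ∨ MomentInput x P := by
  rcases hx with hx | hx
  · exact .inr (.of_bounded hx)
  · exact hx

lemma momentInput_of_or (hx : BoundedInput x P ∨ MomentInput x P) : MomentInput x P :=
  hx.elim .of_bounded id

end Universality

theorem mainTheorem6 {ιX ιY ιU ιV Ω Ω' : Type*} [MeasurableSpace Ω] [MeasurableSpace Ω']
    (P : Measure Ω) [IsProbabilityMeasure P] (P' : Measure Ω') [IsProbabilityMeasure P']
    (LX : Link ιX) (LY : Link ιY) (hXsymm : LX.Symm) (hYsymm : LY.Symm)
    (hXB : LX.PropertyB) (hYB : LY.PropertyB)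
    (hXgrowth : LX.GrowthConditions) (hYgrowth : LY.GrowthConditions)
    (hpZ : WordLimitsExist LX LY)
    (x : ιX → Ω → ℝ) (y : ιY → Ω → ℝ)
    (hx : BoundedInput x P ∨ IIDInput x P ∨ MomentInput x P)
    (hy : BoundedInput y P ∨ IIDInput y P ∨ MomentInput y P)
    (hxy : IndepPatterned LX x LY y P)
    (ρ₁ : ℕ → ιX → ιU) (ρ₂ : ℕ → ιY → ιV)
    (hρ₁ : ∀ n, Function.Injective (ρ₁ n)) (hρ₂ : ∀ n, Function.Injective (ρ₂ n))
    (LU : Link ιU) (LV : Link ιV) (hLU : LU = LX.comp ρ₁) (hLV : LV = LY.comp ρ₂)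
    (u : ιU → Ω' → ℝ) (v : ιV → Ω' → ℝ)
    (hu : BoundedInput u P' ∨ IIDInput u P' ∨ MomentInput u P')
    (hv : BoundedInput v P' ∨ IIDInput v P' ∨ MomentInput v P')
    (huv : IndepPatterned LU u LV v P') :
    ∃ μ : Measure ℝ, IsProbabilityMeasure μ ∧
      HasLSDInProbability (scaledHadamard LX x LY y) μ P ∧
      HasLSDInProbability (scaledHadamard LU u LV v) μ P' ∧
      ((BoundedInput x P ∨ MomentInput x P) ∧ (BoundedInput y P ∨ MomentInput y P) ∨
          LX.IsConstant ∧ LY.IsConstant →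
        HasLSDAlmostSurely (scaledHadamard LX x LY y) μ P) ∧
      ((BoundedInput u P' ∨ MomentInput u P') ∧ (BoundedInput v P' ∨ MomentInput v P') ∨
          LU.IsConstant ∧ LV.IsConstant →
        HasLSDAlmostSurely (scaledHadamard LU u LV v) μ P') := by
  have hx := iidInput_or_momentInput hx
  have hy := iidInput_or_momentInput hy
  have hu := iidInput_or_momentInput hu
  have hv := iidInput_or_momentInput hv
  obtain ⟨β, hβ⟩ := Link.exists_hasWordMoments hpZ
  obtain ⟨Δ, hΔ⟩ := hβ.exists_le hXB
  -- The construction of `μ` needs one sequence of measures with limit moments `β`. The given inputs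
  -- may lack moments, so measurable functions of them are used; any other input with all moments
  -- leads to the same `μ`.
  obtain ⟨f, hf, hfx⟩ := exists_measurable_momentInput hx
  obtain ⟨g, hg, hgy⟩ := exists_measurable_momentInput hy
  obtain ⟨μ, hμ⟩ := exists_tendsto_of_hasMomentLimits (tendsto_evenMoments_div_factorial hΔ)
    (hasMomentLimits_expectedESDSeq hXsymm hYsymm hXB hYB hfx hgy
      ((hxy.comp_left hf).symm.comp_left hg).symm hβ)
  have hXY : IsMomentLSD LX LY (μ : Measure ℝ) P := fun x y hx hy hxy =>
    hasLSDAlmostSurely_of_momentInput hXsymm hYsymm hXB hYB hx hy hxy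
      (hμ _ (hasMomentLimits_expectedESDSeq hXsymm hYsymm hXB hYB hx hy hxy hβ))
  have hUs : LU.Symm := fun n i j => by rw [hLU]; exact congrArg (ρ₁ n) (hXsymm n i j)
  have hVs : LV.Symm := fun n i j => by rw [hLV]; exact congrArg (ρ₂ n) (hYsymm n i j)
  have hUB : LU.PropertyB := hLU ▸ hXB.comp hρ₁
  have hVB : LV.PropertyB := hLV ▸ hYB.comp hρ₂
  have hβ' : LU.HasWordMoments LV β := by rw [hLU, hLV]; exact hβ.comp hρ₁ hρ₂
  -- The same `μ` appears because the relabelled links have the same limit moments `β`, whatever the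
  -- probability space.
  have hUV : IsMomentLSD LU LV (μ : Measure ℝ) P' := fun u v hu hv huv =>
    hasLSDAlmostSurely_of_momentInput hUs hVs hUB hVB hu hv huv
      (hμ _ (hasMomentLimits_expectedESDSeq hUs hVs hUB hVB hu hv huv hβ'))
  refine ⟨μ, inferInstance, hXY.hasLSDInProbability hXsymm hYsymm hx hy hxy,
    hUV.hasLSDInProbability hUs hVs hu hv huv, ?_, ?_⟩
  · rintro (⟨h1, h2⟩ | ⟨h1, h2⟩)
    · exact hXY x y (momentInput_of_or h1) (momentInput_of_or h2) hxy
    · exact hXY.hasLSDAlmostSurely hXsymm hYsymm h1 h2 hXB hYB hx hy hxy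
  · rintro (⟨h1, h2⟩ | ⟨h1, h2⟩)
    · exact hUV u v (momentInput_of_or h1) (momentInput_of_or h2) huv
    · exact hUV.hasLSDAlmostSurely hUs hVs h1 h2 hUB hVB hu hv huv
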